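/- A time-varying graph (TVG) $\mathcal G$ is a finite connected graph $G=(V,E)$ with $n=|V|$ together with a presence function $\rho(e,t)\in\{0,1\}$ for $e\in E$, $t\in\mathbb N$; crossing an edge $e$ that is present at time $t$ takes one time step, and waiting is allowed. It is in class $\mathcal P$ with period $p$ if every edge recurs (is present at arbitrarily late times) and $\rho(e,t)=\rho(e,t+kp)$ for all $e,t,k$. The single-agent problem DMVP asks, given a start vertex $o$, for a journey from $o$ starting at time $0$ that visits all vertices and whose arrival date is least. Theorem. Consider DMVP in $\mathcal P$ with period $p=2$ over a tree. (1) It is solvable in $O(n)$ time: there are one random access machine program and a constant $C$ such that, given $n$, the start vertex $o$, the edges of a tree on $\{0,\dots,n-1\}$ listed in any order, and the availability of each edge at times $0$ and $1$, the program halts within $Cn$ elementary steps (all words written and addresses written to being at most $Cn$) and outputs an optimal journey together with its cost. For the remaining parts root the tree at $o$. Let $T^u$ be the maximal subtree at $u$, and for a child $u$ of $v$ let $B^{u}$ be the branch at $v$ consisting of $v$, the edge $vu$ and $T^u$, rooted at $v$. For a rooted part $S$ (some $T^u$ or $B^u$) let $c_w(S,t)$ and $c(S,t)$ be the least time needed,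 starting at the root of $S$ at date $t$ and moving inside $S$, to visit all of $S$ with and without return to the root of $S$, respectively, and let $m_w(S)=\min_t c_w(S,t)$. Say that $S$ is of type $fw11$ if $c_w(S,t)=m_w(S)$ for all $t$, $fw10$ if this holds exactly for even $t$, and $fw01$ if it holds exactly for odd $t$. (2) Some optimal solution enters each subtree $T^u$, $u\ne o$ (in particular the subtree of each child of $o$), exactly once. (3) Each $T^u$ and each $B^u$ can be covered with return from every start date and is of one of the types $fw11$, $fw10$, $fw01$; $m_w$ is even for type $fw11$ and odd for types $fw10$ and $fw01$. (4) The costs obey the following recursion. Write $\chi_e(t)$ for the first date by which an agent at an end of $e$ at date $t$ can have crossed $e$. For a child $u$ of $v$, with $e=vu$ and $t_1=\chi_e(t)$, $$t+c_w(B^u,t)=\chi_e\bigl(t_1+c_w(T^u,t_1)\bigr),\qquad t+c(B^u,t)=t_1+c(T^u,t_1).$$ Call an order of some children of $v$ alternating from date $t$ if their branches alternate between types $fw10$ and $fw01$, beginning with the type that is fast at the parity of $t$, for as long as a branch of the required type is left, followed by the remaining branches in any order. An alternating order of all children of $v$ exists for every $t$, and covering the branches in any such order from date $t$, each with foremost return,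 is optimal: it takes exactly the time $c_w(T^v,t)$. If $v$ has no child then $c(T^v,t)=0$; otherwise $c(T^v,t)$ is the least cost obtained by choosing a last child $u$ of $v$, covering the branches of the other children with foremost returns in an order alternating from $t$, and then covering $B^u$ without return at cost $c(B^u,\cdot)$. -/

import Mathlib

/-- A discrete time-varying graph with lifetime `ℕ`, undirected edges and unit latency.
Only the values of `present` on edges of the underlying graph matter. -/
structure TVG (V : Type*) where
  /-- the underlying graph -/
  graph : SimpleGraph V
  /-- the presence function: `present e t` says that the edge `e` is available at time `t` -/
  present : Sym2 V → ℕ → Prop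

namespace TVG

variable {V : Type*}

/-- Periodic time-varying graphs of period `p`, as a subclass of the recurrent ones: the
underlying graph is connected, every edge recurs, and availability is `p`-periodic. -/
structure IsPeriodic (G : TVG V) (p : ℕ) : Prop where
  pos : 0 < p
  connected : G.graph.Connected
  recurrent : ∀ e ∈ G.graph.edgeSet, ∀ t, ∃ t', t < t' ∧ G.present e t'
  periodic : ∀ e ∈ G.graph.edgeSet, ∀ t k, G.present e t ↔ G.present e (t + k * p)

/-- A journey of an agent who is at `u` at date `t`, written as the list of its moves
`(target vertex, departure time)`. Crossing an edge takes one time step; waiting is allowed. -/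
def IsJourney (G : TVG V) : V → ℕ → List (V × ℕ) → Prop
  | _, _, [] => True
  | u, t, (v, τ) :: J =>
      G.graph.Adj u v ∧ G.present s(u, v) τ ∧ t ≤ τ ∧ IsJourney G v (τ + 1) J

/-- The arrival date of a journey started at date `t`. -/
def arrival : ℕ → List (V × ℕ) → ℕ
  | t, [] => t
  | _, (_, τ) :: J => arrival (τ + 1) J

/-- The vertices visited by a journey from `u`, in order. -/
def trace (u : V) (J : List (V × ℕ)) : List V := u :: J.map Prod.fst

/-- The last vertex of a journey from `u`. -/
def endpoint : V → List (V × ℕ) → V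
  | u, [] => u
  | _, (v, _) :: J => endpoint v J

open Classical in
/-- The number of moves of a journey from `u` that enter `S` from outside. -/
noncomputable def entries (S : Set V) : V → List (V × ℕ) → ℕ
  | _, [] => 0
  | u, (v, _) :: J => (if u ∉ S ∧ v ∈ S then 1 else 0) + entries S v J

/-- `J` is a journey from `r`, starting at date `t`, inside `S`, that visits all of `S`. -/
structure IsCoverage (G : TVG V) (S : Set V) (r : V) (t : ℕ) (J : List (V × ℕ)) : Prop where
  journey : G.IsJourney r t J
  inside : ∀ v ∈ trace r J, v ∈ S
  covers : ∀ v ∈ S, v ∈ trace r J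

/-- `J` is an optimal solution of the dynamic map visitation problem for one agent that
starts at `o` at time `0`. -/
def IsOptimal (G : TVG V) (o : V) (J : List (V × ℕ)) : Prop :=
  G.IsCoverage Set.univ o 0 J ∧
    ∀ J', G.IsCoverage Set.univ o 0 J' → arrival 0 J ≤ arrival 0 J'

/-- The possible costs of covering `S` from `r`, starting at date `t`. -/
def coverCosts (G : TVG V) (S : Set V) (r : V) (t : ℕ) : Set ℕ :=
  {c | ∃ J, G.IsCoverage S r t J ∧ arrival t J = t + c}

/-- The possible costs of covering `S` from `r` with return to `r`, starting at date `t`. -/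
def returnCosts (G : TVG V) (S : Set V) (r : V) (t : ℕ) : Set ℕ :=
  {c | ∃ J, G.IsCoverage S r t J ∧ endpoint r J = r ∧ arrival t J = t + c}

/-- The cost of a foremost coverage of `S` from `r` at date `t`. -/
noncomputable def coverCost (G : TVG V) (S : Set V) (r : V) (t : ℕ) : ℕ :=
  sInf (G.coverCosts S r t)

/-- The cost of a foremost coverage with return of `S` from `r` at date `t`. -/
noncomputable def returnCost (G : TVG V) (S : Set V) (r : V) (t : ℕ) : ℕ :=
  sInf (G.returnCosts S r t)

/-- The fastest cost, over all start dates, of covering `S` from `r` with return to `r`. -/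
noncomputable def fastestReturn (G : TVG V) (S : Set V) (r : V) : ℕ :=
  sInf {c | ∃ t, c ∈ G.returnCosts S r t}

/-- A fastest coverage with return is available at date `t`. -/
def FastestAt (G : TVG V) (S : Set V) (r : V) (t : ℕ) : Prop :=
  G.fastestReturn S r ∈ G.returnCosts S r t

/-- A fastest coverage with return is always available. -/
def FW11 (G : TVG V) (S : Set V) (r : V) : Prop := ∀ t, G.FastestAt S r t

/-- A fastest coverage with return is available exactly at even times. -/
def FW10 (G : TVG V) (S : Set V) (r : V) : Prop := ∀ t, G.FastestAt S r t ↔ Even t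

/-- A fastest coverage with return is available exactly at odd times. -/
def FW01 (G : TVG V) (S : Set V) (r : V) : Prop := ∀ t, G.FastestAt S r t ↔ Odd t

/-- The maximal subtree at `u` of a tree rooted at `o`: the vertices `w` such that
every walk from `o` to `w` passes through `u`. -/
def subtree (G : TVG V) (o u : V) : Set V := {w | ∀ q : G.graph.Walk o w, u ∈ q.support}

/-- The children of `v` in the tree rooted at `o`. -/
def children (G : TVG V) (o v : V) : Set V := {u | G.graph.Adj v u ∧ u ∈ G.subtree o v}

/-- The branch at `v` through its child `u`: the subtree at `u` together with the edge
from `v`; it is rooted at `v`. -/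
def branch (G : TVG V) (o v u : V) : Set V := insert v (G.subtree o u)

/-- The foremost date at which the agent, at one end of `e` at date `t`, can have crossed
`e`. -/
noncomputable def crossed (G : TVG V) (e : Sym2 V) (t : ℕ) : ℕ :=
  sInf {τ | t ≤ τ ∧ G.present e τ} + 1

/-- The branch at `v` through `u` has the non-constant type that is fast at date `t`. -/
def Favourable (G : TVG V) (o v : V) (t : ℕ) (u : V) : Prop :=
  (Even t ∧ G.FW10 (G.branch o v u) v) ∨ (Odd t ∧ G.FW01 (G.branch o v u) v)

/-- The list of children of `v` alternates between `fw10` and `fw01` branches, beginning with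
the type that is fast at the start date `t`, as long as this is possible; the rest is in any
order. (After a fast branch of these types the parity of the date has changed.) -/
inductive Alternating (G : TVG V) (o v : V) : ℕ → List V → Prop
  | step (t : ℕ) (u : V) (L : List V) : G.Favourable o v t u → Alternating G o v (t + 1) L →
      Alternating G o v t (u :: L)
  | rest (t : ℕ) (L : List V) : (∀ u ∈ L, ¬ G.Favourable o v t u) → Alternating G o v t L

/-- The date at which the agent is back at `v` if, starting there at date `t`, it covers the
branches through the listed children one after the other, each with foremost return. -/
noncomputable def serve (G : TVG V) (o v : V) : ℕ → List V → ℕ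
  | t, [] => t
  | t, u :: L => serve G o v (t + G.returnCost (G.branch o v u) v t) L

end TVG

namespace RAM

/-- The memory of a random access machine: registers and arrays of natural numbers. -/
structure Mem where
  reg : ℕ → ℕ
  arr : ℕ → ℕ → ℕ

/-- Expressions. Subtraction is truncated, comparisons give `0` or `1`. -/
inductive Expr where
  | const (c : ℕ)
  | reg (x : ℕ)
  | arr (a : ℕ) (i : Expr)
  | add (e f : Expr)
  | sub (e f : Expr)
  | eq (e f : Expr)
  | lt (e f : Expr)
  | parity (e : Expr)

/-- The value of an expression. -/
def Expr.eval (m : Mem) : Expr → ℕ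
  | .const c => c
  | .reg x => m.reg x
  | .arr a i => m.arr a (i.eval m)
  | .add e f => e.eval m + f.eval m
  | .sub e f => e.eval m - f.eval m
  | .eq e f => if e.eval m = f.eval m then 1 else 0
  | .lt e f => if e.eval m < f.eval m then 1 else 0
  | .parity e => e.eval m % 2

/-- The number of elementary steps taken to evaluate an expression. -/
def Expr.cost : Expr → ℕ
  | .const _ => 1
  | .reg _ => 1
  | .arr _ i => i.cost + 1
  | .add e f => e.cost + f.cost + 1
  | .sub e f => e.cost + f.cost + 1
  | .eq e f => e.cost + f.cost + 1
  | .lt e f => e.cost + f.cost + 1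
  | .parity e => e.cost + 1

/-- Programs; a condition holds if its value is not `0`. -/
inductive Prog where
  | skip
  | setReg (x : ℕ) (e : Expr)
  | setArr (a : ℕ) (i e : Expr)
  | seq (P Q : Prog)
  | ite (c : Expr) (P Q : Prog)
  | loop (c : Expr) (P : Prog)

/-- `m` with the value of register `x` replaced by `w`. -/
def Mem.setReg (m : Mem) (x w : ℕ) : Mem :=
  { m with reg := Function.update m.reg x w }

/-- `m` with entry `i` of array `a` replaced by `w`. -/
def Mem.setArr (m : Mem) (a i w : ℕ) : Mem :=
  { m with arr := Function.update m.arr a (Function.update (m.arr a) i w) }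

/-- `Exec W P m k m'`: from memory `m`, the program `P` halts with memory `m'` after exactly `k`
elementary steps, and every word written and every address written to is at most `W`. -/
inductive Exec (W : ℕ) : Prog → Mem → ℕ → Mem → Prop
  | skip (m : Mem) : Exec W .skip m 1 m
  | setReg (m : Mem) (x : ℕ) (e : Expr) : e.eval m ≤ W →
      Exec W (.setReg x e) m (e.cost + 1) (m.setReg x (e.eval m))
  | setArr (m : Mem) (a : ℕ) (i e : Expr) : i.eval m ≤ W → e.eval m ≤ W →
      Exec W (.setArr a i e) m (i.cost + e.cost + 1) (m.setArr a (i.eval m) (e.eval m))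
  | seq (m m' m'' : Mem) (k l : ℕ) (P Q : Prog) : Exec W P m k m' → Exec W Q m' l m'' →
      Exec W (.seq P Q) m (k + l) m''
  | ite_true (m m' : Mem) (k : ℕ) (c : Expr) (P Q : Prog) : c.eval m ≠ 0 → Exec W P m k m' →
      Exec W (.ite c P Q) m (c.cost + 1 + k) m'
  | ite_false (m m' : Mem) (k : ℕ) (c : Expr) (P Q : Prog) : c.eval m = 0 → Exec W Q m k m' →
      Exec W (.ite c P Q) m (c.cost + 1 + k) m'
  | loop_done (m : Mem) (c : Expr) (P : Prog) : c.eval m = 0 →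
      Exec W (.loop c P) m (c.cost + 1) m
  | loop_step (m m' m'' : Mem) (k l : ℕ) (c : Expr) (P : Prog) : c.eval m ≠ 0 →
      Exec W P m k m' → Exec W (.loop c P) m' l m'' →
      Exec W (.loop c P) m (c.cost + 1 + k + l) m''

/-- The memory `m` holds the number `n` of vertices, the start vertex `o`, and a list of the
edges of `G` (in any order, each with its endpoints in any order) together with two bits per
edge for its availability at the dates `0` and `1`; everything else is `0`. -/
structure Encodes {n : ℕ} (G : TVG (Fin n)) (o : Fin n) (m : Mem) : Prop where
  size : m.reg 0 = n
  start : m.reg 1 = o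
  reg_zero : ∀ x, 2 ≤ x → m.reg x = 0
  edges : ∃ e : Fin (n - 1) ≃ G.graph.edgeSet, ∀ j : Fin (n - 1),
    (∃ a b : Fin n, (e j : Sym2 (Fin n)) = s(a, b) ∧ m.arr 0 j = a ∧ m.arr 1 j = b) ∧
    ((G.present (e j) 0 ∧ m.arr 2 j = 1) ∨ (¬ G.present (e j) 0 ∧ m.arr 2 j = 0)) ∧
    ((G.present (e j) 1 ∧ m.arr 3 j = 1) ∨ (¬ G.present (e j) 1 ∧ m.arr 3 j = 0))
  arr_zero : ∀ a i, 4 ≤ a ∨ n - 1 ≤ i → m.arr a i = 0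

/-- The memory `m` holds the cost of the journey `J` from date `0`, its number of moves, and
the list of its moves. -/
structure Outputs {n : ℕ} (m : Mem) (J : List (Fin n × ℕ)) : Prop where
  cost : m.reg 0 = TVG.arrival 0 J
  length : m.reg 1 = J.length
  moves : ∀ k (h : k < J.length), m.arr 0 k = (J[k].1 : ℕ) ∧ m.arr 1 k = J[k].2

end RAM

set_option linter.unusedSimpArgs false

/-! ### Journeys: shifts by even amounts of time, and reduction by reordering. -/

namespace TVG

variable {V : Type*}

section Journeys

variable {G : TVG V}

/-! Availability depends on the parity of the date only, so a piece of a journey may be shifted by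
any even amount of time. Suppose a journey crosses from `v` to `u`, makes a closed piece `M` at `u`,
goes back, makes a closed piece `B` at `v`, and crosses to `u` again. Make `B` first, cross once,
and then make `M`. Two crossings disappear, while `B` and `M` each wait at most one date for their
parity, so the arrival is no later (`exists_shortcut`). Hence every journey has a reduced version
with the same vertices and end (`exists_reduced`). The edge from the parent is the only door into a
subtree of a tree, so a reduced journey from the root enters each subtree at most once. At every
vertex it is a sequence of complete excursions into branches, of which only the last may end inside
(`exists_excursion`). This yields the recursion for the costs, with some order of the branches still
to be chosen.

The order is governed by parity. The invariant `Typed` says that the cost with return is a constant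
even number, or alternates between an odd number and its successor. It passes from a subtree to its
branch by a case distinction on the availability of the edge (`Typed.branch`). Among the branches at
one vertex, a fast coverage of nonconstant type has odd cost and changes the parity of the date; all
other foremost coverages have even cost and preserve it. With `x` branches of type `fw10` and `y` of
type `fw01` left at date `t`, the number `waste x y t` is a potential: no choice of a branch beats
it (`Typed.waste_step`), and a choice loses nothing if a slow branch is taken only when no fast one
is left (`Typed.waste_step_eq`). So alternating orders are optimal, and the sum of the least costs
plus the waste is again `Typed`. Without return, an earlier start of the last branch is never a
disadvantage (`add_coverCost_mono`), so the other branches may be taken in alternating order.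

For linear time, the branches at a vertex are summarised by three additive numbers: the sum of their
least costs, `x` and `y`. A branch is added or removed in constant time, so trying every child as
the last one is linear in total. An order with children before parents comes from peeling off
leaves; every vertex keeps its degree and the sum modulo `n` of the indices of its edges, from which
a vertex with one edge left reads off that edge. Finally an agent walks greedily, taking the next
child from one of two lists according to the parity of the date (`Agent.Step`). Its actions number
at most twice the arrival date, which is below `4 * n` because a tour with return crosses each edge
twice in at most two dates each (`IsPeriodic.costs_le`). The program is verified with preconditions
for its loop-free parts (`Prog.runs_of_wp`), invariants for its loops, and a simulation of the agent
(`walkBody_runs`). -/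

theorem isJourney_append {u : V} {t : ℕ} {J K : List (V × ℕ)} :
    G.IsJourney u t (J ++ K) ↔
      G.IsJourney u t J ∧ G.IsJourney (endpoint u J) (arrival t J) K := by
  induction J generalizing u t with
  | nil => simp [IsJourney, endpoint, arrival]
  | cons a J ih =>
    obtain ⟨v, τ⟩ := a
    simp only [List.cons_append, IsJourney, endpoint, arrival, ih, and_assoc]

theorem arrival_append (t : ℕ) (J K : List (V × ℕ)) :
    arrival t (J ++ K) = arrival (arrival t J) K := by
  induction J generalizing t with
  | nil => rfl
  | cons a J ih => exact ih _

theorem endpoint_append (u : V) (J K : List (V × ℕ)) :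
    endpoint u (J ++ K) = endpoint (endpoint u J) K := by
  induction J generalizing u with
  | nil => rfl
  | cons a J ih => exact ih _

theorem trace_append (u : V) (J K : List (V × ℕ)) :
    trace u (J ++ K) = trace u J ++ K.map Prod.fst := by
  simp [trace]

theorem mem_trace_self (u : V) (J : List (V × ℕ)) : u ∈ trace u J := by simp [trace]

theorem endpoint_mem_trace (u : V) (J : List (V × ℕ)) : endpoint u J ∈ trace u J := by
  induction J generalizing u with
  | nil => simp [endpoint, trace]
  | cons a J ih =>
    have := ih a.1
    simp only [trace, endpoint, List.map_cons, List.mem_cons] at this ⊢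
    exact Or.inr this

theorem mem_trace_append {u w : V} {J K : List (V × ℕ)} :
    w ∈ trace u (J ++ K) ↔ w ∈ trace u J ∨ w ∈ trace (endpoint u J) K := by
  rw [trace_append, List.mem_append]
  constructor
  · rintro (h | h)
    · exact Or.inl h
    · exact Or.inr (List.mem_cons_of_mem _ h)
  · rintro (h | h)
    · exact Or.inl h
    · rcases List.mem_cons.1 h with rfl | h
      · exact Or.inl (endpoint_mem_trace _ _)
      · exact Or.inr h

theorem mem_trace_cons {u v w : V} {τ : ℕ} {J : List (V × ℕ)} :
    w ∈ trace u ((v, τ) :: J) ↔ w = u ∨ w ∈ trace v J := by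
  simp [trace]

theorem IsJourney.le_arrival {u : V} {t : ℕ} {J : List (V × ℕ)} (h : G.IsJourney u t J) :
    t ≤ arrival t J := by
  induction J generalizing u t with
  | nil => exact le_rfl
  | cons a J ih =>
    obtain ⟨v, τ⟩ := a
    obtain ⟨-, -, h1, h2⟩ := h
    have := ih h2
    simp only [arrival]
    omega

/-- Waiting is allowed, so an agent who is ready earlier can make the same moves at the same dates.
-/
theorem IsJourney.mono {u : V} {s t : ℕ} {J : List (V × ℕ)} (h : G.IsJourney u t J)
    (hst : s ≤ t) : G.IsJourney u s J := by
  cases J with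
  | nil => trivial
  | cons a J => exact ⟨h.1, h.2.1, hst.trans h.2.2.1, h.2.2.2⟩

theorem arrival_mono {s t : ℕ} (hst : s ≤ t) (J : List (V × ℕ)) : arrival s J ≤ arrival t J := by
  cases J with
  | nil => exact hst
  | cons a J => exact le_rfl

/-- The journey `J` from date `t`, moved to start at date `t'`. -/
def reschedule (t t' : ℕ) (J : List (V × ℕ)) : List (V × ℕ) :=
  J.map fun x => (x.1, x.2 - t + t')

theorem map_fst_reschedule (t t' : ℕ) (J : List (V × ℕ)) :
    (reschedule t t' J).map Prod.fst = J.map Prod.fst := by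
  simp [reschedule, Function.comp_def]

theorem trace_reschedule (u : V) (t t' : ℕ) (J : List (V × ℕ)) :
    trace u (reschedule t t' J) = trace u J := by
  simp only [trace, map_fst_reschedule]

theorem endpoint_reschedule (u : V) (t t' : ℕ) (J : List (V × ℕ)) :
    endpoint u (reschedule t t' J) = endpoint u J := by
  induction J generalizing u with
  | nil => rfl
  | cons a J ih => exact ih _

theorem length_reschedule (t t' : ℕ) (J : List (V × ℕ)) :
    (reschedule t t' J).length = J.length := by
  simp [reschedule]

/-- Availability of edges depends on the parity of the date only. -/
def TwoPeriodic (G : TVG V) : Prop :=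
  ∀ u v, G.graph.Adj u v → ∀ s t, s % 2 = t % 2 → (G.present s(u, v) s ↔ G.present s(u, v) t)

theorem IsPeriodic.twoPeriodic (h : G.IsPeriodic 2) : G.TwoPeriodic := by
  intro u v huv s t hst
  have h1 := h.periodic s(u, v) huv (s % 2) (s / 2)
  have h2 := h.periodic s(u, v) huv (t % 2) (t / 2)
  rw [show s % 2 + s / 2 * 2 = s by omega] at h1
  rw [show t % 2 + t / 2 * 2 = t by omega] at h2
  rw [← h1, ← h2, hst]

/-- The present date `s` varies along the induction while the reference date `t` of the shift is
fixed. As `t ≤ s`, no subtraction is truncated. -/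
theorem IsJourney.reschedule_aux (hG : G.TwoPeriodic) {u : V} {s t t' : ℕ}
    {J : List (V × ℕ)} (h : G.IsJourney u s J) (hts : t ≤ s) (ht : t % 2 = t' % 2) :
    G.IsJourney u (s - t + t') (reschedule t t' J) ∧
      arrival (s - t + t') (reschedule t t' J) + t = arrival s J + t' := by
  induction J generalizing u s with
  | nil => simp only [IsJourney, arrival, reschedule, List.map_nil, true_and]; omega
  | cons a J ih =>
    obtain ⟨v, τ⟩ := a
    obtain ⟨h1, h2, h3, h4⟩ := h
    have := ih h4 (by omega)
    rw [show τ + 1 - t + t' = τ - t + t' + 1 by omega] at this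
    refine ⟨⟨h1, ?_, ?_, this.1⟩, this.2⟩
    · exact (hG u v h1 _ _ (by omega)).1 h2
    · show s - t + t' ≤ τ - t + t'
      omega

theorem IsJourney.reschedule (hG : G.TwoPeriodic) {u : V} {t t' : ℕ}
    {J : List (V × ℕ)} (h : G.IsJourney u t J) (ht : t % 2 = t' % 2) :
    G.IsJourney u t' (reschedule t t' J) := by
  simpa using (h.reschedule_aux hG le_rfl ht).1

theorem IsJourney.arrival_reschedule (hG : G.TwoPeriodic) {u : V} {t t' : ℕ}
    {J : List (V × ℕ)} (h : G.IsJourney u t J) (ht : t % 2 = t' % 2) :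
    arrival t' (TVG.reschedule t t' J) + t = arrival t J + t' := by
  simpa using (h.reschedule_aux hG le_rfl ht).2

/-- The journey `J` from `r` crosses no edge twice in the same direction with a crossing in the
opposite direction in between. -/
def Reduced (r : V) (J : List (V × ℕ)) : Prop :=
  ∀ (u v : V) (τ₁ τ₂ τ₃ : ℕ) (A M B C : List (V × ℕ)),
    J = A ++ (u, τ₁) :: (M ++ (v, τ₂) :: (B ++ (u, τ₃) :: C)) →
    endpoint r A = v → endpoint u M = u → endpoint v B = v → False

theorem Reduced.suffix {r : V} {A J : List (V × ℕ)} (h : Reduced r (A ++ J)) :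
    Reduced (endpoint r A) J := by
  intro u v τ₁ τ₂ τ₃ A' M B C hJ hA
  refine h u v τ₁ τ₂ τ₃ (A ++ A') M B C ?_ ?_
  · rw [hJ, List.append_assoc]
  · rw [endpoint_append, hA]

/-- `B` is made before a single crossing to `u`, and `M` after it. The two deleted crossings pay for
the at most one date that each of `B` and `M` waits for its parity. -/
theorem exists_shortcut (hG : G.TwoPeriodic) {r : V} {t : ℕ} {J : List (V × ℕ)}
    (hJ : G.IsJourney r t J) (h : ¬ Reduced r J) :
    ∃ J', G.IsJourney r t J' ∧ J'.length < J.length ∧ arrival t J' ≤ arrival t J ∧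
      endpoint r J' = endpoint r J ∧ ∀ w, w ∈ trace r J' ↔ w ∈ trace r J := by
  simp only [Reduced, not_forall] at h
  obtain ⟨u, v, τ₁, τ₂, τ₃, A, M, B, C, rfl, hA, hM, hB, -⟩ := h
  simp only [isJourney_append, IsJourney, arrival_append, endpoint_append, arrival, endpoint,
    hA, hM, hB] at hJ ⊢
  obtain ⟨hA', huv, hp1, ha, hM', -, hp2, hb, hB', -, hp3, hc, hC⟩ := hJ
  have hMa := hM'.le_arrival
  have hBa := hB'.le_arrival
  have hvu := huv
  -- the part `B` is moved forward to the date `b`, the part `M` follows later at the date `m`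
  obtain ⟨b, hb1, hb2, hb3⟩ : ∃ b, τ₁ ≤ b ∧ b ≤ τ₁ + 1 ∧ (τ₂ + 1) % 2 = b % 2 :=
    ⟨τ₁ + (τ₂ + 1 - τ₁) % 2, by omega, by omega, by omega⟩
  have hBb := hB'.arrival_reschedule hG hb3
  -- The crossing after `B` is shifted by the same even amount as `B`, so its edge is available at
  -- `c`.
  obtain ⟨c, hc0⟩ : ∃ c, c + (τ₂ + 1) = τ₃ + b := ⟨τ₃ + b - (τ₂ + 1), by omega⟩
  obtain ⟨m, hm1, hm2, hm3⟩ : ∃ m, c + 1 ≤ m ∧ m ≤ c + 2 ∧ (τ₁ + 1) % 2 = m % 2 :=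
    ⟨c + 1 + (τ₁ + c) % 2, by omega, by omega, by omega⟩
  have hMb := hM'.arrival_reschedule hG hm3
  refine ⟨A ++ (reschedule (τ₂ + 1) b B ++
    (u, c) :: (reschedule (τ₁ + 1) m M ++ C)), ?_, ?_, ?_, ?_, ?_⟩
  · simp only [isJourney_append, IsJourney, endpoint_reschedule, hA, hM, hB]
    refine ⟨hA', (hB'.reschedule hG hb3).mono (by omega), huv, ?_, ?_, ?_, ?_⟩
    · exact (hG v u huv _ _ (by omega)).1 hp3
    · have := arrival_mono (show arrival t A ≤ b by omega) (reschedule (τ₂ + 1) b B)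
      omega
    · exact (hM'.reschedule hG hm3).mono hm1
    · refine hC.mono ?_
      have := arrival_mono hm1 (reschedule (τ₁ + 1) m M)
      omega
  · simp only [List.length_append, List.length_cons, length_reschedule]
    omega
  · simp only [arrival_append, arrival]
    apply arrival_mono
    have := arrival_mono hm1 (reschedule (τ₁ + 1) m M)
    omega
  · simp only [endpoint_append, endpoint, endpoint_reschedule, hM]
  · intro w
    have h1 := endpoint_mem_trace r A
    have h2 := endpoint_mem_trace u M
    simp only [trace, List.map_append, List.map_cons, map_fst_reschedule, List.mem_cons,
      List.mem_append] at h1 h2 ⊢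
    rw [hA] at h1
    constructor
    · tauto
    · rintro (h | h | h | h | h | h | h | h)
      · tauto
      · tauto
      · tauto
      · tauto
      -- The vertex `v` reached by the deleted crossing back is still visited, being the end of `A`.
      · subst h; tauto
      · tauto
      · tauto
      · tauto

/-- A shortcut has fewer moves, so repeated shortcuts terminate. -/
theorem exists_reduced (hG : G.TwoPeriodic) {r : V} {t : ℕ} {J : List (V × ℕ)}
    (hJ : G.IsJourney r t J) :
    ∃ J', G.IsJourney r t J' ∧ Reduced r J' ∧ arrival t J' ≤ arrival t J ∧
      endpoint r J' = endpoint r J ∧ ∀ w, w ∈ trace r J' ↔ w ∈ trace r J := by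
  induction hn : J.length using Nat.strong_induction_on generalizing J with
  | _ n ih =>
    by_cases h : Reduced r J
    · exact ⟨J, hJ, h, le_rfl, rfl, fun _ => Iff.rfl⟩
    · obtain ⟨J₁, h1, h2, h3, h4, h5⟩ := exists_shortcut hG hJ h
      obtain ⟨J₂, k1, k2, k3, k4, k5⟩ := ih _ (hn ▸ h2) h1 rfl
      exact ⟨J₂, k1, k2, k3.trans h3, k4.trans h4, fun w => (k5 w).trans (h5 w)⟩

end Journeys

end TVG

/-! ### Rooted trees: children, parents and subtrees. -/

namespace TVG

variable {V : Type*}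

section Trees

variable {G : TVG V} {o : V}

/-- The unique path is the bypass of every walk, so it decides the condition for all walks. -/
theorem mem_subtree_iff (hT : G.graph.IsTree) {u w : V} {q : G.graph.Walk o w} (hq : q.IsPath) :
    w ∈ G.subtree o u ↔ u ∈ q.support := by
  classical
  refine ⟨fun h => h q, fun h p => ?_⟩
  have : p.bypass = q :=
    hT.existsUnique_path o w |>.unique p.bypass_isPath hq
  exact p.support_bypass_subset_support (this ▸ h)

theorem exists_isPath (hT : G.graph.IsTree) (o w : V) : ∃ q : G.graph.Walk o w, q.IsPath :=
  (hT.existsUnique_path o w).exists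

theorem self_mem_subtree (G : TVG V) (o u : V) : u ∈ G.subtree o u :=
  fun q => q.end_mem_support

theorem subtree_root (G : TVG V) (o : V) : G.subtree o o = Set.univ :=
  Set.eq_univ_of_forall fun _ q => q.start_mem_support

theorem root_notMem_subtree {u : V} (hu : u ≠ o) : o ∉ G.subtree o u := by
  intro h
  have := h .nil
  simp at this
  exact hu this

/-- A walk to `a` that avoids `u`, prolonged by the edge, must meet `u`; only its new end is left
for that. -/
theorem eq_of_adj_of_mem_subtree {u a b : V} (hab : G.graph.Adj a b)
    (ha : a ∉ G.subtree o u) (hb : b ∈ G.subtree o u) : b = u := by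
  simp only [subtree, Set.mem_ofPred_eq, not_forall] at ha
  obtain ⟨q, hq⟩ := ha
  have := hb (q.concat hab)
  rw [SimpleGraph.Walk.support_concat] at this
  simp only [List.mem_append, List.mem_singleton] at this
  tauto

/-- Two neighbours outside would give two different paths from the root to `u`. -/
theorem eq_of_adj_of_notMem_subtree (hT : G.graph.IsTree) {u a b : V} (ha : G.graph.Adj a u)
    (hb : G.graph.Adj b u) (ha' : a ∉ G.subtree o u) (hb' : b ∉ G.subtree o u) : a = b := by
  obtain ⟨p, hp⟩ := exists_isPath hT o a
  obtain ⟨q, hq⟩ := exists_isPath hT o b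
  rw [mem_subtree_iff hT hp] at ha'
  rw [mem_subtree_iff hT hq] at hb'
  have h1 : (p.concat ha).IsPath := hp.concat ha' ha
  have h2 : (q.concat hb).IsPath := hq.concat hb' hb
  have := (hT.existsUnique_path o u).unique h1 h2
  obtain ⟨h, -⟩ := SimpleGraph.Walk.concat_inj this
  exact h

theorem notMem_subtree_child (hT : G.graph.IsTree) {u v : V} (hu : u ∈ G.children o v) :
    v ∉ G.subtree o u := by
  classical
  obtain ⟨q, hq⟩ := exists_isPath hT o u
  have hv : v ∈ q.support := hu.2 q
  intro h
  exact SimpleGraph.Walk.endpoint_notMem_support_takeUntil hq hv hu.1.ne' (h _)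

theorem subtree_child_subset {u v : V} (hu : u ∈ G.children o v) :
    G.subtree o u ⊆ G.subtree o v := by
  classical
  intro w hw q
  exact q.support_takeUntil_subset_support (hw q) (hu.2 _)

/-- Neither of two different children lies below the other, since an edge from `v` enters a subtree
only at its top. But the path to `w` meets both, and the later one would lie below the earlier one.
-/
theorem eq_child_of_mem (hT : G.graph.IsTree) {u₁ u₂ v w : V} (h₁ : u₁ ∈ G.children o v)
    (h₂ : u₂ ∈ G.children o v) (hw₁ : w ∈ G.subtree o u₁) (hw₂ : w ∈ G.subtree o u₂) :
    u₁ = u₂ := by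
  classical
  by_contra hne
  have k₁ : u₂ ∉ G.subtree o u₁ := fun h =>
    hne (eq_of_adj_of_mem_subtree h₂.1 (notMem_subtree_child hT h₁) h).symm
  have k₂ : u₁ ∉ G.subtree o u₂ := fun h =>
    hne (eq_of_adj_of_mem_subtree h₁.1 (notMem_subtree_child hT h₂) h)
  obtain ⟨q, hq⟩ := exists_isPath hT o w
  have hu₂ := hw₂ q
  have hq₁ := hq.takeUntil hu₂
  have hu₁ : u₁ ∈ (q.dropUntil u₂ hu₂).support := by
    have := hw₁ q
    rw [← q.take_spec hu₂, SimpleGraph.Walk.mem_support_append_iff] at this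
    rw [mem_subtree_iff hT hq₁] at k₁
    tauto
  apply k₂
  have hp : ((q.takeUntil u₂ hu₂).append ((q.dropUntil u₂ hu₂).takeUntil u₁ hu₁)).IsPath := by
    have h : (((q.takeUntil u₂ hu₂).append ((q.dropUntil u₂ hu₂).takeUntil u₁ hu₁)).append
        ((q.dropUntil u₂ hu₂).dropUntil u₁ hu₁)).IsPath := by
      rw [← SimpleGraph.Walk.append_assoc, SimpleGraph.Walk.take_spec,
        SimpleGraph.Walk.take_spec]
      exact hq
    exact h.of_append_left
  rw [mem_subtree_iff hT hp, SimpleGraph.Walk.mem_support_append_iff]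
  exact Or.inl (SimpleGraph.Walk.end_mem_support _)

/-- The vertex after `v` on the path from the root to `w` is the child whose subtree contains `w`.
-/
theorem mem_subtree_cases (hT : G.graph.IsTree) {v w : V} :
    w ∈ G.subtree o v ↔ w = v ∨ ∃ u ∈ G.children o v, w ∈ G.subtree o u := by
  classical
  constructor
  · intro hw
    by_cases hwv : w = v
    · exact Or.inl hwv
    right
    obtain ⟨q, hq⟩ := exists_isPath hT o w
    have hv := hw q
    have hq' : ((q.takeUntil v hv).append (q.dropUntil v hv)).IsPath := by
      rw [SimpleGraph.Walk.take_spec]; exact hq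
    generalize q.takeUntil v hv = p at hq'
    generalize q.dropUntil v hv = r at hq'
    cases r with
    | nil => exact absurd rfl hwv
    | @cons _ u _ h r =>
      refine ⟨u, ⟨h, ?_⟩, ?_⟩
      · have : (p.concat h).IsPath := by
          rw [← SimpleGraph.Walk.concat_append] at hq'
          exact hq'.of_append_left
        rw [mem_subtree_iff hT this, SimpleGraph.Walk.support_concat]
        simp
      · rw [mem_subtree_iff hT hq', SimpleGraph.Walk.mem_support_append_iff]
        right
        simp
  · rintro (rfl | ⟨u, hu, hw⟩)
    · exact self_mem_subtree G o w
    · exact subtree_child_subset hu hw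

theorem exists_parent (hT : G.graph.IsTree) {u : V} (hu : u ≠ o) :
    ∃ v, u ∈ G.children o v := by
  obtain ⟨q, hq⟩ := exists_isPath hT o u
  have hnil : ¬ q.Nil := fun h => hu h.eq.symm
  refine ⟨q.penultimate, q.adj_penultimate hnil, ?_⟩
  rw [mem_subtree_iff hT hq]
  exact q.getVert_mem_support _

theorem parent_unique (hT : G.graph.IsTree) {u v v' : V} (h : u ∈ G.children o v)
    (h' : u ∈ G.children o v') : v = v' :=
  eq_of_adj_of_notMem_subtree hT h.1 h'.1 (notMem_subtree_child hT h) (notMem_subtree_child hT h')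

theorem ne_root_of_mem_children (hT : G.graph.IsTree) {u v : V} (h : u ∈ G.children o v) :
    u ≠ o := by
  rintro rfl
  exact notMem_subtree_child hT h (by rw [subtree_root]; trivial)

/-- The edge from the parent is the only door into a subtree. This is how the tree structure enters
the analysis of journeys. -/
theorem enter_subtree (hT : G.graph.IsTree) {u v a b : V} (hu : u ∈ G.children o v)
    (hab : G.graph.Adj a b) (ha : a ∉ G.subtree o u) (hb : b ∈ G.subtree o u) :
    a = v ∧ b = u := by
  obtain rfl := eq_of_adj_of_mem_subtree hab ha hb
  exact ⟨eq_of_adj_of_notMem_subtree hT hab hu.1 ha (notMem_subtree_child hT hu), rfl⟩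

theorem mem_children_or_mem_children (hT : G.graph.IsTree) {u v : V} (h : G.graph.Adj u v) :
    u ∈ G.children o v ∨ v ∈ G.children o u := by
  by_cases hv : v ∈ G.subtree o u
  · exact Or.inr ⟨h, hv⟩
  by_cases hu : u = o
  · subst hu
    exact absurd (by rw [subtree_root]; trivial) hv
  obtain ⟨p, hp⟩ := exists_parent hT hu
  obtain ⟨rfl, -⟩ := enter_subtree hT hp h.symm hv (self_mem_subtree G o u)
  exact Or.inl hp

theorem subtree_child_ssubset (hT : G.graph.IsTree) {u v : V} (hu : u ∈ G.children o v) :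
    G.subtree o u ⊂ G.subtree o v :=
  (Set.ssubset_iff_of_subset (subtree_child_subset hu)).2
    ⟨v, self_mem_subtree G o v, notMem_subtree_child hT hu⟩

/-- Induction on a rooted tree from the leaves to the root. -/
theorem subtree_induction [Finite V] (hT : G.graph.IsTree) {P : V → Prop}
    (h : ∀ v, (∀ u ∈ G.children o v, P u) → P v) (v : V) : P v := by
  induction hn : (G.subtree o v).ncard using Nat.strong_induction_on generalizing v with
  | _ n ih =>
    refine h v fun u hu => ih _ ?_ u rfl
    rw [← hn]
    exact Set.ncard_lt_ncard (subtree_child_ssubset hT hu)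

end Trees

end TVG

/-! ### Costs: decomposition of coverages into branches, and the recursion. -/

namespace TVG

variable {V : Type*}

section Costs

variable {G : TVG V} {o : V}

theorem IsCoverage.mono {S : Set V} {r : V} {s t : ℕ} {J : List (V × ℕ)}
    (h : G.IsCoverage S r t J) (hst : s ≤ t) : G.IsCoverage S r s J :=
  ⟨h.journey.mono hst, h.inside, h.covers⟩

/-- A coverage that starts later also bounds the cost of an earlier start, because the agent can
wait. Comparing arrival dates instead of costs absorbs the difference of the start dates. -/
theorem add_returnCost_le {S : Set V} {r : V} {s t : ℕ} {J : List (V × ℕ)}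
    (h : G.IsCoverage S r s J) (hr : endpoint r J = r) (hts : t ≤ s) :
    t + G.returnCost S r t ≤ arrival s J := by
  have h1 := (h.mono hts).journey.le_arrival
  have : G.returnCost S r t ≤ arrival t J - t :=
    Nat.sInf_le ⟨J, h.mono hts, hr, by omega⟩
  have := arrival_mono hts J
  omega

theorem add_coverCost_le {S : Set V} {r : V} {s t : ℕ} {J : List (V × ℕ)}
    (h : G.IsCoverage S r s J) (hts : t ≤ s) :
    t + G.coverCost S r t ≤ arrival s J := by
  have h1 := (h.mono hts).journey.le_arrival
  have : G.coverCost S r t ≤ arrival t J - t :=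
    Nat.sInf_le ⟨J, h.mono hts, by omega⟩
  have := arrival_mono hts J
  omega

theorem exists_returnCost {S : Set V} {r : V} {t : ℕ} (h : (G.returnCosts S r t).Nonempty) :
    ∃ J, G.IsCoverage S r t J ∧ endpoint r J = r ∧ arrival t J = t + G.returnCost S r t :=
  Nat.sInf_mem h

theorem exists_coverCost {S : Set V} {r : V} {t : ℕ} (h : (G.coverCosts S r t).Nonempty) :
    ∃ J, G.IsCoverage S r t J ∧ arrival t J = t + G.coverCost S r t :=
  Nat.sInf_mem h

theorem returnCosts_nonempty_of {S : Set V} {r : V} {t : ℕ} {J : List (V × ℕ)}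
    (h : G.IsCoverage S r t J) (hr : endpoint r J = r) : (G.returnCosts S r t).Nonempty :=
  ⟨arrival t J - t, J, h, hr, by have := h.journey.le_arrival; omega⟩

theorem coverCosts_nonempty_of {S : Set V} {r : V} {t : ℕ}
    (h : (G.returnCosts S r t).Nonempty) : (G.coverCosts S r t).Nonempty := by
  obtain ⟨c, J, h1, -, h2⟩ := h
  exact ⟨c, J, h1, h2⟩

/-- An earlier start never leads to a later foremost arrival, so the beginning of a journey may be
replaced by a faster one. Without a coverage from `t` the cost there would be the default value `0`
of the infimum. -/
theorem add_coverCost_mono {S : Set V} {r : V} {s t : ℕ} (hst : s ≤ t)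
    (h : (G.coverCosts S r t).Nonempty) :
    s + G.coverCost S r s ≤ t + G.coverCost S r t := by
  obtain ⟨J, h1, h3⟩ := exists_coverCost h
  exact h3 ▸ add_coverCost_le h1 hst

theorem IsCoverage.reschedule (hG : G.TwoPeriodic) {S : Set V} {r : V} {t t' : ℕ}
    {J : List (V × ℕ)} (h : G.IsCoverage S r t J) (ht : t % 2 = t' % 2) :
    G.IsCoverage S r t' (TVG.reschedule t t' J) :=
  ⟨h.journey.reschedule hG ht, by simpa only [trace_reschedule] using h.inside,
    by simpa only [trace_reschedule] using h.covers⟩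

theorem coverCosts_eq_of_mod_eq (hG : G.TwoPeriodic) (S : Set V) (r : V) {s t : ℕ}
    (h : s % 2 = t % 2) : G.coverCosts S r s = G.coverCosts S r t := by
  have key : ∀ {s t : ℕ}, s % 2 = t % 2 → G.coverCosts S r s ⊆ G.coverCosts S r t := by
    rintro s t h c ⟨J, h1, h3⟩
    refine ⟨_, h1.reschedule hG h, ?_⟩
    have := h1.journey.arrival_reschedule hG h
    omega
  exact (key h).antisymm (key h.symm)

theorem coverCost_eq_of_mod_eq (hG : G.TwoPeriodic) (S : Set V) (r : V) {s t : ℕ}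
    (h : s % 2 = t % 2) : G.coverCost S r s = G.coverCost S r t := by
  rw [coverCost, coverCosts_eq_of_mod_eq hG S r h, coverCost]

open Classical in
/-- The time spent waiting for the edge `e` from date `t` on, in a graph of period two. -/
noncomputable def wait (G : TVG V) (e : Sym2 V) (t : ℕ) : ℕ := if G.present e t then 0 else 1

theorem wait_le (G : TVG V) (e : Sym2 V) (t : ℕ) : G.wait e t ≤ 1 := by
  unfold wait; split <;> omega

/-- By recurrence the edge is available at some later date, and by periodicity then at `t` or at `t
+ 1`. -/
theorem IsPeriodic.present_add_wait (hP : G.IsPeriodic 2) {u v : V} (h : G.graph.Adj u v)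
    (t : ℕ) : G.present s(u, v) (t + G.wait s(u, v) t) := by
  unfold wait
  split
  · assumption
  · rename_i hn
    obtain ⟨t', ht, hp⟩ := hP.recurrent s(u, v) h t
    have hG := hP.twoPeriodic u v h
    rcases Nat.mod_two_eq_zero_or_one (t' - t) with h0 | h0
    · exact absurd ((hG t' t (by omega)).1 hp) hn
    · exact (hG t' (t + 1) (by omega)).1 hp

theorem wait_eq_of_mod_eq (hG : G.TwoPeriodic) {u v : V} (h : G.graph.Adj u v) {s t : ℕ}
    (hst : s % 2 = t % 2) : G.wait s(u, v) s = G.wait s(u, v) t := by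
  rw [wait, wait, propext (hG u v h s t hst)]

theorem IsPeriodic.crossed_eq (hP : G.IsPeriodic 2) {u v : V} (h : G.graph.Adj u v) (t : ℕ) :
    G.crossed s(u, v) t = t + G.wait s(u, v) t + 1 := by
  have h1 := hP.present_add_wait h t
  have h2 : sInf {τ | t ≤ τ ∧ G.present s(u, v) τ} ≤ t + G.wait s(u, v) t :=
    Nat.sInf_le ⟨by omega, h1⟩
  have h3 : sInf {τ | t ≤ τ ∧ G.present s(u, v) τ} ∈ {τ | t ≤ τ ∧ G.present s(u, v) τ} :=
    Nat.sInf_mem ⟨_, by omega, h1⟩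
  generalize sInf {τ | t ≤ τ ∧ G.present s(u, v) τ} = τ at h2 h3
  have h4 : t + G.wait s(u, v) t ≤ τ := by
    unfold wait
    split
    · exact h3.1
    · rename_i hn
      have : τ ≠ t := fun h => hn (h ▸ h3.2)
      have := h3.1
      omega
  have : sInf {τ | t ≤ τ ∧ G.present s(u, v) τ} = τ := by
    apply le_antisymm (Nat.sInf_le h3)
    refine le_csInf ⟨_, h3⟩ fun σ hσ => ?_
    by_contra hlt
    have := hσ.1
    have := G.wait_le s(u, v) t
    have hσt : σ = t := by omega
    have : G.wait s(u, v) t = 0 := by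
      rw [wait, if_pos (hσt ▸ hσ.2)]
    omega
  unfold crossed
  omega

theorem crossed_le {e : Sym2 V} {t τ : ℕ} (h : t ≤ τ) (hp : G.present e τ) :
    G.crossed e t ≤ τ + 1 :=
  Nat.succ_le_succ (Nat.sInf_le ⟨h, hp⟩)

/-- The cut is made at the first vertex outside `S`. Applied to a subtree and to its complement, it
finds the moves at which a journey leaves and enters the subtree. -/
theorem exists_split (S : Set V) (x : V) (J : List (V × ℕ)) (hx : x ∈ S) :
    (∀ w ∈ trace x J, w ∈ S) ∨
      ∃ M a τ K, J = M ++ (a, τ) :: K ∧ (∀ w ∈ trace x M, w ∈ S) ∧ a ∉ S := by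
  induction J generalizing x with
  | nil => left; simpa [trace] using hx
  | cons b J ih =>
    obtain ⟨y, τ⟩ := b
    by_cases hy : y ∈ S
    · rcases ih y hy with h | ⟨M, a, σ, K, rfl, h2, h3⟩
      · left
        intro w hw
        rcases mem_trace_cons.1 hw with rfl | hw
        · exact hx
        · exact h w hw
      · right
        refine ⟨(y, τ) :: M, a, σ, K, rfl, ?_, h3⟩
        intro w hw
        rcases mem_trace_cons.1 hw with rfl | hw
        · exact hx
        · exact h2 w hw
    · right
      exact ⟨[], y, τ, J, rfl, by simpa [trace] using hx, hy⟩

/-- The root `v` and the subtrees at the listed children. -/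
def region (G : TVG V) (o v : V) (L : List V) : Set V :=
  {w | w = v ∨ ∃ u ∈ L, w ∈ G.subtree o u}

theorem region_singleton (G : TVG V) (o v u : V) : G.region o v [u] = G.branch o v u := by
  ext w; simp [region, branch]

theorem region_eq_subtree (hT : G.graph.IsTree) {v : V} {L : List V}
    (hL : ∀ u, u ∈ L ↔ u ∈ G.children o v) : G.region o v L = G.subtree o v := by
  ext w
  rw [mem_subtree_cases hT]
  simp only [region, Set.mem_ofPred_eq, hL]

/-- How a reduced journey that starts with a move to a child `u` goes on: it stays in the subtree
at `u`, or leaves it once and for all. -/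
theorem reduced_cons_cases (hT : G.graph.IsTree) {u v : V} {t τ : ℕ} {K : List (V × ℕ)}
    (hu : u ∈ G.children o v) (hJ : G.IsJourney v t ((u, τ) :: K))
    (hr : Reduced v ((u, τ) :: K)) :
    (∀ w ∈ trace u K, w ∈ G.subtree o u) ∨
      ∃ M τ' J, K = M ++ (v, τ') :: J ∧ endpoint u M = u ∧
        (∀ w ∈ trace u M, w ∈ G.subtree o u) ∧ ∀ w ∈ trace v J, w ∉ G.subtree o u := by
  rcases exists_split (G.subtree o u) u K (self_mem_subtree G o u) with h | ⟨M, a, τ', J, rfl, h2, h3⟩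
  · exact Or.inl h
  right
  obtain ⟨-, -, -, hK⟩ := hJ
  rw [isJourney_append] at hK
  obtain ⟨-, hadj, -, -, hJ⟩ := hK
  obtain ⟨rfl, hend⟩ := enter_subtree hT hu hadj.symm h3 (h2 _ (endpoint_mem_trace u M))
  refine ⟨M, τ', J, rfl, hend, h2, ?_⟩
  -- A second entry would use the edge from the parent again after the return over it, which is the
  -- pattern excluded for reduced journeys, with empty initial part.
  rcases exists_split (G.subtree o u)ᶜ a J h3 with h | ⟨B, b, τ₃, C, rfl, k2, k3⟩
  · exact h
  exfalso
  rw [isJourney_append] at hJ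
  obtain ⟨-, hadj', -⟩ := hJ
  obtain ⟨hB, rfl⟩ := enter_subtree hT hu hadj' (k2 _ (endpoint_mem_trace a B))
    (not_not.1 k3)
  exact hr b a τ τ' τ₃ [] M B C (by simp) rfl hend hB

theorem mem_of_region_cons (hT : G.graph.IsTree) {u v : V} {t τ : ℕ} {K : List (V × ℕ)}
    {L : List V} (hL : ∀ u ∈ L, u ∈ G.children o v)
    (hJ : G.IsJourney v t ((u, τ) :: K))
    (hin : ∀ w ∈ trace v ((u, τ) :: K), w ∈ G.region o v L) : u ∈ L := by
  rcases hin u (by simp [trace]) with h | ⟨u', hu', h⟩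
  · exact absurd h hJ.1.ne'
  · obtain ⟨-, rfl⟩ := enter_subtree hT (hL u' hu') hJ.1 (notMem_subtree_child hT (hL u' hu')) h
    exact hu'

/-- The excursion of a journey to the subtree at a child. -/
theorem isCoverage_excursion {u v : V} {t τ τ' : ℕ} {M J : List (V × ℕ)}
    (hJ : G.IsJourney v t ((u, τ) :: (M ++ (v, τ') :: J)))
    (hM : ∀ w ∈ trace u M, w ∈ G.subtree o u)
    (hJ' : ∀ w ∈ trace v J, w ∉ G.subtree o u)
    (hcov : ∀ w ∈ G.subtree o u, w ∈ trace v ((u, τ) :: (M ++ (v, τ') :: J)))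
    (hv : v ∉ G.subtree o u) :
    G.IsCoverage (G.subtree o u) u (τ + 1) M ∧
    G.IsCoverage (G.branch o v u) v t ((u, τ) :: (M ++ [(v, τ')])) := by
  have key : ∀ w ∈ G.subtree o u, w ∈ trace u M := by
    intro w hw
    rcases mem_trace_cons.1 (hcov w hw) with rfl | h
    · exact absurd hw hv
    rw [mem_trace_append, mem_trace_cons] at h
    rcases h with h | rfl | h
    · exact h
    · exact endpoint_mem_trace _ _
    · exact absurd hw (hJ' w h)
  obtain ⟨h1, h2, h3, h4⟩ := hJ
  rw [isJourney_append] at h4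
  refine ⟨⟨h4.1, hM, key⟩, ⟨⟨h1, h2, h3, ?_⟩, ?_, ?_⟩⟩
  · rw [isJourney_append]
    exact ⟨h4.1, h4.2.1, h4.2.2.1, h4.2.2.2.1, trivial⟩
  · intro w hw
    rw [mem_trace_cons, mem_trace_append, mem_trace_cons] at hw
    simp only [trace, List.map_nil, List.mem_singleton] at hw
    rcases hw with rfl | hw | rfl | rfl
    · exact Set.mem_insert _ _
    · exact Set.mem_insert_of_mem _ (hM w hw)
    · exact Set.mem_insert_of_mem _ (hM _ (endpoint_mem_trace _ _))
    · exact Set.mem_insert _ _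
  · intro w hw
    rw [mem_trace_cons, mem_trace_append]
    rcases hw with rfl | hw
    · exact Or.inl rfl
    · exact Or.inr (Or.inl (key w hw))

/-- A reduced journey over several branches at `v` begins with an excursion to one of them, and
covers the other ones afterwards. -/
theorem exists_excursion (hT : G.graph.IsTree) {v : V} {L : List V}
    (hL : ∀ u ∈ L, u ∈ G.children o v) (hnd : L.Nodup) (hL0 : L ≠ []) {t : ℕ}
    {J : List (V × ℕ)} (hJ : G.IsCoverage (G.region o v L) v t J) (hr : Reduced v J)
    (hend : endpoint v J = v ∨ ¬ ∃ u, L = [u]) [DecidableEq V] :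
    ∃ u ∈ L, ∃ J', G.IsCoverage (G.region o v (L.erase u)) v
        (t + G.returnCost (G.branch o v u) v t) J' ∧ J'.length < J.length ∧ Reduced v J' ∧
      endpoint v J' = endpoint v J ∧
      arrival (t + G.returnCost (G.branch o v u) v t) J' ≤ arrival t J := by
  match J with
  | [] =>
    exfalso
    apply hL0
    rw [List.eq_nil_iff_forall_not_mem]
    intro u hu
    have := hJ.covers u (Or.inr ⟨u, hu, self_mem_subtree G o u⟩)
    simp only [trace, List.map_nil, List.mem_singleton] at this
    exact notMem_subtree_child hT (hL u hu) (this ▸ self_mem_subtree G o u)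
  | (u, τ) :: K =>
    have huL := mem_of_region_cons hT hL hJ.journey hJ.inside
    have hu := hL u huL
    have hv := notMem_subtree_child hT hu
    rcases reduced_cons_cases hT hu hJ.journey hr with h | ⟨M, τ', J, rfl, h1, h2, h3⟩
    -- A journey that never leaves the subtree at `u` can neither return to `v` nor reach a second
    -- branch.
    · exfalso
      rcases hend with hend | hsing
      · exact hv (h v (hend ▸ endpoint_mem_trace u K))
      · have herase : L.erase u ≠ [] := by
          intro h0
          apply hsing
          refine ⟨u, ?_⟩
          have := List.perm_cons_erase huL
          rw [h0] at this
          exact List.perm_singleton.1 this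
        obtain ⟨u', hu'⟩ := List.exists_mem_of_ne_nil _ herase
        have hne' := (hnd.mem_erase_iff.1 hu').1
        have hu'L := List.mem_of_mem_erase hu'
        have hw := hJ.covers u' (Or.inr ⟨u', hu'L, self_mem_subtree G o u'⟩)
        rcases mem_trace_cons.1 hw with rfl | hw
        · exact (hL u' hu'L).1.ne rfl
        · exact hne' (eq_child_of_mem hT (hL u' hu'L) hu (self_mem_subtree G o u') (h u' hw))
    · have hE := isCoverage_excursion hJ.journey h2 h3
        (fun w hw => hJ.covers w (Or.inr ⟨u, huL, hw⟩)) hv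
      have hEe : endpoint v ((u, τ) :: (M ++ [(v, τ')])) = v := by
        simp [endpoint, endpoint_append]
      -- The excursion may be slower than necessary. The remaining journey is then regarded as
      -- starting at the foremost return date, with its moves unchanged.
      have hs := add_returnCost_le hE.2 hEe le_rfl
      simp only [arrival, arrival_append] at hs
      have hsplit : (u, τ) :: (M ++ (v, τ') :: J) = ((u, τ) :: (M ++ [(v, τ')])) ++ J := by simp
      have hJ2 : G.IsJourney v (τ' + 1) J := by
        have := hJ.journey
        rw [hsplit, isJourney_append, hEe] at this
        simpa [arrival, arrival_append] using this.2
      refine ⟨u, huL, J, ⟨hJ2.mono hs, ?_, ?_⟩, ?_, ?_, ?_, ?_⟩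
      · intro w hw
        rcases hJ.inside w (by rw [hsplit, mem_trace_append, hEe]; exact Or.inr hw) with
          h | ⟨u', hu', h⟩
        · exact Or.inl h
        · refine Or.inr ⟨u', (List.mem_erase_of_ne ?_).2 hu', h⟩
          rintro rfl
          exact h3 w hw h
      · rintro w (rfl | ⟨u', hu', h⟩)
        · exact mem_trace_self _ _
        have hne' := (hnd.mem_erase_iff.1 hu').1
        have hu'L := List.mem_of_mem_erase hu'
        have hw := hJ.covers w (Or.inr ⟨u', hu'L, h⟩)
        rw [hsplit, mem_trace_append, hEe] at hw
        rcases hw with hw | hw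
        · rcases hE.2.inside w hw with rfl | hw'
          · exact mem_trace_self _ _
          · exact absurd (eq_child_of_mem hT (hL u' hu'L) hu h hw') hne'
        · exact hw
      · simp; omega
      · rw [hsplit] at hr
        have := hr.suffix
        rwa [hEe] at this
      · rw [hsplit, endpoint_append, hEe]
      · rw [hsplit, arrival_append]
        simp only [arrival, arrival_append]
        exact arrival_mono hs J

/-- The order is that of the excursions of the reduced journey, which are split off one by one. -/
theorem exists_serve_le (hT : G.graph.IsTree) {v : V} {L : List V}
    (hL : ∀ u ∈ L, u ∈ G.children o v) {t : ℕ}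
    {J : List (V × ℕ)} (hJ : G.IsCoverage (G.region o v L) v t J) (hr : Reduced v J)
    (hend : endpoint v J = v) (hnd : L.Nodup) :
    ∃ L', L'.Perm L ∧ G.serve o v t L' ≤ arrival t J := by
  classical
  induction hn : L.length generalizing J t L with
  | zero =>
    rw [List.length_eq_zero_iff] at hn
    exact ⟨[], by rw [hn], hJ.journey.le_arrival⟩
  | succ n ih =>
    obtain ⟨u, hu, J', h1, -, h3, h4, h5⟩ := exists_excursion hT hL hnd
      (by rintro rfl; simp at hn) hJ hr (Or.inl hend)
    obtain ⟨L', p1, p2⟩ := ih (fun u' hu' => hL u' (List.mem_of_mem_erase hu')) h1 h3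
      (h4.trans hend) (hnd.erase u) (by rw [List.length_erase_of_mem hu]; omega)
    exact ⟨u :: L', (p1.cons u).trans (List.perm_cons_erase hu).symm, p2.trans h5⟩

/-- Excursions are split off until a single branch is left; until then a reduced journey has to come
back to `v`. -/
theorem exists_serve_cover_le (hT : G.graph.IsTree) {v : V} {L : List V}
    (hL : ∀ u ∈ L, u ∈ G.children o v) (hL0 : L ≠ []) {t : ℕ}
    {J : List (V × ℕ)} (hJ : G.IsCoverage (G.region o v L) v t J) (hr : Reduced v J)
    (hnd : L.Nodup) :
    ∃ u L', (u :: L').Perm L ∧ G.serve o v t L' +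
      G.coverCost (G.branch o v u) v (G.serve o v t L') ≤ arrival t J := by
  classical
  induction hn : L.length generalizing J t L with
  | zero => exact absurd (List.length_eq_zero_iff.1 hn) hL0
  | succ n ih =>
    by_cases hsing : ∃ u, L = [u]
    · obtain ⟨u, rfl⟩ := hsing
      rw [region_singleton] at hJ
      exact ⟨u, [], .refl _, add_coverCost_le hJ le_rfl⟩
    obtain ⟨u, hu, J', h1, -, h3, -, h5⟩ := exists_excursion hT hL hnd hL0 hJ hr (Or.inr hsing)
    have hp := List.perm_cons_erase hu
    obtain ⟨u₂, L', p1, p2⟩ := ih (fun u' hu' => hL u' (List.mem_of_mem_erase hu'))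
      (fun h0 => hsing ⟨u, List.perm_singleton.1 (h0 ▸ hp)⟩) h1 h3
      (hnd.erase u) (by rw [List.length_erase_of_mem hu]; omega)
    exact ⟨u₂, u :: L', (List.Perm.swap u u₂ L').trans ((p1.cons u).trans hp.symm), p2.trans h5⟩

/-- Coverage of a branch is at least as expensive as crossing the edge and covering the subtree. -/
theorem exists_coverage_of_branch (hT : G.graph.IsTree) {u v : V} (hu : u ∈ G.children o v)
    {t : ℕ} {J : List (V × ℕ)} (hJ : G.IsCoverage (G.branch o v u) v t J) (hr : Reduced v J) :
    ∃ τ M, t ≤ τ ∧ G.present s(v, u) τ ∧ G.IsCoverage (G.subtree o u) u (τ + 1) M ∧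
      arrival (τ + 1) M ≤ arrival t J ∧ (endpoint v J = v → endpoint u M = u ∧ ∃ τ',
        arrival (τ + 1) M ≤ τ' ∧ G.present s(v, u) τ' ∧ τ' + 1 ≤ arrival t J) := by
  have hv := notMem_subtree_child hT hu
  rw [← region_singleton] at hJ
  match J with
  | [] =>
    have := hJ.covers u (Or.inr ⟨u, by simp, self_mem_subtree G o u⟩)
    simp only [trace, List.map_nil, List.mem_singleton] at this
    exact absurd (this ▸ self_mem_subtree G o u) hv
  | (u', τ) :: K =>
    obtain rfl : u' = u := List.mem_singleton.1
      (mem_of_region_cons hT (by simpa using hu) hJ.journey hJ.inside)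
    rcases reduced_cons_cases hT hu hJ.journey hr with h | ⟨M, τ', J, rfl, h1, h2, h3⟩
    · obtain ⟨k1, k2, k3, k4⟩ := hJ.journey
      refine ⟨τ, K, k3, k2, ⟨k4, h, ?_⟩, le_rfl, ?_⟩
      · intro w hw
        rcases mem_trace_cons.1 (hJ.covers w (Or.inr ⟨u', by simp, hw⟩)) with rfl | hw'
        · exact absurd hw hv
        · exact hw'
      · intro hend
        exact absurd (h v (hend ▸ endpoint_mem_trace u' K)) hv
    · have hE := isCoverage_excursion hJ.journey h2 h3
        (fun w hw => hJ.covers w (Or.inr ⟨u', by simp, hw⟩)) hv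
      obtain ⟨k1, k2, k3, k4⟩ := hJ.journey
      rw [isJourney_append] at k4
      obtain ⟨-, -, k5, k6, k7⟩ := k4
      have := k7.le_arrival
      refine ⟨τ, M, k3, k2, hE.1, ?_, fun _ => ⟨h1, τ', k6, ?_, ?_⟩⟩
      · simp only [arrival, arrival_append]; omega
      · rwa [h1, Sym2.eq_swap] at k5
      · simpa only [arrival, arrival_append] using this

theorem exists_coverage_reduced (hG : G.TwoPeriodic) {S : Set V} {r : V} {t : ℕ}
    {J : List (V × ℕ)} (hJ : G.IsCoverage S r t J) :
    ∃ J', G.IsCoverage S r t J' ∧ Reduced r J' ∧ arrival t J' ≤ arrival t J ∧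
      endpoint r J' = endpoint r J := by
  obtain ⟨J', h1, h2, h3, h4, h5⟩ := exists_reduced hG hJ.journey
  exact ⟨J', ⟨h1, fun w hw => hJ.inside w ((h5 w).1 hw), fun w hw => (h5 w).2 (hJ.covers w hw)⟩,
    h2, h3, h4⟩

theorem IsPeriodic.crossed_spec (hP : G.IsPeriodic 2) {u v : V} (h : G.graph.Adj u v) (t : ℕ) :
    ∃ τ, t ≤ τ ∧ G.present s(u, v) τ ∧ G.crossed s(u, v) t = τ + 1 :=
  ⟨_, Nat.le_add_right _ _, hP.present_add_wait h t, hP.crossed_eq h t⟩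

theorem isCoverage_branch_cons {u v : V} (hu : u ∈ G.children o v) {t τ : ℕ}
    (hτ : t ≤ τ) (hp : G.present s(v, u) τ) {M : List (V × ℕ)}
    (hM : G.IsCoverage (G.subtree o u) u (τ + 1) M) :
    G.IsCoverage (G.branch o v u) v t ((u, τ) :: M) := by
  refine ⟨⟨hu.1, hp, hτ, hM.journey⟩, ?_, ?_⟩
  · intro w hw
    rcases mem_trace_cons.1 hw with rfl | hw
    · exact Set.mem_insert _ _
    · exact Set.mem_insert_of_mem _ (hM.inside w hw)
  · rintro w (rfl | hw)
    · exact mem_trace_self _ _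
    · exact mem_trace_cons.2 (Or.inr (hM.covers w hw))

theorem isCoverage_branch_return {u v : V} (hu : u ∈ G.children o v) {t τ τ' : ℕ}
    (hτ : t ≤ τ) (hp : G.present s(v, u) τ) {M : List (V × ℕ)}
    (hM : G.IsCoverage (G.subtree o u) u (τ + 1) M) (hend : endpoint u M = u)
    (hτ' : arrival (τ + 1) M ≤ τ') (hp' : G.present s(v, u) τ') :
    G.IsCoverage (G.branch o v u) v t ((u, τ) :: (M ++ [(v, τ')])) := by
  obtain ⟨⟨h1, h2, h3, h4⟩, h5, h6⟩ := isCoverage_branch_cons hu hτ hp hM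
  have key : ∀ w, w ∈ trace v ((u, τ) :: (M ++ [(v, τ')])) ↔ w ∈ trace v ((u, τ) :: M) := by
    intro w
    simp only [trace, List.map_cons, List.map_append, List.mem_cons, List.mem_append]
    simp only [List.map_nil, List.not_mem_nil]
    tauto
  refine ⟨⟨h1, h2, h3, ?_⟩, fun w hw => h5 w ((key w).1 hw), fun w hw => (key w).2 (h6 w hw)⟩
  rw [isJourney_append, hend]
  exact ⟨h4, hu.1.symm, by rwa [Sym2.eq_swap], hτ', trivial⟩

theorem IsPeriodic.branch_returnCosts_nonempty (hP : G.IsPeriodic 2) {u v : V}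
    (hu : u ∈ G.children o v) (h : ∀ t, (G.returnCosts (G.subtree o u) u t).Nonempty) (t : ℕ) :
    (G.returnCosts (G.branch o v u) v t).Nonempty := by
  obtain ⟨τ, h1, h2, -⟩ := hP.crossed_spec hu.1 t
  obtain ⟨M, h4, h5, -⟩ := exists_returnCost (h (τ + 1))
  obtain ⟨τ', k1, k2, -⟩ := hP.crossed_spec hu.1 (arrival (τ + 1) M)
  exact returnCosts_nonempty_of (isCoverage_branch_return hu h1 h2 h4 h5 k1 k2)
    (by simp [endpoint, endpoint_append])

/-- Crossing as early as possible both ways gives one inequality. Conversely, a reduced coverage is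
a single excursion, and neither its crossings nor its stay in the subtree can end before their
foremost dates. -/
theorem IsPeriodic.branch_returnCost (hP : G.IsPeriodic 2) (hT : G.graph.IsTree) {u v : V}
    (hu : u ∈ G.children o v) (h : ∀ t, (G.returnCosts (G.subtree o u) u t).Nonempty) (t : ℕ) :
    t + G.returnCost (G.branch o v u) v t =
      G.crossed s(v, u) (G.crossed s(v, u) t +
        G.returnCost (G.subtree o u) u (G.crossed s(v, u) t)) := by
  apply le_antisymm
  · obtain ⟨τ, h1, h2, h3⟩ := hP.crossed_spec hu.1 t
    obtain ⟨M, h4, h5, h6⟩ := exists_returnCost (h (τ + 1))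
    obtain ⟨τ', k1, k2, k3⟩ := hP.crossed_spec hu.1 (arrival (τ + 1) M)
    have := add_returnCost_le (isCoverage_branch_return hu h1 h2 h4 h5 k1 k2)
      (by simp [endpoint, endpoint_append]) le_rfl
    rw [h3, ← h6, k3]
    simpa [arrival, arrival_append] using this
  · obtain ⟨J, h1, h2, h3⟩ := exists_returnCost (hP.branch_returnCosts_nonempty hu h t)
    obtain ⟨J', k1, k2, k3, k4⟩ := exists_coverage_reduced hP.twoPeriodic h1
    obtain ⟨τ, M, l1, l2, l3, l4, l5⟩ := exists_coverage_of_branch hT hu k1 k2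
    obtain ⟨l5, τ', l6, l7, l8⟩ := l5 (k4.trans h2)
    have m1 := crossed_le l1 l2
    have m2 := add_returnCost_le l3 l5 m1
    have m3 := crossed_le (m2.trans l6) l7
    omega

theorem IsPeriodic.branch_coverCost (hP : G.IsPeriodic 2) (hT : G.graph.IsTree) {u v : V}
    (hu : u ∈ G.children o v) (h : ∀ t, (G.returnCosts (G.subtree o u) u t).Nonempty) (t : ℕ) :
    t + G.coverCost (G.branch o v u) v t =
      G.crossed s(v, u) t + G.coverCost (G.subtree o u) u (G.crossed s(v, u) t) := by
  apply le_antisymm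
  · obtain ⟨τ, h1, h2, h3⟩ := hP.crossed_spec hu.1 t
    obtain ⟨M, h4, h6⟩ := exists_coverCost (coverCosts_nonempty_of (h (τ + 1)))
    have := add_coverCost_le (isCoverage_branch_cons hu h1 h2 h4) le_rfl
    rw [h3, ← h6]
    simpa [arrival] using this
  · obtain ⟨J, h1, h3⟩ := exists_coverCost
      (coverCosts_nonempty_of (hP.branch_returnCosts_nonempty hu h t))
    obtain ⟨J', k1, k2, k3, k4⟩ := exists_coverage_reduced hP.twoPeriodic h1
    obtain ⟨τ, M, l1, l2, l3, l4, -⟩ := exists_coverage_of_branch hT hu k1 k2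
    have m1 := crossed_le l1 l2
    have m2 := add_coverCost_le l3 m1
    omega

/-- Coverage of the branches one after the other. -/
theorem exists_serve (v : V) (L : List V)
    (hne : ∀ u ∈ L, ∀ t, (G.returnCosts (G.branch o v u) v t).Nonempty) (t : ℕ) :
    ∃ J, G.IsCoverage (G.region o v L) v t J ∧ endpoint v J = v ∧
      arrival t J = G.serve o v t L := by
  induction L generalizing t with
  | nil =>
    refine ⟨[], ⟨trivial, ?_, ?_⟩, rfl, rfl⟩ <;> intro w <;> simp [trace, region]
  | cons u L ih =>
    obtain ⟨J₁, h1, h2, h3⟩ := exists_returnCost (hne u (by simp) t)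
    obtain ⟨J₂, k1, k2, k3⟩ := ih (fun u' hu' => hne u' (List.mem_cons_of_mem _ hu'))
      (t + G.returnCost (G.branch o v u) v t)
    refine ⟨J₁ ++ J₂, ⟨?_, ?_, ?_⟩, ?_, ?_⟩
    · rw [isJourney_append, h2, h3]
      exact ⟨h1.journey, k1.journey⟩
    · intro w hw
      rw [mem_trace_append, h2] at hw
      rcases hw with hw | hw
      · rcases h1.inside w hw with rfl | hw
        · exact Or.inl rfl
        · exact Or.inr ⟨u, by simp, hw⟩
      · rcases k1.inside w hw with rfl | ⟨u', hu', hw⟩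
        · exact Or.inl rfl
        · exact Or.inr ⟨u', List.mem_cons_of_mem _ hu', hw⟩
    · intro w hw
      rw [mem_trace_append, h2]
      rcases hw with rfl | ⟨u', hu', hw⟩
      · exact Or.inl (mem_trace_self _ _)
      · rcases List.mem_cons.1 hu' with rfl | hu'
        · exact Or.inl (h1.covers w (Set.mem_insert_of_mem _ hw))
        · exact Or.inr (k1.covers w (Or.inr ⟨u', hu', hw⟩))
    · rw [endpoint_append, h2, k2]
    · rw [arrival_append, h3, k3]
      rfl

theorem exists_serve_cover (v u : V) (L : List V)
    (hne : ∀ w ∈ u :: L, ∀ t, (G.returnCosts (G.branch o v w) v t).Nonempty) (t : ℕ) :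
    ∃ J, G.IsCoverage (G.region o v (u :: L)) v t J ∧
      arrival t J = G.serve o v t L + G.coverCost (G.branch o v u) v (G.serve o v t L) := by
  obtain ⟨J₂, k1, k2, k3⟩ := exists_serve v L (fun w hw => hne w (List.mem_cons_of_mem _ hw)) t
  obtain ⟨J₁, h1, h3⟩ := exists_coverCost
    (coverCosts_nonempty_of (hne u (by simp) (G.serve o v t L)))
  refine ⟨J₂ ++ J₁, ⟨?_, ?_, ?_⟩, ?_⟩
  · rw [isJourney_append, k2, k3]
    exact ⟨k1.journey, h1.journey⟩
  · intro w hw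
    rw [mem_trace_append, k2] at hw
    rcases hw with hw | hw
    · rcases k1.inside w hw with rfl | ⟨u', hu', hw⟩
      · exact Or.inl rfl
      · exact Or.inr ⟨u', List.mem_cons_of_mem _ hu', hw⟩
    · rcases h1.inside w hw with rfl | hw
      · exact Or.inl rfl
      · exact Or.inr ⟨u, by simp, hw⟩
  · intro w hw
    rw [mem_trace_append, k2]
    rcases hw with rfl | ⟨u', hu', hw⟩
    · exact Or.inl (mem_trace_self _ _)
    · rcases List.mem_cons.1 hu' with rfl | hu'
      · exact Or.inr (h1.covers w (Set.mem_insert_of_mem _ hw))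
      · exact Or.inl (k1.covers w (Or.inr ⟨u', hu', hw⟩))
  · rw [arrival_append, k3, h3]

theorem exists_children_list [Finite V] (G : TVG V) (o v : V) :
    ∃ L : List V, L.Nodup ∧ ∀ u, u ∈ L ↔ u ∈ G.children o v :=
  ⟨(Set.toFinite (G.children o v)).toFinset.toList, Finset.nodup_toList _, by simp⟩

/-- By induction from the leaves, the branches can be covered one after the other. So no infimum in
the recursion is one over the empty set. -/
theorem IsPeriodic.subtree_returnCosts_nonempty [Finite V] (hP : G.IsPeriodic 2)
    (hT : G.graph.IsTree) (v : V) : ∀ t, (G.returnCosts (G.subtree o v) v t).Nonempty := by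
  induction v using subtree_induction (o := o) hT with
  | h v ih =>
    intro t
    obtain ⟨L, -, hL⟩ := G.exists_children_list o v
    obtain ⟨J, h1, h2, -⟩ := exists_serve (G := G) (o := o) v L (fun u hu =>
      hP.branch_returnCosts_nonempty ((hL u).1 hu) (ih u ((hL u).1 hu))) t
    rw [region_eq_subtree hT hL] at h1
    exact returnCosts_nonempty_of h1 h2

end Costs

end TVG

/-! ### Parity types and the optimality of alternating orders. -/

namespace TVG

/-- The number of waiting steps in an optimal order of `x` branches that are fast at even dates
and `y` branches that are fast at odd dates, from date `t`. -/
def waste (x y t : ℕ) : ℕ :=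
  if t % 2 = 0 then (x - (y + 1)) + (y - x) else (y - (x + 1)) + (x - y)

/-- The cost of coverage with return depends on the parity of the start date only, and is of one of
the types `fw11`, `fw10`, `fw01`, with the parity that belongs to the type. -/
structure Typed (c : ℕ → ℕ) : Prop where
  mod : ∀ t, c t = c (t % 2)
  type : (c 0 = c 1 ∧ c 0 % 2 = 0) ∨ (c 1 = c 0 + 1 ∧ c 0 % 2 = 1) ∨ (c 0 = c 1 + 1 ∧ c 1 % 2 = 1)

/-- The least value of a cost function. -/
def low (c : ℕ → ℕ) : ℕ := min (c 0) (c 1)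

/-- The indicator of the type `fw10`. -/
def fastEven (c : ℕ → ℕ) : ℕ := if c 0 < c 1 then 1 else 0

/-- The indicator of the type `fw01`. -/
def fastOdd (c : ℕ → ℕ) : ℕ := if c 1 < c 0 then 1 else 0

/-- The case distinction in a form suited to linear arithmetic. For a nonconstant type the fast cost
is odd and the slow one even, so the coverage always ends at dates of one fixed parity. -/
theorem Typed.cases {c : ℕ → ℕ} (h : Typed c) :
    (c 0 = low c ∧ c 1 = low c ∧ low c % 2 = 0 ∧ fastEven c = 0 ∧ fastOdd c = 0) ∨
    (c 0 = low c ∧ c 1 = low c + 1 ∧ low c % 2 = 1 ∧ fastEven c = 1 ∧ fastOdd c = 0) ∨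
    (c 0 = low c + 1 ∧ c 1 = low c ∧ low c % 2 = 1 ∧ fastEven c = 0 ∧ fastOdd c = 1) := by
  unfold low fastEven fastOdd
  rcases h.type with ⟨h1, h2⟩ | ⟨h1, h2⟩ | ⟨h1, h2⟩
  · left; rw [if_neg (by omega), if_neg (by omega)]; omega
  · right; left; rw [if_pos (by omega), if_neg (by omega)]; omega
  · right; right; rw [if_neg (by omega), if_pos (by omega)]; omega

theorem Typed.eq_of_even {c : ℕ → ℕ} (h : Typed c) {t : ℕ} (ht : t % 2 = 0) : c t = c 0 := by
  rw [h.mod, ht]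

theorem Typed.eq_of_odd {c : ℕ → ℕ} (h : Typed c) {t : ℕ} (ht : t % 2 = 1) : c t = c 1 := by
  rw [h.mod, ht]

theorem waste_of_even {x y t : ℕ} (h : t % 2 = 0) : waste x y t = (x - (y + 1)) + (y - x) :=
  if_pos h

theorem waste_of_odd {x y t : ℕ} (h : t % 2 = 1) : waste x y t = (y - (x + 1)) + (x - y) :=
  if_neg (by omega)

/-- The date after an optimal sequence of coverages with costs `c i`, of total least cost `s`. -/
theorem Typed.waste_step {c : ℕ → ℕ} (h : Typed c) (x y t : ℕ) :
    low c + waste (fastEven c + x) (fastOdd c + y) t ≤ c t + waste x y (t + c t) := by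
  -- An even cost preserves the parity of the date and an odd one changes it. With `waste` evaluated
  -- at the resulting parity, each of the six cases is linear arithmetic.
  rcases Nat.mod_two_eq_zero_or_one t with ht | ht
  · rw [h.eq_of_even ht]
    rcases h.cases with ⟨h1, h2, h3, h4, h5⟩ | ⟨h1, h2, h3, h4, h5⟩ | ⟨h1, h2, h3, h4, h5⟩
    · rw [waste_of_even ht, waste_of_even (by omega)]; omega
    · rw [waste_of_even ht, waste_of_odd (by omega)]; omega
    · rw [waste_of_even ht, waste_of_even (by omega)]; omega
  · rw [h.eq_of_odd ht]
    rcases h.cases with ⟨h1, h2, h3, h4, h5⟩ | ⟨h1, h2, h3, h4, h5⟩ | ⟨h1, h2, h3, h4, h5⟩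
    · rw [waste_of_odd ht, waste_of_odd (by omega)]; omega
    · rw [waste_of_odd ht, waste_of_odd (by omega)]; omega
    · rw [waste_of_odd ht, waste_of_even (by omega)]; omega

/-- Nothing is lost if a slow branch is taken only when no branch that is fast at the present date
remains. -/
theorem Typed.waste_step_eq {c : ℕ → ℕ} (h : Typed c) {x y t : ℕ}
    (hx : t % 2 = 0 → fastOdd c = 1 → x = 0) (hy : t % 2 = 1 → fastEven c = 1 → y = 0) :
    low c + waste (fastEven c + x) (fastOdd c + y) t = c t + waste x y (t + c t) := by
  rcases Nat.mod_two_eq_zero_or_one t with ht | ht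
  · rw [h.eq_of_even ht]
    rcases h.cases with ⟨h1, h2, h3, h4, h5⟩ | ⟨h1, h2, h3, h4, h5⟩ | ⟨h1, h2, h3, h4, h5⟩
    · rw [waste_of_even ht, waste_of_even (by omega)]; omega
    · rw [waste_of_even ht, waste_of_odd (by omega)]; omega
    · have := hx ht h5
      rw [waste_of_even ht, waste_of_even (by omega)]; omega
  · rw [h.eq_of_odd ht]
    rcases h.cases with ⟨h1, h2, h3, h4, h5⟩ | ⟨h1, h2, h3, h4, h5⟩ | ⟨h1, h2, h3, h4, h5⟩
    · rw [waste_of_odd ht, waste_of_odd (by omega)]; omega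
    · have := hy ht h4
      rw [waste_of_odd ht, waste_of_odd (by omega)]; omega
    · rw [waste_of_odd ht, waste_of_even (by omega)]; omega

theorem waste_mod (x y t : ℕ) : waste x y t = waste x y (t % 2) := by
  simp [waste]

/-- The type of a tree in terms of the types of its branches. -/
theorem typed_add_waste {s x y : ℕ} (h : s % 2 = (x + y) % 2) :
    Typed fun t => s + waste x y t := by
  refine ⟨fun t => by simp only [waste_mod x y t], ?_⟩
  -- For `x = y` there is no waste and `s` is even. Otherwise the two wastes differ by one, the
  -- smaller one is the distance of `x` and `y` minus one, and the least cost is odd.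
  simp only [waste_of_even (t := 0) rfl, waste_of_odd (t := 1) rfl]
  omega

/-- The type of a branch in terms of the type of its subtree; `w` is the waiting time for the
edge. -/
theorem Typed.branch {c d w : ℕ → ℕ} (h : Typed c) (hw : ∀ t, w t = w (t % 2))
    (hw' : w 0 + w 1 ≤ 1) (hd : ∀ t, t + d t =
      t + w t + 1 + c (t + w t + 1) + w (t + w t + 1 + c (t + w t + 1)) + 1) :
    Typed d := by
  have h0 := hd 0
  have h1 := hd 1
  have hdm : ∀ t, d t = d (t % 2) := by
    intro t
    have k1 := hd t
    have k2 := hd (t % 2)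
    have k3 : c (t + w t + 1) = c (t % 2 + w (t % 2) + 1) := by
      rw [h.mod, h.mod (t % 2 + _ + 1), ← hw]; congr 1; omega
    rw [k3] at k1
    have k4 : w (t + w t + 1 + c (t % 2 + w (t % 2) + 1)) =
        w (t % 2 + w (t % 2) + 1 + c (t % 2 + w (t % 2) + 1)) := by
      rw [hw, hw (t % 2 + w (t % 2) + 1 + _), ← hw t]; congr 1; omega
    rw [k4, hw t] at k1
    omega
  refine ⟨hdm, ?_⟩
  have e0 : ∀ {t}, t % 2 = 0 → w t = w 0 := fun {t} ht => by rw [hw, ht]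
  have e1 : ∀ {t}, t % 2 = 1 → w t = w 1 := fun {t} ht => by rw [hw, ht]
  have c0 : ∀ {t}, t % 2 = 0 → c t = c 0 := h.eq_of_even
  have c1 : ∀ {t}, t % 2 = 1 → c t = c 1 := h.eq_of_odd
  obtain ⟨hw0, hw1⟩ | ⟨hw0, hw1⟩ | ⟨hw0, hw1⟩ :
    (w 0 = 0 ∧ w 1 = 0) ∨ (w 0 = 0 ∧ w 1 = 1) ∨ (w 0 = 1 ∧ w 1 = 0) := by omega
  -- The edge is always available. The branch costs two more than the subtree one date later, so the
  -- types `fw10` and `fw01` are exchanged.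
  · simp only [hw0, hw1] at h0 h1
    norm_num at h0 h1
    rw [c0 (t := 2) rfl] at h1
    have a1 : ∀ t, w t = 0 := fun t => by
      rcases Nat.mod_two_eq_zero_or_one t with ht | ht
      · rw [e0 ht, hw0]
      · rw [e1 ht, hw1]
    rw [a1] at h0 h1
    rcases h.type with h | h | h <;> omega
  -- The edge is available at even dates only. The child is always reached, and the return
  -- completed, at an odd date; so a start at `1` costs one more than a start at `0`, and the type
  -- is `fw10`.
  · simp only [hw0, hw1] at h0 h1
    norm_num at h0 h1
    rw [c1 (t := 3) rfl] at h1
    rcases h.type with h | h | h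
    · rw [e1 (by omega)] at h0 h1; omega
    · rw [e1 (by omega)] at h0 h1; omega
    · rw [e0 (by omega)] at h0 h1; omega
  -- The mirror case: the edge is available at odd dates only, and the type is `fw01`.
  · simp only [hw0, hw1] at h0 h1
    norm_num at h0 h1
    rw [c0 (t := 2) rfl] at h0 h1
    rcases h.type with h | h | h
    · rw [e0 (by omega)] at h0 h1; omega
    · rw [e1 (by omega)] at h0 h1; omega
    · rw [e0 (by omega)] at h0 h1; omega

variable {V : Type*} {G : TVG V} {o : V}

/-- The cost of foremost coverage with return of the branch at `v` through `u`. -/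
noncomputable def branchCost (G : TVG V) (o v u : V) (t : ℕ) : ℕ :=
  G.returnCost (G.branch o v u) v t

/-- The least cost of the listed branches, the number of those that are fast at even, and of those
that are fast at odd dates. -/
noncomputable def listCost (G : TVG V) (o v : V) (t : ℕ) (L : List V) : ℕ :=
  (L.map fun u => low (G.branchCost o v u)).sum +
    waste (L.map fun u => fastEven (G.branchCost o v u)).sum
      (L.map fun u => fastOdd (G.branchCost o v u)).sum t

theorem listCost_perm {v : V} {t : ℕ} {L L' : List V} (h : L.Perm L') :
    G.listCost o v t L = G.listCost o v t L' := by
  unfold listCost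
  rw [(h.map _).sum_eq, (h.map fun u => fastEven (G.branchCost o v u)).sum_eq,
    (h.map fun u => fastOdd (G.branchCost o v u)).sum_eq]

/-- Induction along the order, with `waste` as the potential controlled by `Typed.waste_step`. -/
theorem listCost_le_serve {v : V} {L : List V} (hL : ∀ u ∈ L, Typed (G.branchCost o v u))
    (t : ℕ) : t + G.listCost o v t L ≤ G.serve o v t L := by
  induction L generalizing t with
  | nil => simp [listCost, serve, waste]
  | cons u L ih =>
    have h1 := ih (fun w hw => hL w (List.mem_cons_of_mem _ hw)) (t + G.branchCost o v u t)
    have h2 := (hL u (by simp)).waste_step (L.map fun u => fastEven (G.branchCost o v u)).sum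
      (L.map fun u => fastOdd (G.branchCost o v u)).sum t
    simp only [listCost, serve, List.map_cons, List.sum_cons] at h1 h2 ⊢
    change _ ≤ G.serve o v (t + G.branchCost o v u t) L
    omega

/-- A branch contributes an odd least cost exactly if it is counted in `x` or `y`, so the sum of the
least costs has the parity of `x + y`. -/
theorem typed_listCost {v : V} {L : List V} (hL : ∀ u ∈ L, Typed (G.branchCost o v u)) :
    Typed fun t => G.listCost o v t L := by
  apply typed_add_waste
  induction L with
  | nil => rfl
  | cons u L ih =>
    have := ih fun w hw => hL w (List.mem_cons_of_mem _ hw)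
    simp only [List.map_cons, List.sum_cons]
    rcases (hL u (by simp)).cases with h | h | h <;> omega

section Types

variable {S : Set V} {r : V}

/-- The minimum over all start dates is one over the two parities, which translates the types into
inequalities between two numbers. -/
theorem fastestAt_iff (hne : ∀ t, (G.returnCosts S r t).Nonempty)
    (hc : Typed (G.returnCost S r)) :
    G.fastestReturn S r = low (G.returnCost S r) ∧
      ∀ t, G.FastestAt S r t ↔ G.returnCost S r t = low (G.returnCost S r) := by
  have hle : ∀ t, low (G.returnCost S r) ≤ G.returnCost S r t := by
    intro t
    rw [hc.mod, low]
    rcases Nat.mod_two_eq_zero_or_one t with h | h <;> rw [h] <;> omega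
  have hmem : ∀ t, G.returnCost S r t ∈ G.returnCosts S r t := fun t => Nat.sInf_mem (hne t)
  have h1 : G.fastestReturn S r = low (G.returnCost S r) := by
    apply le_antisymm
    · apply Nat.sInf_le
      rcases min_choice (G.returnCost S r 0) (G.returnCost S r 1) with h | h
      · exact ⟨0, by rw [low, h]; exact hmem 0⟩
      · exact ⟨1, by rw [low, h]; exact hmem 1⟩
    · refine le_csInf ⟨_, 0, hmem 0⟩ ?_
      rintro c ⟨t, ht⟩
      exact (hle t).trans (Nat.sInf_le ht)
  refine ⟨h1, fun t => ?_⟩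
  rw [FastestAt, h1]
  constructor
  · intro h
    exact le_antisymm (Nat.sInf_le h) (hle t)
  · intro h
    rw [← h]
    exact hmem t

theorem type_of_typed (hne : ∀ t, (G.returnCosts S r t).Nonempty)
    (hc : Typed (G.returnCost S r)) :
    (G.FW11 S r ∧ Even (G.fastestReturn S r)) ∨
      (G.FW10 S r ∧ Odd (G.fastestReturn S r)) ∨ (G.FW01 S r ∧ Odd (G.fastestReturn S r)) := by
  obtain ⟨h1, h2⟩ := fastestAt_iff hne hc
  rw [h1, Nat.even_iff, Nat.odd_iff]
  have key : ∀ t, (t % 2 = 0 ∧ G.returnCost S r t = G.returnCost S r 0) ∨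
      (t % 2 = 1 ∧ G.returnCost S r t = G.returnCost S r 1) := fun t => by
    rcases Nat.mod_two_eq_zero_or_one t with h | h
    · exact Or.inl ⟨h, hc.eq_of_even h⟩
    · exact Or.inr ⟨h, hc.eq_of_odd h⟩
  rcases hc.cases with h | h | h
  · left
    refine ⟨fun t => ?_, by omega⟩
    rw [h2]
    rcases key t with k | k <;> omega
  · right; left
    refine ⟨fun t => ?_, by omega⟩
    rw [h2, Nat.even_iff]
    rcases key t with k | k <;> omega
  · right; right
    refine ⟨fun t => ?_, by omega⟩
    rw [h2, Nat.odd_iff]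
    rcases key t with k | k <;> omega

theorem fw10_iff (hne : ∀ t, (G.returnCosts S r t).Nonempty) (hc : Typed (G.returnCost S r)) :
    G.FW10 S r ↔ fastEven (G.returnCost S r) = 1 := by
  obtain ⟨-, h2⟩ := fastestAt_iff hne hc
  have key : ∀ t, (t % 2 = 0 ∧ G.returnCost S r t = G.returnCost S r 0) ∨
      (t % 2 = 1 ∧ G.returnCost S r t = G.returnCost S r 1) := fun t => by
    rcases Nat.mod_two_eq_zero_or_one t with h | h
    · exact Or.inl ⟨h, hc.eq_of_even h⟩
    · exact Or.inr ⟨h, hc.eq_of_odd h⟩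
  simp only [FW10, h2, Nat.even_iff]
  rcases hc.cases with h | h | h
  · refine ⟨fun k => ?_, fun k => by omega⟩
    have := k 1
    omega
  · refine ⟨fun _ => by omega, fun k t => ?_⟩
    rcases key t with k | k <;> omega
  · refine ⟨fun k => ?_, fun k => by omega⟩
    have := k 1
    omega

theorem fw01_iff (hne : ∀ t, (G.returnCosts S r t).Nonempty) (hc : Typed (G.returnCost S r)) :
    G.FW01 S r ↔ fastOdd (G.returnCost S r) = 1 := by
  obtain ⟨-, h2⟩ := fastestAt_iff hne hc
  have key : ∀ t, (t % 2 = 0 ∧ G.returnCost S r t = G.returnCost S r 0) ∨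
      (t % 2 = 1 ∧ G.returnCost S r t = G.returnCost S r 1) := fun t => by
    rcases Nat.mod_two_eq_zero_or_one t with h | h
    · exact Or.inl ⟨h, hc.eq_of_even h⟩
    · exact Or.inr ⟨h, hc.eq_of_odd h⟩
  simp only [FW01, h2, Nat.odd_iff]
  rcases hc.cases with h | h | h
  · refine ⟨fun k => ?_, fun k => by omega⟩
    have := k 0
    omega
  · refine ⟨fun k => ?_, fun k => by omega⟩
    have := k 0
    omega
  · refine ⟨fun _ => by omega, fun k t => ?_⟩
    rcases key t with k | k <;> omega

end Types

theorem exists_alternating_perm (G : TVG V) (o v : V) (t : ℕ) (L : List V) :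
    ∃ L', L'.Perm L ∧ G.Alternating o v t L' := by
  classical
  induction hn : L.length generalizing t L with
  | zero =>
    rw [List.length_eq_zero_iff] at hn
    exact ⟨L, .refl _, .rest t L (by simp [hn])⟩
  | succ n ih =>
    by_cases h : ∃ u ∈ L, G.Favourable o v t u
    · obtain ⟨u, hu, hf⟩ := h
      obtain ⟨L', h1, h2⟩ := ih (t + 1) (L.erase u)
        (by rw [List.length_erase_of_mem hu]; omega)
      exact ⟨u :: L', (h1.cons u).trans (List.perm_cons_erase hu).symm, .step t u L' hf h2⟩
    · exact ⟨L, .refl _, .rest t L fun u hu hf => h ⟨u, hu, hf⟩⟩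

theorem alternating_of_mod_eq {v : V} {s t : ℕ} (h : s % 2 = t % 2) {L : List V}
    (hL : G.Alternating o v s L) : G.Alternating o v t L := by
  have key : ∀ {s t : ℕ}, s % 2 = t % 2 → ∀ {u}, G.Favourable o v s u →
      G.Favourable o v t u := by
    intro s t h u
    simp only [Favourable, Nat.even_iff, Nat.odd_iff, h]
    exact id
  induction hL generalizing t with
  | step s u L hf _ ih => exact .step t u L (key h hf) (ih (by omega))
  | rest s L hf => exact .rest t L fun u hu k => hf u hu (key h.symm k)

theorem sum_eq_zero_of_forall {L : List V} {f : V → ℕ} (h : ∀ u ∈ L, f u = 0) :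
    (L.map f).sum = 0 :=
  List.sum_eq_zero fun x hx => by
    obtain ⟨u, hu, rfl⟩ := List.mem_map.1 hx
    exact h u hu

/-- Every choice in an alternating order satisfies the conditions of `Typed.waste_step_eq`, so the
potential is attained exactly. -/
theorem serve_eq_of_alternating {v : V} {L : List V}
    (hne : ∀ u ∈ L, ∀ t, (G.returnCosts (G.branch o v u) v t).Nonempty)
    (hL : ∀ u ∈ L, Typed (G.branchCost o v u)) {t : ℕ} (h : G.Alternating o v t L) :
    G.serve o v t L = t + G.listCost o v t L := by
  have hfav : ∀ u ∈ L, ∀ t, G.Favourable o v t u ↔ (t % 2 = 0 ∧ fastEven (G.branchCost o v u) = 1) ∨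
      (t % 2 = 1 ∧ fastOdd (G.branchCost o v u) = 1) := fun u hu t => by
    rw [Favourable, fw10_iff (hne u hu) (hL u hu), fw01_iff (hne u hu) (hL u hu), Nat.even_iff,
      Nat.odd_iff]
    rfl
  induction L generalizing t with
  | nil => simp [listCost, serve, waste]
  | cons u L ih =>
    have hu := hL u (by simp)
    have hsub : ∀ w ∈ L, w ∈ u :: L := fun w hw => List.mem_cons_of_mem _ hw
    have key : G.Alternating o v (t + G.branchCost o v u t) L ∧
        (t % 2 = 0 → fastOdd (G.branchCost o v u) = 1 →
          (L.map fun u => fastEven (G.branchCost o v u)).sum = 0) ∧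
        (t % 2 = 1 → fastEven (G.branchCost o v u) = 1 →
          (L.map fun u => fastOdd (G.branchCost o v u)).sum = 0) := by
      cases h with
      | step _ _ _ hf hA =>
        rw [hfav u (by simp)] at hf
        refine ⟨alternating_of_mod_eq ?_ hA, ?_, ?_⟩
        -- The favourable branch has odd cost, so the real date after it has the parity of `t + 1`.
        · rcases hf with ⟨h1, h2⟩ | ⟨h1, h2⟩
          · rw [hu.eq_of_even h1]
            rcases hu.cases with h | h | h <;> omega
          · rw [hu.eq_of_odd h1]
            rcases hu.cases with h | h | h <;> omega
        · intro h1 h2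
          rcases hu.cases with h | h | h <;> omega
        · intro h1 h2
          rcases hu.cases with h | h | h <;> omega
      | rest _ _ hf =>
        have hu' := hf u (by simp)
        rw [hfav u (by simp)] at hu'
        -- A branch that is not favourable is constant or slow. Its cost is even in both cases, so
        -- the parity stays and the remaining branches stay unfavourable.
        have hpar : (t + G.branchCost o v u t) % 2 = t % 2 := by
          rcases Nat.mod_two_eq_zero_or_one t with h1 | h1
          · rw [hu.eq_of_even h1]
            rcases hu.cases with h | h | h <;> omega
          · rw [hu.eq_of_odd h1]
            rcases hu.cases with h | h | h <;> omega
        refine ⟨alternating_of_mod_eq hpar.symm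
          (.rest t L fun w hw => hf w (hsub w hw)), ?_, ?_⟩
        · intro h1 _
          refine sum_eq_zero_of_forall fun w hw => ?_
          have := hf w (hsub w hw)
          rw [hfav w (hsub w hw)] at this
          rcases (hL w (hsub w hw)).cases with h | h | h <;> omega
        · intro h1 _
          refine sum_eq_zero_of_forall fun w hw => ?_
          have := hf w (hsub w hw)
          rw [hfav w (hsub w hw)] at this
          rcases (hL w (hsub w hw)).cases with h | h | h <;> omega
    have h1 := ih (fun w hw => hne w (hsub w hw)) (fun w hw => hL w (hsub w hw)) key.1
      (fun w hw => hfav w (hsub w hw))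
    have h2 := hu.waste_step_eq key.2.1 key.2.2
    simp only [listCost, serve, List.map_cons, List.sum_cons] at h1 h2 ⊢
    change G.serve o v (t + G.branchCost o v u t) L = _
    omega

theorem IsPeriodic.wait_add_wait_le (hP : G.IsPeriodic 2) {u v : V} (h : G.graph.Adj u v) :
    G.wait s(u, v) 0 + G.wait s(u, v) 1 ≤ 1 := by
  have h0 := G.wait_le s(u, v) 0
  have h1 := G.wait_le s(u, v) 1
  by_contra hlt
  have h2 := hP.present_add_wait h 0
  rw [show 0 + G.wait s(u, v) 0 = 1 by omega] at h2
  have : G.wait s(u, v) 1 = 0 := by rw [wait, if_pos h2]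
  omega

theorem coverCost_leaf (hT : G.graph.IsTree) {v : V} (h : G.children o v = ∅) (t : ℕ) :
    G.coverCost (G.subtree o v) v t = 0 := by
  have hS : ∀ w, w ∈ G.subtree o v ↔ w = v := fun w => by
    rw [mem_subtree_cases hT, h]; simp
  have : G.IsCoverage (G.subtree o v) v t [] :=
    ⟨trivial, fun w => by simp [trace, hS], fun w => by simp [trace, hS]⟩
  have := add_coverCost_le this le_rfl
  simp only [arrival] at this
  omega

theorem one_le_entries {S : Set V} {x : V} {J : List (V × ℕ)} (hx : x ∉ S)
    (h : ∃ w ∈ trace x J, w ∈ S) : 1 ≤ entries S x J := by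
  induction J generalizing x with
  | nil =>
    obtain ⟨w, hw, hS⟩ := h
    simp only [trace, List.map_nil, List.mem_singleton] at hw
    exact absurd (hw ▸ hS) hx
  | cons b J ih =>
    obtain ⟨y, τ⟩ := b
    simp only [entries]
    by_cases hy : y ∈ S
    · rw [if_pos ⟨hx, hy⟩]; omega
    · obtain ⟨w, hw, hS⟩ := h
      have := ih hy ⟨w, (mem_trace_cons.1 hw).resolve_left (fun h => hx (h ▸ hS)), hS⟩
      omega

theorem entries_eq_zero {S : Set V} {x : V} {J : List (V × ℕ)}
    (h : ∀ w ∈ trace x J, w ∉ S) : entries S x J = 0 := by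
  induction J generalizing x with
  | nil => rfl
  | cons b J ih =>
    obtain ⟨y, τ⟩ := b
    rw [entries, ih fun w hw => h w (mem_trace_cons.2 (Or.inr hw)), if_neg]
    rintro ⟨-, hy⟩
    exact h y (mem_trace_cons.2 (Or.inr (mem_trace_self _ _))) hy

theorem entries_eq_zero_of_inside {S : Set V} {x : V} {J : List (V × ℕ)}
    (h : ∀ w ∈ trace x J, w ∈ S) : entries S x J = 0 := by
  induction J generalizing x with
  | nil => rfl
  | cons b J ih =>
    obtain ⟨y, τ⟩ := b
    rw [entries, ih fun w hw => h w (mem_trace_cons.2 (Or.inr hw)), if_neg]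
    rintro ⟨hx, -⟩
    exact hx (h x (mem_trace_self _ _))

theorem entries_append (S : Set V) (x : V) (J K : List (V × ℕ)) :
    entries S x (J ++ K) = entries S x J + entries S (endpoint x J) K := by
  induction J generalizing x with
  | nil => simp [entries, endpoint]
  | cons b J ih =>
    obtain ⟨y, τ⟩ := b
    simp only [List.cons_append, entries, endpoint, ih]
    omega

/-- A reduced journey enters a subtree at most once. -/
theorem Reduced.entries_le_one (hT : G.graph.IsTree) {u v : V} {t : ℕ} {J : List (V × ℕ)}
    (hu : u ∈ G.children o v) (hJ : G.IsJourney o t J) (hr : Reduced o J) :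
    entries (G.subtree o u) o J ≤ 1 := by
  rcases exists_split (G.subtree o u)ᶜ o J
    (root_notMem_subtree (ne_root_of_mem_children hT hu)) with h | ⟨M, a, τ, K, rfl, h2, h3⟩
  · rw [entries_eq_zero h]; omega
  · rw [isJourney_append] at hJ
    obtain ⟨hend, rfl⟩ := enter_subtree hT hu hJ.2.1 (h2 _ (endpoint_mem_trace _ _)) (not_not.1 h3)
    rw [entries_append, entries_eq_zero h2, entries, zero_add]
    have hr' := hr.suffix
    have hJ' := hJ.2
    rw [hend] at hr' hJ' ⊢
    have hK : entries (G.subtree o a) a K = 0 := by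
      rcases reduced_cons_cases hT hu hJ' hr' with h | ⟨M, τ', J, rfl, k1, k2, k3⟩
      · exact entries_eq_zero_of_inside h
      · rw [entries_append, entries_eq_zero_of_inside k2, k1, entries, entries_eq_zero k3,
          if_neg fun h => h.1 (self_mem_subtree G o a)]
    rw [hK]
    split <;> omega

/-! ### Assembly of the structural statements. -/

section Main

variable [Finite V]

theorem IsPeriodic.branchCost_eq (hP : G.IsPeriodic 2) (hT : G.graph.IsTree) {u v : V}
    (hu : u ∈ G.children o v) (t : ℕ) : t + G.branchCost o v u t =
      t + G.wait s(v, u) t + 1 + G.returnCost (G.subtree o u) u (t + G.wait s(v, u) t + 1) +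
        G.wait s(v, u) (t + G.wait s(v, u) t + 1 +
          G.returnCost (G.subtree o u) u (t + G.wait s(v, u) t + 1)) + 1 := by
  have := hP.branch_returnCost hT hu (hP.subtree_returnCosts_nonempty hT u) t
  rwa [hP.crossed_eq hu.1, hP.crossed_eq hu.1] at this

theorem IsPeriodic.branch_nonempty (hP : G.IsPeriodic 2) (hT : G.graph.IsTree) {u v : V}
    (hu : u ∈ G.children o v) (t : ℕ) : (G.returnCosts (G.branch o v u) v t).Nonempty :=
  hP.branch_returnCosts_nonempty hu (hP.subtree_returnCosts_nonempty hT u) t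

theorem IsPeriodic.typed_branchCost_of (hP : G.IsPeriodic 2) (hT : G.graph.IsTree) {u v : V}
    (hu : u ∈ G.children o v) (h : Typed (G.returnCost (G.subtree o u) u)) :
    Typed (G.branchCost o v u) :=
  h.branch (fun t => wait_eq_of_mod_eq hP.twoPeriodic hu.1 (Nat.mod_mod t 2).symm)
    (hP.wait_add_wait_le hu.1) (hP.branchCost_eq hT hu)

/-- An alternating order gives the upper bound, and the order read off from a reduced optimal
coverage the lower one. The types of the branches are a hypothesis because the induction that proves
them uses this formula. -/
theorem IsPeriodic.returnCost_eq_of_typed (hP : G.IsPeriodic 2) (hT : G.graph.IsTree) {v : V}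
    {L : List V} (hnd : L.Nodup) (hL : ∀ u, u ∈ L ↔ u ∈ G.children o v)
    (hty : ∀ u ∈ L, Typed (G.branchCost o v u)) (t : ℕ) :
    G.returnCost (G.subtree o v) v t = G.listCost o v t L := by
  have hne : ∀ u ∈ L, ∀ t, (G.returnCosts (G.branch o v u) v t).Nonempty :=
    fun u hu => hP.branch_nonempty hT ((hL u).1 hu)
  apply le_antisymm
  · obtain ⟨L', h1, h2⟩ := G.exists_alternating_perm o v t L
    obtain ⟨J, k1, k2, k3⟩ := exists_serve v L' (fun u hu => hne u (h1.mem_iff.1 hu)) t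
    rw [region_eq_subtree hT fun u => (h1.mem_iff.trans (hL u))] at k1
    rw [serve_eq_of_alternating (fun u hu => hne u (h1.mem_iff.1 hu))
      (fun u hu => hty u (h1.mem_iff.1 hu)) h2, listCost_perm h1] at k3
    have := add_returnCost_le k1 k2 le_rfl
    omega
  · obtain ⟨J, h1, h2, h3⟩ := exists_returnCost (hP.subtree_returnCosts_nonempty (o := o) hT v t)
    obtain ⟨J', k1, k2, k3, k4⟩ := exists_coverage_reduced hP.twoPeriodic h1
    rw [← region_eq_subtree hT hL] at k1
    obtain ⟨L', p1, p2⟩ := exists_serve_le hT (fun u hu => (hL u).1 hu) k1 k2 (k4.trans h2) hnd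
    have := listCost_le_serve (fun u hu => hty u (p1.mem_iff.1 hu)) t
    rw [listCost_perm p1] at this
    omega

theorem IsPeriodic.typed_subtree (hP : G.IsPeriodic 2) (hT : G.graph.IsTree) (v : V) :
    Typed (G.returnCost (G.subtree o v) v) := by
  induction v using subtree_induction (o := o) hT with
  | h v ih =>
    obtain ⟨L, hnd, hL⟩ := G.exists_children_list o v
    have hty : ∀ u ∈ L, Typed (G.branchCost o v u) := fun u hu =>
      hP.typed_branchCost_of hT ((hL u).1 hu) (ih u ((hL u).1 hu))
    rw [funext (hP.returnCost_eq_of_typed hT hnd hL hty)]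
    exact typed_listCost hty

theorem IsPeriodic.typed_branchCost (hP : G.IsPeriodic 2) (hT : G.graph.IsTree) {u v : V}
    (hu : u ∈ G.children o v) : Typed (G.branchCost o v u) :=
  hP.typed_branchCost_of hT hu (hP.typed_subtree hT u)

theorem IsPeriodic.returnCost_eq (hP : G.IsPeriodic 2) (hT : G.graph.IsTree) {v : V}
    {L : List V} (hnd : L.Nodup) (hL : ∀ u, u ∈ L ↔ u ∈ G.children o v) (t : ℕ) :
    G.returnCost (G.subtree o v) v t = G.listCost o v t L :=
  hP.returnCost_eq_of_typed hT hnd hL (fun u hu => hP.typed_branchCost hT ((hL u).1 hu)) t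

/-- Alternating orders are optimal. -/
theorem IsPeriodic.serve_eq (hP : G.IsPeriodic 2) (hT : G.graph.IsTree) {v : V}
    {L : List V} (hL : ∀ u ∈ L, u ∈ G.children o v) {t : ℕ} (h : G.Alternating o v t L) :
    G.serve o v t L = t + G.listCost o v t L :=
  serve_eq_of_alternating (fun u hu => hP.branch_nonempty hT (hL u hu))
    (fun u hu => hP.typed_branchCost hT (hL u hu)) h

theorem IsPeriodic.add_coverCost_le_serve (hP : G.IsPeriodic 2) (hT : G.graph.IsTree) {u v : V}
    {L : List V} (hL : ∀ w, w ∈ u :: L ↔ w ∈ G.children o v) (t : ℕ) :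
    t + G.coverCost (G.subtree o v) v t ≤
      G.serve o v t L + G.coverCost (G.branch o v u) v (G.serve o v t L) := by
  obtain ⟨J, h1, h2⟩ := exists_serve_cover v u L
    (fun w hw => hP.branch_nonempty hT ((hL w).1 hw)) t
  rw [region_eq_subtree hT hL] at h1
  exact h2 ▸ add_coverCost_le h1 le_rfl

/-- In the order read off from a reduced optimal coverage, the branches before the last one are
rearranged into an alternating order. The agent is then back at `v` no later, which by
`add_coverCost_mono` cannot delay the end. -/
theorem IsPeriodic.exists_coverCost_eq (hP : G.IsPeriodic 2) (hT : G.graph.IsTree) {v : V}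
    (h : (G.children o v).Nonempty) (t : ℕ) :
    ∃ (u : V) (L : List V), (u :: L).Nodup ∧ (∀ w, w ∈ u :: L ↔ w ∈ G.children o v) ∧
      G.Alternating o v t L ∧ t + G.coverCost (G.subtree o v) v t =
        G.serve o v t L + G.coverCost (G.branch o v u) v (G.serve o v t L) := by
  obtain ⟨L, hnd, hL⟩ := G.exists_children_list o v
  have hL0 : L ≠ [] := by
    rintro rfl
    obtain ⟨u, hu⟩ := h
    simpa using (hL u).2 hu
  obtain ⟨J, h1, h3⟩ := exists_coverCost
    (coverCosts_nonempty_of (hP.subtree_returnCosts_nonempty (o := o) hT v t))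
  obtain ⟨J', k1, k2, k3, -⟩ := exists_coverage_reduced hP.twoPeriodic h1
  rw [← region_eq_subtree hT hL] at k1
  obtain ⟨u, L', p1, p2⟩ := exists_serve_cover_le hT (fun u hu => (hL u).1 hu) hL0 k1 k2 hnd
  obtain ⟨L₂, q1, q2⟩ := G.exists_alternating_perm o v t L'
  have r1 := (q1.cons u).trans p1
  have hmem : ∀ w, w ∈ u :: L₂ ↔ w ∈ G.children o v := fun w => r1.mem_iff.trans (hL w)
  refine ⟨u, L₂, r1.nodup_iff.2 hnd, hmem, q2, le_antisymm
    (hP.add_coverCost_le_serve hT hmem t) ?_⟩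
  have s1 : G.serve o v t L₂ ≤ G.serve o v t L' := by
    rw [hP.serve_eq hT (fun w hw => (hmem w).1 (List.mem_cons_of_mem _ hw)) q2,
      listCost_perm q1]
    exact listCost_le_serve (fun w hw => hP.typed_branchCost hT
      ((hL w).1 (p1.mem_iff.1 (List.mem_cons_of_mem _ hw)))) t
  have s2 := add_coverCost_mono s1 (coverCosts_nonempty_of
    (hP.branch_nonempty hT ((hmem u).1 (by simp)) (G.serve o v t L')))
  omega

theorem IsPeriodic.isLeast_coverCost (hP : G.IsPeriodic 2) (hT : G.graph.IsTree) {v : V}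
    (h : (G.children o v).Nonempty) (t : ℕ) : IsLeast
      {x | ∃ (u : V) (L : List V), (u :: L).Nodup ∧
        (∀ w, w ∈ u :: L ↔ w ∈ G.children o v) ∧ G.Alternating o v t L ∧
        x = G.serve o v t L + G.coverCost (G.branch o v u) v (G.serve o v t L)}
      (t + G.coverCost (G.subtree o v) v t) := by
  refine ⟨hP.exists_coverCost_eq hT h t, ?_⟩
  rintro x ⟨u, L, -, h2, -, rfl⟩
  exact hP.add_coverCost_le_serve hT h2 t

/-- The date at which the listed branches are covered optimally and the one through `u` is covered
without return afterwards. -/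
noncomputable def coverDate (G : TVG V) (o v : V) (t : ℕ) (u : V) (L : List V) : ℕ :=
  t + G.listCost o v t L + G.coverCost (G.branch o v u) v (t + G.listCost o v t L)

theorem IsPeriodic.add_coverCost_le_coverDate (hP : G.IsPeriodic 2) (hT : G.graph.IsTree)
    {u v : V} {L : List V} (hL : ∀ w, w ∈ u :: L ↔ w ∈ G.children o v) (t : ℕ) :
    t + G.coverCost (G.subtree o v) v t ≤ G.coverDate o v t u L := by
  obtain ⟨L', q1, q2⟩ := G.exists_alternating_perm o v t L
  have hL' : ∀ w, w ∈ u :: L' ↔ w ∈ G.children o v := fun w => (q1.cons u).mem_iff.trans (hL w)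
  have := hP.add_coverCost_le_serve hT hL' t
  rwa [hP.serve_eq hT (fun w hw => (hL' w).1 (List.mem_cons_of_mem _ hw)) q2,
    listCost_perm q1] at this

theorem IsPeriodic.exists_coverDate_eq (hP : G.IsPeriodic 2) (hT : G.graph.IsTree) {v : V}
    (h : (G.children o v).Nonempty) (t : ℕ) :
    ∃ (u : V) (L : List V), (u :: L).Nodup ∧ (∀ w, w ∈ u :: L ↔ w ∈ G.children o v) ∧
      t + G.coverCost (G.subtree o v) v t = G.coverDate o v t u L := by
  obtain ⟨u, L, h1, h2, h3, h4⟩ := hP.exists_coverCost_eq hT h t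
  refine ⟨u, L, h1, h2, ?_⟩
  rwa [hP.serve_eq hT (fun w hw => (h2 w).1 (List.mem_cons_of_mem _ hw)) h3] at h4

/-- Reducing an optimal journey keeps it optimal. Reducedness allows at most one entry into a
subtree, and visiting its vertices from outside requires one. -/
theorem IsPeriodic.exists_optimal_entries (hP : G.IsPeriodic 2) (hT : G.graph.IsTree) (o : V) :
    ∃ J, G.IsOptimal o J ∧ ∀ u, u ≠ o → entries (G.subtree o u) o J = 1 := by
  obtain ⟨J, h1, h2⟩ := exists_coverCost
    (coverCosts_nonempty_of (hP.subtree_returnCosts_nonempty (o := o) hT o 0))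
  obtain ⟨J', k1, k2, k3, -⟩ := exists_coverage_reduced hP.twoPeriodic h1
  rw [subtree_root] at h2 k1
  refine ⟨J', ⟨k1, fun J₂ hJ₂ => ?_⟩, fun u hu => ?_⟩
  · have := add_coverCost_le hJ₂ le_rfl
    omega
  · obtain ⟨v, hv⟩ := exists_parent hT hu
    exact le_antisymm (k2.entries_le_one hT hv k1.journey)
      (one_le_entries (root_notMem_subtree hu) ⟨u, k1.covers u trivial, self_mem_subtree G o u⟩)

/-- The structure of optimal solutions in a tree of period two. -/
theorem IsPeriodic.tree_structure (hP : G.IsPeriodic 2) (hT : G.graph.IsTree) (o : V) :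
    (∃ J, G.IsOptimal o J ∧ ∀ u, u ≠ o → TVG.entries (G.subtree o u) o J = 1) ∧
    (∀ (S : Set V) (r : V),
      (S = G.subtree o r ∨ ∃ u ∈ G.children o r, S = G.branch o r u) →
        (∀ t, (G.returnCosts S r t).Nonempty) ∧
        ((G.FW11 S r ∧ Even (G.fastestReturn S r)) ∨
         (G.FW10 S r ∧ Odd (G.fastestReturn S r)) ∨
         (G.FW01 S r ∧ Odd (G.fastestReturn S r)))) ∧
    (∀ (v : V), ∀ u ∈ G.children o v, ∀ t : ℕ,
      t + G.returnCost (G.branch o v u) v t =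
        G.crossed s(v, u) (G.crossed s(v, u) t +
          G.returnCost (G.subtree o u) u (G.crossed s(v, u) t)) ∧
      t + G.coverCost (G.branch o v u) v t =
        G.crossed s(v, u) t + G.coverCost (G.subtree o u) u (G.crossed s(v, u) t)) ∧
    (∀ (v : V) (t : ℕ),
      (∃ L : List V, L.Nodup ∧ (∀ u, u ∈ L ↔ u ∈ G.children o v) ∧ G.Alternating o v t L) ∧
      ∀ L : List V, L.Nodup → (∀ u, u ∈ L ↔ u ∈ G.children o v) → G.Alternating o v t L →
        t + G.returnCost (G.subtree o v) v t = G.serve o v t L) ∧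
    (∀ (v : V) (t : ℕ),
      (G.children o v = ∅ → G.coverCost (G.subtree o v) v t = 0) ∧
      ((G.children o v).Nonempty → IsLeast
        {x | ∃ (u : V) (L : List V), (u :: L).Nodup ∧
          (∀ w, w ∈ u :: L ↔ w ∈ G.children o v) ∧ G.Alternating o v t L ∧
          x = G.serve o v t L + G.coverCost (G.branch o v u) v (G.serve o v t L)}
        (t + G.coverCost (G.subtree o v) v t))) := by
  refine ⟨hP.exists_optimal_entries hT o, ?_, fun v u hu t => ?_, fun v t => ⟨?_, ?_⟩,
    fun v t => ⟨fun h => coverCost_leaf hT h t, fun h => hP.isLeast_coverCost hT h t⟩⟩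
  · rintro S r (rfl | ⟨u, hu, rfl⟩)
    · have := hP.subtree_returnCosts_nonempty (o := o) hT r
      exact ⟨this, type_of_typed this (hP.typed_subtree hT r)⟩
    · have := hP.branch_nonempty hT hu
      exact ⟨this, type_of_typed this (hP.typed_branchCost hT hu)⟩
  · have := hP.subtree_returnCosts_nonempty (o := o) hT u
    exact ⟨hP.branch_returnCost hT hu this t, hP.branch_coverCost hT hu this t⟩
  · obtain ⟨L, h1, h2⟩ := G.exists_children_list o v
    obtain ⟨L', k1, k2⟩ := G.exists_alternating_perm o v t L
    exact ⟨L', k1.nodup_iff.2 h1, fun u => k1.mem_iff.trans (h2 u), k2⟩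
  · intro L h1 h2 h3
    rw [hP.serve_eq hT (fun u hu => (h2 u).1 hu) h3, hP.returnCost_eq hT h1 h2]

end Main

end TVG

/-! ### A program logic for the random access machine. -/

namespace RAM

/-- The program halts within `K` steps, in a memory with property `Q`. -/
def Runs (W : ℕ) (P : Prog) (m : Mem) (K : ℕ) (Q : Mem → Prop) : Prop :=
  ∃ k m', Exec W P m k m' ∧ k ≤ K ∧ Q m'

theorem Runs.seq {W : ℕ} {P P' : Prog} {m : Mem} {K K' : ℕ} {Q Q' : Mem → Prop}
    (h : Runs W P m K Q) (h' : ∀ m', Q m' → Runs W P' m' K' Q') :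
    Runs W (.seq P P') m (K + K') Q' := by
  obtain ⟨k, m₁, h1, h2, h3⟩ := h
  obtain ⟨l, m₂, k1, k2, k3⟩ := h' m₁ h3
  exact ⟨k + l, m₂, .seq _ _ _ _ _ _ _ h1 k1, by omega, k3⟩

/-- The invariant is indexed by the number of completed rounds, so it controls the running time as
well as the memory. -/
theorem Runs.loop {W : ℕ} {c : Expr} {P : Prog} {K N : ℕ} (Inv : ℕ → Mem → Prop)
    (hstep : ∀ i < N, ∀ m, Inv i m → c.eval m ≠ 0 ∧ Runs W P m K (Inv (i + 1)))
    (hend : ∀ m, Inv N m → c.eval m = 0) {m : Mem} (h0 : Inv 0 m) :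
    Runs W (.loop c P) m (N * (c.cost + 1 + K) + (c.cost + 1)) (Inv N) := by
  have key : ∀ j i, i + j = N → ∀ m, Inv i m →
      Runs W (.loop c P) m (j * (c.cost + 1 + K) + (c.cost + 1)) (Inv N) := by
    intro j
    induction j with
    | zero =>
      rintro i rfl m hm
      exact ⟨_, m, .loop_done m c P (hend m hm), by omega, hm⟩
    | succ j ih =>
      intro i hi m hm
      obtain ⟨hc, k, m₁, h1, h2, h3⟩ := hstep i (by omega) m hm
      obtain ⟨l, m₂, k1, k2, k3⟩ := ih (i + 1) (by omega) m₁ h3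
      refine ⟨_, m₂, .loop_step m m₁ m₂ k l c P hc h1 k1, ?_, k3⟩
      rw [Nat.succ_mul]
      omega
  exact key N 0 (Nat.zero_add N) m h0

/-- An upper bound for the running time of a program without loops. -/
def Prog.time : Prog → ℕ
  | .skip => 1
  | .setReg _ e => e.cost + 1
  | .setArr _ i e => i.cost + e.cost + 1
  | .seq P Q => P.time + Q.time
  | .ite c P Q => c.cost + 1 + max P.time Q.time
  | .loop _ _ => 0

/-- A precondition under which a program without loops establishes `Q`. -/
def Prog.wp (W : ℕ) : Prog → (Mem → Prop) → Mem → Prop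
  | .skip, Q, m => Q m
  | .setReg x e, Q, m => e.eval m ≤ W ∧ ∀ w, w = e.eval m → Q (m.setReg x w)
  | .setArr a i e, Q, m => i.eval m ≤ W ∧ e.eval m ≤ W ∧
      ∀ j w, j = i.eval m → w = e.eval m → Q (m.setArr a j w)
  | .seq P P', Q, m => P.wp W (P'.wp W Q) m
  | .ite c P P', Q, m => (c.eval m ≠ 0 → P.wp W Q m) ∧ (c.eval m = 0 → P'.wp W Q m)
  | .loop _ _, _, _ => False

/-- In `Prog.wp` the computed words are variables with an equation, so they need not be unfolded
inside the new memory. A loop has precondition `False`, which makes its entry `0` in `Prog.time`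
harmless. -/
theorem Prog.runs_of_wp {W : ℕ} {P : Prog} {Q : Mem → Prop} {m : Mem} (h : P.wp W Q m) :
    Runs W P m P.time Q := by
  induction P generalizing Q m with
  | skip => exact ⟨1, m, .skip m, le_rfl, h⟩
  | setReg x e => exact ⟨_, _, .setReg m x e h.1, le_rfl, h.2 _ rfl⟩
  | setArr a i e => exact ⟨_, _, .setArr m a i e h.1 h.2.1, le_rfl, h.2.2 _ _ rfl rfl⟩
  | seq P P' ih ih' => exact (ih h).seq fun m' h' => ih' h'
  | ite c P P' ih ih' =>
    by_cases hc : c.eval m = 0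
    · obtain ⟨k, m', h1, h2, h3⟩ := ih' (h.2 hc)
      refine ⟨_, m', .ite_false m m' k c P P' hc h1, ?_, h3⟩
      simp only [Prog.time]
      omega
    · obtain ⟨k, m', h1, h2, h3⟩ := ih (h.1 hc)
      refine ⟨_, m', .ite_true m m' k c P P' hc h1, ?_, h3⟩
      simp only [Prog.time]
      omega
  | loop c P => exact h.elim

theorem Mem.setReg_reg (m : Mem) (x w y : ℕ) :
    (m.setReg x w).reg y = if y = x then w else m.reg y := by
  simp [Mem.setReg, Function.update_apply]

theorem Mem.setReg_arr (m : Mem) (x w : ℕ) : (m.setReg x w).arr = m.arr := rfl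

theorem Mem.setArr_reg (m : Mem) (a i w : ℕ) : (m.setArr a i w).reg = m.reg := rfl

theorem Mem.setArr_arr (m : Mem) (a i w b : ℕ) :
    (m.setArr a i w).arr b = if b = a then Function.update (m.arr a) i w else m.arr b := by
  simp [Mem.setArr, Function.update_apply]

theorem indicator_ne_zero {p : Prop} [Decidable p] : ((if p then 1 else 0 : ℕ) ≠ 0) = p := by
  by_cases h : p <;> simp [h]

theorem indicator_eq_zero {p : Prop} [Decidable p] : ((if p then 1 else 0 : ℕ) = 0) = ¬ p := by
  by_cases h : p <;> simp [h]

/-- Count one end of the current edge. -/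
def countEnd (s : ℕ) : Prog :=
  .seq (.setReg 4 (.arr s (.reg 2))) <|
  .seq (.setArr 4 (.reg 4) (.add (.arr 4 (.reg 4)) (.const 1))) <|
  .seq (.setReg 5 (.add (.arr 5 (.reg 4)) (.reg 2))) <|
  .seq (.ite (.lt (.reg 5) (.reg 0)) .skip (.setReg 5 (.sub (.reg 5) (.reg 0)))) <|
  .setArr 5 (.reg 4) (.reg 5)

def nextIndex : Prog := .setReg 2 (.add (.reg 2) (.const 1))

/-- Register `2` is the running index. Arrays `4` and `5` collect, for every vertex, its degree and
the sum of the indices of its edges. The sums replace adjacency lists, and are taken modulo `n`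
because they could otherwise be quadratic in `n`. -/
def countBody : Prog := .seq (countEnd 0) (.seq (countEnd 1) nextIndex)

/-- The old sum and the index are below `n`, so one conditional subtraction reduces modulo `n`. -/
theorem countEnd_wp {W s n j v d : ℕ} {m : Mem} {Q : Mem → Prop} (hn : m.reg 0 = n)
    (hj : m.reg 2 = j) (hjn : j < n) (hnW : 4 * n ≤ W)
    (hv : m.arr s j = v) (hvn : v < n) (hd : m.arr 4 v = d) (hdW : d < W)
    (hS : m.arr 5 v < n)
    (hQ : ∀ m', (∀ x, x ≠ 4 → x ≠ 5 → m'.reg x = m.reg x) →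
      (∀ a, a ≠ 4 → a ≠ 5 → m'.arr a = m.arr a) →
      m'.arr 4 = Function.update (m.arr 4) v (d + 1) →
      m'.arr 5 = Function.update (m.arr 5) v ((m.arr 5 v + j) % n) → Q m') :
    (countEnd s).wp W Q m := by
  simp +decide only [countEnd, Prog.wp, Expr.eval, Mem.setReg_reg,
    Mem.setReg_arr, Mem.setArr_reg, Mem.setArr_arr, if_true, if_false, indicator_ne_zero,
    indicator_eq_zero, hn, hj, hv]
  refine ⟨by omega, ?_⟩
  rintro v rfl
  refine ⟨by omega, by omega, ?_⟩
  rintro j' d' rfl rfl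
  refine ⟨by omega, ?_⟩
  rintro r hr
  refine ⟨fun hlt => ⟨by omega, by omega, ?_⟩, fun hlt => ⟨by omega, ?_⟩⟩
  · rintro j' r' rfl rfl
    apply hQ
    · intro x h4 h5; simp [Mem.setReg_reg, Mem.setArr_reg, h4, h5]
    · intro a h4 h5; simp [Mem.setReg_arr, Mem.setArr_arr, h4, h5]
    · simp [Mem.setReg_arr, Mem.setArr_arr, hd]
    · simp [Mem.setReg_arr, Mem.setArr_arr, hr, Nat.mod_eq_of_lt (hr ▸ hlt)]
  · rintro r₂ hr₂
    refine ⟨by omega, by omega, ?_⟩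
    rintro j' r' rfl rfl
    apply hQ
    · intro x h4 h5; simp [Mem.setReg_reg, Mem.setArr_reg, h4, h5]
    · intro a h4 h5; simp [Mem.setReg_arr, Mem.setArr_arr, h4, h5]
    · simp [Mem.setReg_arr, Mem.setArr_arr, hd]
    · have : (m.arr 5 j' + j) % n = r' := by
        rw [Nat.mod_eq_sub_mod (by omega), Nat.mod_eq_of_lt (by omega)]; omega
      simp [Mem.setReg_arr, Mem.setArr_arr, this]

end RAM

/-! ### Parents, and the list of edges indexed by the lower ends. -/

namespace TVG

/-- `par` maps every vertex except the root `o` to its parent. -/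
def IsParent {V : Type*} (G : TVG V) (o : V) (par : V → V) : Prop :=
  ∀ u, u ≠ o → u ∈ G.children o (par u)

theorem exists_isParent {V : Type*} {G : TVG V} (hT : G.graph.IsTree) (o : V) :
    ∃ par, G.IsParent o par := by
  classical
  have : ∀ u, ∃ v, u ≠ o → u ∈ G.children o v := fun u => by
    by_cases h : u = o
    · exact ⟨o, fun h' => absurd h h'⟩
    · obtain ⟨v, hv⟩ := exists_parent hT h
      exact ⟨v, fun _ => hv⟩
  choose par hpar using this
  exact ⟨par, hpar⟩

theorem IsParent.mem_children_iff {V : Type*} {G : TVG V} {o : V} {par : V → V}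
    (h : G.IsParent o par) (hT : G.graph.IsTree) {u v : V} :
    u ∈ G.children o v ↔ u ≠ o ∧ par u = v := by
  constructor
  · intro hu
    have h0 := ne_root_of_mem_children hT hu
    exact ⟨h0, parent_unique hT (h u h0) hu⟩
  · rintro ⟨h0, rfl⟩
    exact h u h0

/-- If the ends were interchanged, each of two vertices would be a child of the other. -/
theorem eq_of_parent_edge_eq {V : Type*} {G : TVG V} (hT : G.graph.IsTree) {o u v u' v' : V}
    (h : u ∈ G.children o v) (h' : u' ∈ G.children o v') (he : s(v, u) = s(v', u')) : u = u' := by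
  rcases Sym2.eq_iff.1 he with ⟨-, h1⟩ | ⟨h1, h2⟩
  · exact h1
  · subst h1 h2
    exact absurd h.2 (notMem_subtree_child hT h')

end TVG

namespace RAM

open TVG

/-- The parent edge of `u` is the one with index `idx u` in the list in the memory. -/
structure EdgeIndex {n : ℕ} (G : TVG (Fin n)) (o : Fin n) (par : Fin n → Fin n)
    (idx : Fin n → ℕ) (arr : ℕ → ℕ → ℕ) : Prop where
  lt : ∀ u, u ≠ o → idx u < n - 1
  inj : ∀ u v, u ≠ o → v ≠ o → idx u = idx v → u = v
  surj : ∀ j, j < n - 1 → ∃ u, u ≠ o ∧ idx u = j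
  ends : ∀ u, u ≠ o → (arr 0 (idx u) = par u ∧ arr 1 (idx u) = u) ∨
    (arr 0 (idx u) = u ∧ arr 1 (idx u) = par u)
  even : ∀ u, u ≠ o → 1 - arr 2 (idx u) = G.wait s(par u, u) 0
  odd : ∀ u, u ≠ o → 1 - arr 3 (idx u) = G.wait s(par u, u) 1

/-- Every edge joins a vertex to its parent, so the listed edges correspond to the vertices other
than the root. -/
theorem Encodes.exists_edgeIndex {n : ℕ} {G : TVG (Fin n)} {o : Fin n} {m : Mem}
    (h : Encodes G o m) (hT : G.graph.IsTree) {par : Fin n → Fin n} (hpar : G.IsParent o par) :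
    ∃ idx, EdgeIndex G o par idx m.arr := by
  obtain ⟨e, he⟩ := h.edges
  have key : ∀ u, ∃ i : ℕ, u ≠ o → ∃ hi : i < n - 1, (e ⟨i, hi⟩ : Sym2 (Fin n)) = s(par u, u) := by
    intro u
    by_cases hu : u = o
    · exact ⟨0, fun h => absurd hu h⟩
    · refine ⟨e.symm ⟨s(par u, u), (hpar u hu).1⟩, fun _ => ⟨Fin.is_lt _, ?_⟩⟩
      simp
  choose idx hidx using key
  refine ⟨idx, ⟨fun u hu => (hidx u hu).1, ?_, ?_, ?_, ?_, ?_⟩⟩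
  · intro u v hu hv huv
    obtain ⟨h1, h2⟩ := hidx u hu
    obtain ⟨h3, h4⟩ := hidx v hv
    simp only [huv] at h2
    exact eq_of_parent_edge_eq hT (hpar u hu) (hpar v hv) (h2.symm.trans h4)
  · intro j hj
    obtain ⟨⟨a, b, hab, -, -⟩, -⟩ := he ⟨j, hj⟩
    have hadj : G.graph.Adj a b := by
      have := (e ⟨j, hj⟩).2
      rw [hab] at this
      exact this
    have : ∃ u, u ≠ o ∧ (e ⟨j, hj⟩ : Sym2 (Fin n)) = s(par u, u) := by
      rcases mem_children_or_mem_children (o := o) hT hadj with h | h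
      · obtain ⟨h1, h2⟩ := (hpar.mem_children_iff hT).1 h
        exact ⟨a, h1, by rw [hab, h2, Sym2.eq_swap]⟩
      · obtain ⟨h1, h2⟩ := (hpar.mem_children_iff hT).1 h
        exact ⟨b, h1, by rw [hab, h2]⟩
    obtain ⟨u, hu, heu⟩ := this
    refine ⟨u, hu, ?_⟩
    obtain ⟨h1, h2⟩ := hidx u hu
    have := e.injective (Subtype.ext (h2.trans heu.symm))
    exact congrArg Fin.val this
  · intro u hu
    obtain ⟨h1, h2⟩ := hidx u hu
    obtain ⟨⟨a, b, hab, h3, h4⟩, -⟩ := he ⟨idx u, h1⟩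
    rw [h2] at hab
    simp only at h3 h4
    rcases Sym2.eq_iff.1 hab with ⟨rfl, rfl⟩ | ⟨h5, h6⟩
    · exact Or.inl ⟨h3, h4⟩
    · rw [← h5] at h4
      rw [← h6] at h3
      exact Or.inr ⟨h3, h4⟩
  · intro u hu
    obtain ⟨h1, h2⟩ := hidx u hu
    obtain ⟨-, h3, -⟩ := he ⟨idx u, h1⟩
    rw [h2] at h3
    simp only at h3
    unfold wait
    rcases h3 with ⟨h3, h4⟩ | ⟨h3, h4⟩
    · rw [if_pos h3, h4]
    · rw [if_neg h3, h4]
  · intro u hu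
    obtain ⟨h1, h2⟩ := hidx u hu
    obtain ⟨-, -, h3⟩ := he ⟨idx u, h1⟩
    rw [h2] at h3
    simp only at h3
    unfold wait
    rcases h3 with ⟨h3, h4⟩ | ⟨h3, h4⟩
    · rw [if_pos h3, h4]
    · rw [if_neg h3, h4]

/-- The sum of the weights of the edges `a j, b j` with `j < i` at the vertex `v`. -/
def endSum (a b f : ℕ → ℕ) (i v : ℕ) : ℕ :=
  ∑ j ∈ Finset.range i, ((if a j = v then f j else 0) + (if b j = v then f j else 0))

theorem endSum_succ (a b f : ℕ → ℕ) (i v : ℕ) : endSum a b f (i + 1) v =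
    endSum a b f i v + ((if a i = v then f i else 0) + (if b i = v then f i else 0)) :=
  Finset.sum_range_succ _ _

/-- Each edge is counted at its lower end and at the parent. So a vertex collects the edges to its
children, and its own parent edge unless it is the root. -/
theorem EdgeIndex.endSum_eq {n : ℕ} {G : TVG (Fin n)} {o : Fin n} {par : Fin n → Fin n}
    {idx : Fin n → ℕ} {arr : ℕ → ℕ → ℕ} (h : EdgeIndex G o par idx arr) (f : ℕ → ℕ) (v : Fin n) :
    endSum (arr 0) (arr 1) f (n - 1) v =
      ∑ u ∈ Finset.univ.filter (fun u => u ≠ o ∧ par u = v), f (idx u) +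
        if v = o then 0 else f (idx v) := by
  have h1 : endSum (arr 0) (arr 1) f (n - 1) v = ∑ u ∈ Finset.univ.filter (fun u => u ≠ o),
      ((if par u = v then f (idx u) else 0) + (if u = v then f (idx u) else 0)) := by
    symm
    refine Finset.sum_bij (fun u _ => idx u) ?_ ?_ ?_ ?_
    · intro u hu
      exact Finset.mem_range.2 (h.lt u (Finset.mem_filter.1 hu).2)
    · intro u hu v hv
      exact h.inj u v (Finset.mem_filter.1 hu).2 (Finset.mem_filter.1 hv).2
    · intro j hj
      obtain ⟨u, hu, rfl⟩ := h.surj j (Finset.mem_range.1 hj)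
      exact ⟨u, by simp [hu], rfl⟩
    · intro u hu
      simp only [Fin.ext_iff]
      rcases h.ends u (Finset.mem_filter.1 hu).2 with ⟨h1, h2⟩ | ⟨h1, h2⟩
      · rw [h1, h2]
      · rw [h1, h2, add_comm]
  rw [h1, Finset.sum_add_distrib]
  congr 1
  · rw [← Finset.sum_filter, Finset.filter_filter]
  · rw [Finset.sum_ite_eq' (Finset.univ.filter (fun u => u ≠ o)) v (fun u => f (idx u))]
    simp [ite_not]

structure CountInv (n o : ℕ) (m₀ : Mem) (i : ℕ) (m : Mem) : Prop where
  size : m.reg 0 = n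
  start : m.reg 1 = o
  index : m.reg 2 = i
  tail : m.reg 3 = 0
  frame : ∀ a, a ≠ 4 → a ≠ 5 → m.arr a = m₀.arr a
  deg : ∀ v, m.arr 4 v = endSum (m₀.arr 0) (m₀.arr 1) (fun _ => 1) i v
  sum : ∀ v, m.arr 5 v = endSum (m₀.arr 0) (m₀.arr 1) id i v % n

theorem endSum_one_le (a b : ℕ → ℕ) (i v : ℕ) : endSum a b (fun _ => 1) i v ≤ 2 * i := by
  induction i with
  | zero => simp [endSum]
  | succ i ih => rw [endSum_succ]; split_ifs <;> omega

theorem countBody_runs {W n o : ℕ} {m₀ m : Mem} {i : ℕ} (hW : 4 * n ≤ W) (hi : i + 1 < n)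
    (ha : ∀ j < n - 1, m₀.arr 0 j < n ∧ m₀.arr 1 j < n) (h : CountInv n o m₀ i m) :
    Runs W countBody m countBody.time (CountInv n o m₀ (i + 1)) := by
  have hn : 0 < n := by omega
  obtain ⟨ha0, hb0⟩ := ha i (by omega)
  obtain ⟨h0, h1, h2, h3, h4, h5, h6⟩ := h
  have hd : ∀ v, m.arr 4 v ≤ 2 * i := fun v => (h5 v).trans_le (endSum_one_le _ _ _ _)
  apply Prog.runs_of_wp
  refine countEnd_wp (v := m₀.arr 0 i) h0 h2 (by omega) hW
    (by rw [h4 0 (by decide) (by decide)]) ha0 rfl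
    (by have := hd (m₀.arr 0 i); omega) (by rw [h6]; exact Nat.mod_lt _ hn) ?_
  intro m₁ k1 k2 k3 k4
  have hd1 : ∀ v, m₁.arr 4 v ≤ 2 * i + 1 := fun v => by
    rw [k3, Function.update_apply]
    have := hd v
    have := hd (m₀.arr 0 i)
    split_ifs <;> omega
  refine countEnd_wp (v := m₀.arr 1 i) (n := n) (j := i) (by rw [k1 0 (by decide) (by decide), h0])
    (by rw [k1 2 (by decide) (by decide), h2]) (by omega) hW
    (by rw [k2 1 (by decide) (by decide), h4 1 (by decide) (by decide)]) hb0 rfl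
    (by have := hd1 (m₀.arr 1 i); omega) ?_ ?_
  · rw [k4, Function.update_apply]
    split_ifs
    · exact Nat.mod_lt _ hn
    · rw [h6]; exact Nat.mod_lt _ hn
  intro m₂ l1 l2 l3 l4
  have e2 : m₂.reg 2 = i := by
    rw [l1 2 (by decide) (by decide), k1 2 (by decide) (by decide), h2]
  simp only [nextIndex, Prog.wp, Expr.eval]
  rw [e2]
  refine ⟨by omega, ?_⟩
  rintro w rfl
  have hr : ∀ x, x ≠ 2 → x ≠ 4 → x ≠ 5 → (m₂.setReg 2 (i + 1)).reg x = m.reg x := by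
    intro x x2 x4 x5
    rw [Mem.setReg_reg, if_neg x2, l1 x x4 x5, k1 x x4 x5]
  refine ⟨?_, ?_, ?_, ?_, ?_, ?_, ?_⟩
  · rw [hr 0 (by decide) (by decide) (by decide), h0]
  · rw [hr 1 (by decide) (by decide) (by decide), h1]
  · rw [Mem.setReg_reg, if_pos rfl]
  · rw [hr 3 (by decide) (by decide) (by decide), h3]
  · intro a a4 a5
    rw [Mem.setReg_arr, l2 a a4 a5, k2 a a4 a5, h4 a a4 a5]
  · intro v
    rw [Mem.setReg_arr, l3, k3, endSum_succ]
    simp only [Function.update_apply, h5]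
    by_cases e1 : v = m₀.arr 0 i <;> by_cases e2 : v = m₀.arr 1 i
    · simp [← e1, ← e2]
    · simp [← e1, e2, Ne.symm e2]
    · simp [← e2, e1, Ne.symm e1]
    · simp [e1, e2, Ne.symm e1, Ne.symm e2]
  · intro v
    rw [Mem.setReg_arr, l4, k4, endSum_succ]
    simp only [Function.update_apply, h6, id]
    by_cases e1 : v = m₀.arr 0 i <;> by_cases e2 : v = m₀.arr 1 i
    · simp [← e1, ← e2, add_assoc]
    · simp [← e1, e2, Ne.symm e2]
    · simp [← e2, e1, Ne.symm e1]
    · simp [e1, e2, Ne.symm e1, Ne.symm e2]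

/-- The condition that the index in register `2` is that of an edge. -/
def moreEdges : Expr := .lt (.add (.reg 2) (.const 1)) (.reg 0)

theorem moreEdges_eval {n i : ℕ} {m : Mem} (h0 : m.reg 0 = n) (h2 : m.reg 2 = i) :
    moreEdges.eval m = if i + 1 < n then 1 else 0 := by
  simp only [moreEdges, Expr.eval, h0, h2]

theorem countLoop_runs {W n o : ℕ} {m : Mem} (hn : 0 < n) (hW : 4 * n ≤ W)
    (ha : ∀ j < n - 1, m.arr 0 j < n ∧ m.arr 1 j < n) (h0 : m.reg 0 = n) (h1 : m.reg 1 = o)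
    (hz : ∀ x, 2 ≤ x → m.reg x = 0) (hz' : ∀ a i, 4 ≤ a → m.arr a i = 0) :
    Runs W (.loop moreEdges countBody) m
      ((n - 1) * (moreEdges.cost + 1 + countBody.time) + (moreEdges.cost + 1))
      (CountInv n o m (n - 1)) := by
  refine Runs.loop (CountInv n o m) ?_ ?_ ?_
  · intro i hi m' hm'
    refine ⟨?_, countBody_runs hW (by omega) ha hm'⟩
    rw [moreEdges_eval hm'.size hm'.index, if_pos (by omega)]
    decide
  · intro m' hm'
    rw [moreEdges_eval hm'.size hm'.index, if_neg (by omega)]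
  · refine ⟨h0, h1, hz 2 le_rfl, hz 3 (by omega), fun _ _ _ => rfl, fun v => ?_, fun v => ?_⟩
    · rw [hz' 4 v le_rfl]; simp [endSum]
    · rw [hz' 5 v (by omega)]; simp [endSum]

end RAM

/-! ### Peeling off leaves: the queue with children before parents. -/

namespace RAM

open TVG

/-- Put the vertex in register `x` into the queue if it has one unprocessed edge and is not the
root. -/
def enqueue (x : ℕ) : Prog :=
  .ite (.eq (.arr 4 (.reg x)) (.const 1))
    (.ite (.eq (.reg x) (.reg 1)) .skip <|
      .seq (.setArr 6 (.reg 3) (.reg x)) (.setReg 3 (.add (.reg 3) (.const 1))))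
    .skip

theorem enqueue_wp {W x v o tail : ℕ} {m : Mem} {Q : Mem → Prop} (hv : m.reg x = v)
    (ho : m.reg 1 = o) (ht : m.reg 3 = tail) (hvW : v ≤ W) (htW : tail < W)
    (hyes : m.arr 4 v = 1 → v ≠ o → Q ((m.setArr 6 tail v).setReg 3 (tail + 1)))
    (hno : ¬ (m.arr 4 v = 1 ∧ v ≠ o) → Q m) : (enqueue x).wp W Q m := by
  simp +decide only [enqueue, Prog.wp, Expr.eval, Mem.setReg_reg,
    Mem.setReg_arr, Mem.setArr_reg, Mem.setArr_arr, if_true, if_false, indicator_ne_zero,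
    indicator_eq_zero, hv, ho, ht]
  refine ⟨fun h1 => ⟨fun h2 => hno (by tauto), fun h2 => ⟨by omega, by omega, ?_⟩⟩,
    fun h1 => hno (by tauto)⟩
  rintro _ _ rfl rfl
  refine ⟨by omega, ?_⟩
  rintro _ rfl
  exact hyes h1 h2

/-- The list `l` is stored in the array `f`. -/
def ListIn {n : ℕ} (f : ℕ → ℕ) (l : List (Fin n)) : Prop :=
  ∀ k (h : k < l.length), f k = (l[k] : ℕ)

theorem ListIn.concat {n : ℕ} {f : ℕ → ℕ} {l : List (Fin n)} (h : ListIn f l) (v : Fin n) :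
    ListIn (Function.update f l.length v) (l ++ [v]) := by
  intro k hk
  rw [List.length_append, List.length_singleton] at hk
  by_cases hkl : k < l.length
  · rw [List.getElem_append_left hkl, Function.update_of_ne (by omega), h k hkl]
  · obtain rfl : k = l.length := by omega
    simp

/-- The queue in array `6`, of length in register `3`, is started with the leaves other than the
root. -/
def leafBody : Prog := .seq (enqueue 2) nextIndex

structure LeafInv {n : ℕ} (o : Fin n) (m₀ : Mem) (i : ℕ) (m : Mem) (l : List (Fin n)) : Prop where
  size : m.reg 0 = n
  start : m.reg 1 = o
  index : m.reg 2 = i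
  frame : ∀ a, a ≠ 6 → m.arr a = m₀.arr a
  nodup : l.Nodup
  queued : ∀ v, v ∈ l ↔ (v : ℕ) < i ∧ v ≠ o ∧ m₀.arr 4 v = 1
  tail : m.reg 3 = l.length
  list : ListIn (m.arr 6) l

theorem nextIndex_wp {W i : ℕ} {m : Mem} {Q : Mem → Prop} (h : m.reg 2 = i) (hi : i < W)
    (hQ : Q (m.setReg 2 (i + 1))) : nextIndex.wp W Q m := by
  simp only [nextIndex, Prog.wp, Expr.eval, h]
  refine ⟨by omega, ?_⟩
  rintro w rfl
  exact hQ

theorem leafBody_runs {W n i : ℕ} {o : Fin n} {m₀ m : Mem} (hW : 4 * n ≤ W) (hi : i < n)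
    (h : ∃ l, LeafInv o m₀ i m l) :
    Runs W leafBody m leafBody.time (fun m' => ∃ l, LeafInv o m₀ (i + 1) m' l) := by
  obtain ⟨l, h0, h1, h2, h3, h4, h5, h6, h7⟩ := h
  have hlen : l.length ≤ n := by simpa using h4.length_le_card
  have e4 : m.arr 4 = m₀.arr 4 := h3 4 (by decide)
  apply Prog.runs_of_wp
  refine enqueue_wp h2 h1 h6 (by omega) (by omega) ?_ ?_
  · intro k1 k2
    refine nextIndex_wp (i := i) ?_ (by omega) ⟨l ++ [⟨i, hi⟩], ?_⟩
    · rw [Mem.setReg_reg, if_neg (by decide), Mem.setArr_reg, h2]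
    rw [e4] at k1
    have hnot : (⟨i, hi⟩ : Fin n) ∉ l := fun hmem => by
      have := ((h5 _).1 hmem).1
      simp at this
    refine ⟨?_, ?_, ?_, ?_, ?_, ?_, ?_, ?_⟩
    · simpa [Mem.setReg_reg, Mem.setArr_reg] using h0
    · simpa [Mem.setReg_reg, Mem.setArr_reg] using h1
    · simp [Mem.setReg_reg]
    · intro a ha
      simpa [Mem.setReg_arr, Mem.setArr_arr, ha] using h3 a ha
    · rw [← List.concat_eq_append]
      exact h4.concat hnot
    · intro v
      rw [List.mem_append, List.mem_singleton, h5]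
      constructor
      · rintro (⟨g1, g2, g3⟩ | rfl)
        · exact ⟨by omega, g2, g3⟩
        · exact ⟨by simp, fun hh => k2 (congrArg Fin.val hh), k1⟩
      · rintro ⟨g1, g2, g3⟩
        by_cases hvi : (v : ℕ) = i
        · exact Or.inr (Fin.ext hvi)
        · exact Or.inl ⟨by omega, g2, g3⟩
    · simp [Mem.setReg_reg]
    · simpa [Mem.setReg_arr, Mem.setArr_arr] using h7.concat ⟨i, hi⟩
  · intro k1
    refine nextIndex_wp (i := i) h2 (by omega) ⟨l, ?_⟩
    rw [e4] at k1
    refine ⟨?_, ?_, ?_, h3, h4, ?_, ?_, h7⟩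
    · simpa [Mem.setReg_reg] using h0
    · simpa [Mem.setReg_reg] using h1
    · simp [Mem.setReg_reg]
    · intro v
      rw [h5]
      constructor
      · rintro ⟨g1, g2, g3⟩
        exact ⟨by omega, g2, g3⟩
      · rintro ⟨g1, g2, g3⟩
        by_cases hvi : (v : ℕ) = i
        · exact absurd ⟨hvi ▸ g3, fun hh => g2 (Fin.ext (hvi.trans hh))⟩ k1
        · exact ⟨by omega, g2, g3⟩
    · simpa [Mem.setReg_reg] using h6

/-- The condition that the index in register `2` is that of a vertex. -/
def moreVertices : Expr := .lt (.reg 2) (.reg 0)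

theorem leafLoop_runs {W n : ℕ} {o : Fin n} {m : Mem} (hW : 4 * n ≤ W)
    (h0 : m.reg 0 = n) (h1 : m.reg 1 = o) (h2 : m.reg 2 = 0) (h3 : m.reg 3 = 0) :
    Runs W (.loop moreVertices leafBody) m
      (n * (moreVertices.cost + 1 + leafBody.time) + (moreVertices.cost + 1))
      (fun m' => ∃ l, LeafInv o m n m' l) := by
  refine Runs.loop (fun i m' => ∃ l, LeafInv o m i m' l) ?_ ?_ ?_
  · intro i hi m' hm'
    refine ⟨?_, leafBody_runs hW hi hm'⟩
    obtain ⟨l, hl⟩ := hm'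
    simp [moreVertices, Expr.eval, hl.size, hl.index, hi]
  · rintro m' ⟨l, hl⟩
    simp [moreVertices, Expr.eval, hl.size, hl.index]
  · exact ⟨[], h0, h1, h2, fun _ _ => rfl, List.nodup_nil, by simp, h3, fun k hk => by simp at hk⟩

/-- Registers `4`, `5` and `6` hold the next vertex of the queue, its parent edge and its parent.
The parent is the sum of both ends minus the vertex, in whichever order the ends are listed. The
edge is then removed from the degree and the index sum of the parent. -/
def peelBody : Prog :=
  .seq (.setReg 4 (.arr 6 (.reg 2))) <|
  .seq (.setReg 5 (.arr 5 (.reg 4))) <|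
  .seq (.setReg 6 (.sub (.add (.arr 0 (.reg 5)) (.arr 1 (.reg 5))) (.reg 4))) <|
  .seq (.setArr 7 (.reg 4) (.reg 6)) <|
  .seq (.setArr 4 (.reg 6) (.sub (.arr 4 (.reg 6)) (.const 1))) <|
  .seq (.setReg 7 (.arr 5 (.reg 6))) <|
  .seq (.ite (.lt (.reg 7) (.reg 5)) (.setReg 7 (.sub (.add (.reg 7) (.reg 0)) (.reg 5)))
    (.setReg 7 (.sub (.reg 7) (.reg 5)))) <|
  .seq (.setArr 5 (.reg 6) (.reg 7)) <|
  .seq (enqueue 6) nextIndex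

/-- The children of `v` that are not among the first `i` vertices of the queue. -/
def pending {n : ℕ} (o : Fin n) (par : Fin n → Fin n) (l : List (Fin n)) (i : ℕ) (v : Fin n) :
    Finset (Fin n) :=
  Finset.univ.filter fun u => u ≠ o ∧ par u = v ∧ u ∉ l.take i

/-- The first `i` vertices of the queue are removed from the tree. A vertex other than the root is
queued as soon as all its children are removed, when its parent edge is the only one left. -/
structure PeelInv {n : ℕ} (o : Fin n) (par : Fin n → Fin n) (idx : Fin n → ℕ) (m₀ : Mem)
    (i : ℕ) (m : Mem) (l : List (Fin n)) : Prop where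
  size : m.reg 0 = n
  start : m.reg 1 = o
  index : m.reg 2 = i
  frame : ∀ a, a ≤ 3 ∨ 8 ≤ a → m.arr a = m₀.arr a
  nodup : l.Nodup
  queued : ∀ v, v ∈ l ↔ v ≠ o ∧ ∀ u, u ≠ o → par u = v → u ∈ l.take i
  order : ∀ k (h : k < l.length) u, u ≠ o → par u = l[k] → u ∈ l.take k
  tail : m.reg 3 = l.length
  list : ListIn (m.arr 6) l
  le : i ≤ l.length
  deg : ∀ v : Fin n, m.arr 4 v = (pending o par l i v).card + if v = o then 0 else 1
  sum : ∀ v : Fin n, m.arr 5 v =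
    (∑ u ∈ pending o par l i v, idx u + if v = o then 0 else idx v) % n
  parent : ∀ u ∈ l.take i, m.arr 7 u = par u

theorem mem_pending {n : ℕ} {o : Fin n} {par : Fin n → Fin n} {l : List (Fin n)} {i : ℕ}
    {u v : Fin n} : u ∈ pending o par l i v ↔ u ≠ o ∧ par u = v ∧ u ∉ l.take i := by
  simp [pending]

theorem PeelInv.mem_list {n : ℕ} {G : TVG (Fin n)} {o : Fin n} {par : Fin n → Fin n}
    {idx : Fin n → ℕ} {m₀ m : Mem} {i : ℕ} {l : List (Fin n)} (h : PeelInv o par idx m₀ i m l)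
    (hT : G.graph.IsTree) (hpar : G.IsParent o par) (hi : l.length ≤ i) (v : Fin n) (hv : v ≠ o) :
    v ∈ l := by
  induction v using subtree_induction (o := o) hT with
  | h v ih =>
    rw [h.queued]
    refine ⟨hv, fun u hu huv => ?_⟩
    rw [List.take_of_length_le hi]
    exact ih u ((hpar.mem_children_iff hT).2 ⟨hu, huv⟩) hu

theorem length_of_mem_iff_ne {n : ℕ} {o : Fin n} {l : List (Fin n)} (hnd : l.Nodup)
    (h : ∀ v, v ∈ l ↔ v ≠ o) : l.length = n - 1 := by
  have h1 : l.toFinset = Finset.univ.erase o := by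
    ext v; simp [h]
  rw [← List.toFinset_card_of_nodup hnd, h1, Finset.card_erase_of_mem (Finset.mem_univ o)]
  simp

/-- The peeling cannot stall: by induction from the leaves, an exhausted queue would contain all `n
- 1` vertices other than the root. -/
theorem PeelInv.lt_length {n : ℕ} {G : TVG (Fin n)} {o : Fin n} {par : Fin n → Fin n}
    {idx : Fin n → ℕ} {m₀ m : Mem} {i : ℕ} {l : List (Fin n)} (h : PeelInv o par idx m₀ i m l)
    (hT : G.graph.IsTree) (hpar : G.IsParent o par) (hi : i < n - 1) : i < l.length := by
  by_contra hlt
  have hlt : l.length ≤ i := by omega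
  have := length_of_mem_iff_ne h.nodup
    fun v => ⟨fun hv => ((h.queued v).1 hv).1, h.mem_list hT hpar hlt v⟩
  omega

theorem sub_index_mod {n j S T : ℕ} (hj : j < n) (hS : S = (T + j) % n) :
    (if S < j then S + n - j else S - j) = T % n := by
  have hT := Nat.mod_lt T (show 0 < n by omega)
  have h : S = (T % n + j) % n := by rw [hS, Nat.mod_add_mod]
  by_cases hlt : T % n + j < n
  · rw [Nat.mod_eq_of_lt hlt] at h
    rw [if_neg (by omega)]
    omega
  · rw [Nat.mod_eq_sub_mod (by omega), Nat.mod_eq_of_lt (by omega)] at h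
    rw [if_pos (by omega)]
    omega

theorem peelBody_runs {W n i : ℕ} {G : TVG (Fin n)} {o : Fin n} {par : Fin n → Fin n}
    {idx : Fin n → ℕ} {m₀ m : Mem} (hT : G.graph.IsTree) (hpar : G.IsParent o par)
    (hidx : EdgeIndex G o par idx m₀.arr) (hW : 4 * n ≤ W) (hi : i < n - 1)
    (h : ∃ l, PeelInv o par idx m₀ i m l) :
    Runs W peelBody m peelBody.time (fun m' => ∃ l, PeelInv o par idx m₀ (i + 1) m' l) := by
  obtain ⟨l, h⟩ := h
  have hil := h.lt_length hT hpar hi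
  obtain ⟨h0, h1, h2, h3, h4, h5, h6, h7, h8, h9, h10, h11, h12⟩ := h
  have hlen : l.length ≤ n := by simpa using h4.length_le_card
  obtain ⟨u, hu⟩ : ∃ u, u = l[i] := ⟨_, rfl⟩
  have hul : u ∈ l := hu ▸ List.getElem_mem hil
  obtain ⟨huo, hchild⟩ := (h5 u).1 hul
  have htake : l.take (i + 1) = l.take i ++ [u] := by
    rw [List.take_succ_eq_append_getElem hil, ← hu]
  have hunot : u ∉ l.take i := by
    have := h4.sublist (List.take_sublist (i + 1) l)
    rw [htake, List.nodup_append] at this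
    intro hmem
    exact this.2.2 u hmem u (by simp) rfl
  -- the values that the program computes
  have e6 : m.arr 6 i = u := by rw [h8 i hil, hu]
  -- All children of `u` are removed, so the sum at `u` is the index of its parent edge alone; this
  -- is below `n` and survives the reduction.
  have e5 : m.arr 5 u = idx u := by
    have : pending o par l i u = ∅ := by
      rw [Finset.eq_empty_iff_forall_notMem]
      intro w hw
      obtain ⟨w1, w2, w3⟩ := mem_pending.1 hw
      exact w3 (hchild w w1 w2)
    rw [h11, this, if_neg huo, Finset.sum_empty, zero_add]
    have := hidx.lt u huo
    exact Nat.mod_eq_of_lt (by omega)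
  have e0 : m.arr 0 (idx u) + m.arr 1 (idx u) - u = par u := by
    rw [h3 0 (by omega), h3 1 (by omega)]
    rcases hidx.ends u huo with ⟨g1, g2⟩ | ⟨g1, g2⟩ <;> rw [g1, g2] <;> omega
  obtain ⟨p, hp⟩ : ∃ p, p = par u := ⟨_, rfl⟩
  have hpu : p ≠ u := by
    rw [hp]
    exact (hpar u huo).1.ne
  have hidxlt := hidx.lt u huo
  have hpend : ∀ v, v ≠ p → pending o par l (i + 1) v = pending o par l i v := by
    intro v hv
    ext w
    rw [mem_pending, mem_pending, htake, List.mem_append, List.mem_singleton]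
    constructor
    · tauto
    · rintro ⟨g1, g2, g3⟩
      refine ⟨g1, g2, ?_⟩
      rintro (g | rfl)
      · exact g3 g
      · exact hv (g2.symm.trans hp.symm)
  have hupend : u ∈ pending o par l i p := mem_pending.2 ⟨huo, hp.symm, hunot⟩
  have hpend' : pending o par l (i + 1) p = (pending o par l i p).erase u := by
    ext w
    rw [Finset.mem_erase, mem_pending, mem_pending, htake, List.mem_append, List.mem_singleton]
    tauto
  have hcard : m.arr 4 p - 1 =
      (pending o par l (i + 1) p).card + if p = o then 0 else 1 := by
    have := Finset.card_pos.2 ⟨u, hupend⟩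
    rw [h10, hpend', Finset.card_erase_of_mem hupend]
    omega
  have hsum : (if m.arr 5 p < idx u then m.arr 5 p + n - idx u else m.arr 5 p - idx u) =
      (∑ u ∈ pending o par l (i + 1) p, idx u + if p = o then 0 else idx p) % n := by
    apply sub_index_mod (by omega)
    rw [h11, hpend', ← Finset.sum_erase_add _ _ hupend]
    congr 1
    omega
  -- The child `u` is only being removed now, so `p` cannot be in the queue yet.
  have hpl : p ∉ l := fun hmem => hunot (((h5 p).1 hmem).2 u huo hp.symm)
  have hdegle : m.arr 4 p ≤ n + 1 := by
    rw [h10]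
    have : (pending o par l i p).card ≤ n := by simpa using Finset.card_le_univ (pending o par l i p)
    split_ifs <;> omega
  have h5n : m.arr 5 p < n := by rw [h11]; exact Nat.mod_lt _ (by omega)
  have hpn := p.2
  have hun := u.2
  rw [← hp] at e0
  apply Prog.runs_of_wp
  simp +decide only [peelBody, Prog.wp, Expr.eval, Mem.setReg_reg,
    Mem.setReg_arr, Mem.setArr_reg, Mem.setArr_arr, if_true, if_false, indicator_ne_zero,
    indicator_eq_zero, h0, h2, e6]
  refine ⟨by omega, ?_⟩
  rintro _ rfl
  rw [e5]
  refine ⟨by omega, ?_⟩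
  rintro _ rfl
  rw [e0]
  refine ⟨by omega, ?_⟩
  rintro _ rfl
  refine ⟨by omega, by omega, ?_⟩
  rintro _ _ rfl rfl
  refine ⟨by omega, by omega, ?_⟩
  rintro _ d rfl hd
  refine ⟨by omega, ?_⟩
  rintro _ rfl
  rw [hcard] at hd
  -- both branches of the subtraction modulo `n` lead to the same memory
  suffices hfin : ∀ (m₁ : Mem) (S : ℕ), m₁.reg 0 = n → m₁.reg 1 = o → m₁.reg 2 = i →
      m₁.reg 3 = l.length → m₁.reg 6 = p → m₁.reg 7 = S →
      (∀ a, a ≠ 4 → a ≠ 7 → m₁.arr a = m.arr a) → m₁.arr 4 = Function.update (m.arr 4) p d →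
      m₁.arr 7 = Function.update (m.arr 7) u p →
      S = (if m.arr 5 p < idx u then m.arr 5 p + n - idx u else m.arr 5 p - idx u) →
      m₁.reg 6 ≤ W ∧ m₁.reg 7 ≤ W ∧ ∀ j w, j = m₁.reg 6 → w = m₁.reg 7 →
        (enqueue 6).wp W (nextIndex.wp W fun m' => ∃ l, PeelInv o par idx m₀ (i + 1) m' l)
          (m₁.setArr 5 j w) by
    refine ⟨fun hlt => ⟨by omega, ?_⟩, fun hlt => ⟨by omega, ?_⟩⟩
    · rintro S hS
      refine hfin (((((((m.setReg 4 _).setReg 5 _).setReg 6 _).setArr 7 _ _).setArr 4 _ _).setReg 7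
        _).setReg 7 _) S ?_ ?_ ?_ ?_ ?_ ?_ ?_ ?_ ?_ ?_
      · simp [Mem.setReg_reg, Mem.setArr_reg, h0]
      · simp [Mem.setReg_reg, Mem.setArr_reg, h1]
      · simp [Mem.setReg_reg, Mem.setArr_reg, h2]
      · simp [Mem.setReg_reg, Mem.setArr_reg, h7]
      · simp [Mem.setReg_reg, Mem.setArr_reg]
      · simp [Mem.setReg_reg]
      · intro a a4 a7
        simp [Mem.setReg_arr, Mem.setArr_arr, a4, a7]
      · simp [Mem.setReg_arr, Mem.setArr_arr]
      · simp [Mem.setReg_arr, Mem.setArr_arr]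
      · rw [if_pos hlt, hS]
    · rintro S hS
      refine hfin (((((((m.setReg 4 _).setReg 5 _).setReg 6 _).setArr 7 _ _).setArr 4 _ _).setReg 7
        _).setReg 7 _) S ?_ ?_ ?_ ?_ ?_ ?_ ?_ ?_ ?_ ?_
      · simp [Mem.setReg_reg, Mem.setArr_reg, h0]
      · simp [Mem.setReg_reg, Mem.setArr_reg, h1]
      · simp [Mem.setReg_reg, Mem.setArr_reg, h2]
      · simp [Mem.setReg_reg, Mem.setArr_reg, h7]
      · simp [Mem.setReg_reg, Mem.setArr_reg]
      · simp [Mem.setReg_reg]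
      · intro a a4 a7
        simp [Mem.setReg_arr, Mem.setArr_arr, a4, a7]
      · simp [Mem.setReg_arr, Mem.setArr_arr]
      · simp [Mem.setReg_arr, Mem.setArr_arr]
      · rw [if_neg hlt, hS]
  rintro m₁ S k0 k1 k2 k3 k6 k7 kf k4 k8 hS
  rw [k6, k7]
  have hSW : S ≤ W := by
    rw [hS]; split_ifs <;> omega
  refine ⟨by omega, hSW, ?_⟩
  rintro _ S rfl rfl
  rw [hsum] at hS
  have deg' : ∀ v : Fin n, m₁.arr 4 v =
      (pending o par l (i + 1) v).card + if v = o then 0 else 1 := by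
    intro v
    rw [k4]
    by_cases hv : v = p
    · rw [hv, Function.update_self, hd]
    · rw [Function.update_of_ne (fun hh => hv (Fin.ext hh)), h10, hpend v hv]
  have sum' : ∀ v : Fin n, (m₁.setArr 5 p S).arr 5 v =
      (∑ u ∈ pending o par l (i + 1) v, idx u + if v = o then 0 else idx v) % n := by
    intro v
    rw [Mem.setArr_arr, if_pos rfl]
    by_cases hv : v = p
    · rw [hv, Function.update_self, hS]
    · rw [Function.update_of_ne (fun hh => hv (Fin.ext hh)), kf 5 (by decide) (by decide), h11,
        hpend v hv]
  have par' : ∀ w ∈ l.take (i + 1), m₁.arr 7 w = par w := by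
    intro w hw
    rw [k8]
    by_cases hwu : w = u
    · rw [hwu, Function.update_self, hp]
    · rw [Function.update_of_ne (fun hh => hwu (Fin.ext hh))]
      rw [htake, List.mem_append, List.mem_singleton] at hw
      exact h12 w (hw.resolve_right hwu)
  have frame' : ∀ a, a ≤ 3 ∨ 8 ≤ a → m₁.arr a = m₀.arr a := fun a ha => by
    rw [kf a (by omega) (by omega), h3 a ha]
  have child' : ∀ v, v ≠ p → ∀ w, par w = v → (w ∈ l.take (i + 1) ↔ w ∈ l.take i) := by
    intro v hv w hw
    rw [htake, List.mem_append, List.mem_singleton]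
    refine or_iff_left ?_
    rintro rfl
    exact hv (hw.symm.trans hp.symm)
  have hpempty : pending o par l (i + 1) p = ∅ ↔
      ∀ w, w ≠ o → par w = p → w ∈ l.take (i + 1) := by
    rw [Finset.eq_empty_iff_forall_notMem]
    simp only [mem_pending]
    constructor
    · intro hh w w1 w2
      by_contra w3
      exact hh w ⟨w1, w2, w3⟩
    · rintro hh w ⟨w1, w2, w3⟩
      exact w3 (hh w w1 w2)
  refine enqueue_wp (v := p) (o := o) (tail := l.length) k6 k1 k3 (by omega) (by omega) ?_ ?_
  · intro g1 g2
    have hpo : p ≠ o := fun hh => g2 (congrArg Fin.val hh)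
    rw [Mem.setArr_arr, if_neg (by decide), deg' p, if_neg hpo] at g1
    have hall := hpempty.1 (Finset.card_eq_zero.1 (by omega))
    refine nextIndex_wp (i := i) ?_ (by omega) ⟨l ++ [p], ?_⟩
    · simpa [Mem.setReg_reg, Mem.setArr_reg] using k2
    have htk : (l ++ [p]).take (i + 1) = l.take (i + 1) :=
      List.take_append_of_le_length (by omega)
    have hpe : ∀ v, pending o par (l ++ [p]) (i + 1) v = pending o par l (i + 1) v := fun v => by
      unfold pending; rw [htk]
    refine ⟨?_, ?_, ?_, ?_, ?_, ?_, ?_, ?_, ?_, ?_, ?_, ?_, ?_⟩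
    · simpa [Mem.setReg_reg, Mem.setArr_reg] using k0
    · simpa [Mem.setReg_reg, Mem.setArr_reg] using k1
    · simp [Mem.setReg_reg]
    · intro a ha
      have a5 : a ≠ 5 := by omega
      have a6 : a ≠ 6 := by omega
      simpa [Mem.setReg_arr, Mem.setArr_arr, a5, a6] using frame' a ha
    · rw [List.nodup_append]
      exact ⟨h4, by simp, fun a ha b hb hab => hpl (by
        rw [List.mem_singleton] at hb; rwa [← hb, ← hab])⟩
    · intro v
      rw [htk, List.mem_append, List.mem_singleton]
      by_cases hv : v = p
      · subst hv
        exact ⟨fun _ => ⟨hpo, hall⟩, fun _ => Or.inr rfl⟩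
      · rw [or_iff_left hv, h5]
        refine and_congr_right fun _ => forall_congr' fun w => forall_congr' fun _ =>
          forall_congr' fun hw => (child' v hv w hw).symm
    · intro k hk w w1 w2
      rw [List.length_append, List.length_singleton] at hk
      by_cases hkl : k < l.length
      · rw [List.getElem_append_left hkl] at w2
        rw [List.take_append_of_le_length (by omega)]
        exact h6 k hkl w w1 w2
      · obtain rfl : k = l.length := by omega
        simp only [List.getElem_concat_length] at w2
        rw [List.take_left']
        · exact List.mem_of_mem_take (hall w w1 w2)
        · rfl
    · simp [Mem.setReg_reg]
    · have : m.arr 6 = m₁.arr 6 := (kf 6 (by decide) (by decide)).symm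
      simpa [Mem.setReg_arr, Mem.setArr_arr, this] using h8.concat p
    · simp; omega
    · intro v
      rw [hpe]
      simpa [Mem.setReg_arr, Mem.setArr_arr] using deg' v
    · intro v
      rw [hpe]
      have := sum' v
      simpa [Mem.setReg_arr, Mem.setArr_arr] using this
    · intro w hw
      rw [htk] at hw
      simpa [Mem.setReg_arr, Mem.setArr_arr] using par' w hw
  · intro g1
    rw [Mem.setArr_arr, if_neg (by decide), deg' p] at g1
    have hnall : ¬ (p ≠ o ∧ ∀ w, w ≠ o → par w = p → w ∈ l.take (i + 1)) := by
      rintro ⟨hpo, hall⟩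
      apply g1
      rw [hpempty.2 hall, if_neg hpo]
      exact ⟨rfl, fun hh => hpo (Fin.ext hh)⟩
    refine nextIndex_wp (i := i) ?_ (by omega) ⟨l, ?_⟩
    · simpa [Mem.setReg_reg, Mem.setArr_reg] using k2
    refine ⟨?_, ?_, ?_, ?_, h4, ?_, h6, ?_, ?_, hil, ?_, ?_, ?_⟩
    · simpa [Mem.setReg_reg, Mem.setArr_reg] using k0
    · simpa [Mem.setReg_reg, Mem.setArr_reg] using k1
    · simp [Mem.setReg_reg]
    · intro a ha
      have a5 : a ≠ 5 := by omega
      simpa [Mem.setReg_arr, Mem.setArr_arr, a5] using frame' a ha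
    · intro v
      by_cases hv : v = p
      · subst hv
        exact ⟨fun hh => absurd hh hpl, fun hh => absurd hh hnall⟩
      · rw [h5]
        refine and_congr_right fun _ => forall_congr' fun w => forall_congr' fun _ =>
          forall_congr' fun hw => (child' v hv w hw).symm
    · simpa [Mem.setReg_reg, Mem.setArr_reg] using k3
    · have : m.arr 6 = m₁.arr 6 := (kf 6 (by decide) (by decide)).symm
      simpa [Mem.setReg_arr, Mem.setArr_arr, this] using h8
    · intro v
      simpa [Mem.setReg_arr, Mem.setArr_arr] using deg' v
    · intro v
      have := sum' v
      simpa [Mem.setReg_arr, Mem.setArr_arr] using this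
    · intro w hw
      simpa [Mem.setReg_arr, Mem.setArr_arr] using par' w hw

end RAM

/-! ### Linear bounds for the costs. -/

namespace TVG

variable {V : Type*} {G : TVG V} {o : V}

theorem serve_le_sum {v : V} {L : List V} {f : V → ℕ}
    (h : ∀ u ∈ L, ∀ t, G.branchCost o v u t ≤ f u) (t : ℕ) :
    G.serve o v t L ≤ t + (L.map f).sum := by
  induction L generalizing t with
  | nil => simp [serve]
  | cons u L ih =>
    have h1 := ih (fun w hw => h w (List.mem_cons_of_mem _ hw)) (t + G.branchCost o v u t)
    have h2 := h u (by simp) t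
    rw [List.map_cons, List.sum_cons]
    change G.serve o v (t + G.branchCost o v u t) L ≤ _
    omega

theorem sum_map_mul {L : List V} (f : V → ℕ) (c : ℕ) :
    (L.map fun u => c * f u).sum = c * (L.map f).sum := by
  induction L with
  | nil => rfl
  | cons u L ih => rw [List.map_cons, List.sum_cons, ih, List.map_cons, List.sum_cons, mul_add]

variable [Finite V]

/-- The subtrees at different children are disjoint, and none contains `v`. -/
theorem sum_ncard_subtree_le (hT : G.graph.IsTree) {v : V} {L : List V} (hnd : L.Nodup)
    (hL : ∀ u ∈ L, u ∈ G.children o v) :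
    (L.map fun u => (G.subtree o u).ncard).sum + 1 ≤ (G.subtree o v).ncard := by
  have key : ∀ L : List V, L.Nodup → (∀ u ∈ L, u ∈ G.children o v) →
      (L.map fun u => (G.subtree o u).ncard).sum = {w | ∃ u ∈ L, w ∈ G.subtree o u}.ncard := by
    intro L
    induction L with
    | nil => simp
    | cons u L ih =>
      intro hnd hL
      rw [List.nodup_cons] at hnd
      rw [List.map_cons, List.sum_cons, ih hnd.2 fun w hw => hL w (List.mem_cons_of_mem _ hw),
        ← Set.ncard_union_eq]
      · congr 1
        ext w
        simp
      · rw [Set.disjoint_left]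
        rintro w hw ⟨u', hu', hw'⟩
        obtain rfl := eq_child_of_mem hT (hL u (by simp)) (hL u' (List.mem_cons_of_mem _ hu')) hw hw'
        exact hnd.1 hu'
  rw [key L hnd hL]
  have hv : v ∉ {w | ∃ u ∈ L, w ∈ G.subtree o u} := by
    rintro ⟨u, hu, hw⟩
    exact notMem_subtree_child hT (hL u hu) hw
  rw [← Set.ncard_insert_of_notMem hv]
  refine Set.ncard_le_ncard ?_ (Set.toFinite _)
  rintro w (rfl | ⟨u, hu, hw⟩)
  · exact self_mem_subtree G o w
  · exact subtree_child_subset (hL u hu) hw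

/-- Each edge below `v` is crossed twice, and each crossing takes at most two dates including the
waiting. -/
theorem IsPeriodic.costs_le (hP : G.IsPeriodic 2) (hT : G.graph.IsTree) (v : V) :
    ∀ t, G.returnCost (G.subtree o v) v t + 4 ≤ 4 * (G.subtree o v).ncard := by
  induction v using subtree_induction (o := o) hT with
  | h v ih =>
    intro t
    obtain ⟨L, hnd, hL⟩ := G.exists_children_list o v
    rw [hP.returnCost_eq hT hnd hL]
    have h1 := listCost_le_serve (fun u hu => hP.typed_branchCost hT ((hL u).1 hu)) t
    have h2 := serve_le_sum (G := G) (o := o) (v := v) (L := L)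
      (f := fun u => 4 * (G.subtree o u).ncard) (fun u hu t => by
        have h1 := hP.branchCost_eq hT ((hL u).1 hu) t
        have h2 := ih u ((hL u).1 hu) (t + G.wait s(v, u) t + 1)
        have h3 := G.wait_le s(v, u) t
        have h4 := G.wait_le s(v, u) (t + G.wait s(v, u) t + 1 +
          G.returnCost (G.subtree o u) u (t + G.wait s(v, u) t + 1))
        omega) t
    have h3 := sum_ncard_subtree_le hT hnd fun u hu => (hL u).1 hu
    rw [sum_map_mul] at h2
    omega

theorem IsPeriodic.branchCost_le (hP : G.IsPeriodic 2) (hT : G.graph.IsTree) {u v : V}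
    (hu : u ∈ G.children o v) (t : ℕ) : G.branchCost o v u t ≤ 4 * (G.subtree o u).ncard := by
  have h1 := hP.branchCost_eq hT hu t
  have h2 := hP.costs_le (o := o) hT u (t + G.wait s(v, u) t + 1)
  have h3 := G.wait_le s(v, u) t
  have h4 := G.wait_le s(v, u) (t + G.wait s(v, u) t + 1 +
    G.returnCost (G.subtree o u) u (t + G.wait s(v, u) t + 1))
  omega

theorem IsPeriodic.listCost_le (hP : G.IsPeriodic 2) (hT : G.graph.IsTree) {v : V} {L : List V}
    (hnd : L.Nodup) (hL : ∀ u ∈ L, u ∈ G.children o v) (t : ℕ) :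
    G.listCost o v t L + 4 ≤ 4 * (G.subtree o v).ncard := by
  have h1 := listCost_le_serve (fun u hu => hP.typed_branchCost hT (hL u hu)) t
  have h2 := serve_le_sum (G := G) (o := o) (v := v) (L := L) (fun u hu =>
    hP.branchCost_le hT (hL u hu)) t
  have h3 := sum_ncard_subtree_le hT hnd hL
  rw [sum_map_mul] at h2
  omega

end TVG

/-! ### Correctness and running time of the ordering phase. -/

namespace RAM

open TVG

/-- The list `l` enumerates the vertices other than the root, children before their parents. -/
structure Queue {n : ℕ} (o : Fin n) (par : Fin n → Fin n) (l : List (Fin n)) : Prop where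
  nodup : l.Nodup
  mem : ∀ v, v ∈ l ↔ v ≠ o
  order : ∀ k (h : k < l.length) u, u ≠ o → par u = l[k] → u ∈ l.take k

/-- The memory holds the queue, the parents of the vertices, and the data of their parent edges. -/
structure Peeled {n : ℕ} (G : TVG (Fin n)) (o : Fin n) (par : Fin n → Fin n) (l : List (Fin n))
    (m : Mem) : Prop where
  size : m.reg 0 = n
  start : m.reg 1 = o
  list : ListIn (m.arr 6) l
  index_lt : ∀ u, u ≠ o → m.arr 5 u < n
  parent : ∀ u, u ≠ o → m.arr 7 u = par u
  even : ∀ u, u ≠ o → 1 - m.arr 2 (m.arr 5 u) = G.wait s(par u, u) 0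
  odd : ∀ u, u ≠ o → 1 - m.arr 3 (m.arr 5 u) = G.wait s(par u, u) 1
  zero : ∀ a i, 8 ≤ a → m.arr a i = 0

theorem peelLoop_runs {W n : ℕ} {G : TVG (Fin n)} {o : Fin n} {par : Fin n → Fin n}
    {idx : Fin n → ℕ} {m₀ m : Mem} (hT : G.graph.IsTree) (hpar : G.IsParent o par)
    (hidx : EdgeIndex G o par idx m₀.arr) (hW : 4 * n ≤ W)
    (hz : ∀ a i, 8 ≤ a → m₀.arr a i = 0) (h : ∃ l, PeelInv o par idx m₀ 0 m l) :
    Runs W (.loop moreEdges peelBody) m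
      ((n - 1) * (moreEdges.cost + 1 + peelBody.time) + (moreEdges.cost + 1))
      (fun m' => ∃ l, Queue o par l ∧ Peeled G o par l m') := by
  have hrun : Runs W (.loop moreEdges peelBody) m
      ((n - 1) * (moreEdges.cost + 1 + peelBody.time) + (moreEdges.cost + 1))
      (fun m' => ∃ l, PeelInv o par idx m₀ (n - 1) m' l) := by
    refine Runs.loop (fun i m' => ∃ l, PeelInv o par idx m₀ i m' l) ?_ ?_ h
    · intro i hi m' hm'
      refine ⟨?_, peelBody_runs hT hpar hidx hW hi hm'⟩
      obtain ⟨l, hl⟩ := hm'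
      rw [moreEdges_eval hl.size hl.index, if_pos (by omega)]
      decide
    · rintro m' ⟨l, hl⟩
      rw [moreEdges_eval hl.size hl.index, if_neg (by omega)]
  obtain ⟨k, m', h1, h2, l, hl⟩ := hrun
  refine ⟨k, m', h1, h2, l, ?_⟩
  have hle : l.length ≤ n - 1 := by
    have h1 : l.toFinset ⊆ Finset.univ.erase o := fun v hv => by
      simpa using ((hl.queued v).1 (List.mem_toFinset.1 hv)).1
    have h2 := Finset.card_le_card h1
    rw [List.toFinset_card_of_nodup hl.nodup, Finset.card_erase_of_mem (Finset.mem_univ o)] at h2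
    simpa using h2
  have hmem : ∀ v, v ∈ l ↔ v ≠ o := fun v =>
    ⟨fun hv => ((hl.queued v).1 hv).1, hl.mem_list hT hpar hle v⟩
  have htake : l.take (n - 1) = l := List.take_of_length_le hle
  -- When everything is peeled off, every sum has shrunk to the index of the parent edge, so array
  -- `5` is a table of parent edges.
  have hsum : ∀ u, u ≠ o → m'.arr 5 u = idx u := by
    intro u hu
    have : pending o par l (n - 1) u = ∅ := by
      rw [Finset.eq_empty_iff_forall_notMem]
      intro w hw
      obtain ⟨w1, w2, w3⟩ := mem_pending.1 hw
      rw [htake] at w3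
      exact w3 ((hmem w).2 w1)
    have hlt := hidx.lt u hu
    rw [hl.sum, this, if_neg hu, Finset.sum_empty, zero_add, Nat.mod_eq_of_lt (by omega)]
  refine ⟨⟨hl.nodup, hmem, hl.order⟩, hl.size, hl.start, hl.list, ?_, ?_, ?_, ?_, ?_⟩
  · intro u hu
    have := hidx.lt u hu
    rw [hsum u hu]
    omega
  · intro u hu
    exact hl.parent u (by rw [htake]; exact (hmem u).2 hu)
  · intro u hu
    rw [hsum u hu, hl.frame 2 (by omega), hidx.even u hu]
  · intro u hu
    rw [hsum u hu, hl.frame 3 (by omega), hidx.odd u hu]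
  · intro a i ha
    rw [hl.frame a (Or.inr ha), hz a i ha]

/-- Before any removal, a vertex other than the root has degree one exactly if it has no children,
so the leaves form the right initial queue. -/
theorem CountInv.peelInv {n : ℕ} {G : TVG (Fin n)} {o : Fin n} {par : Fin n → Fin n}
    {idx : Fin n → ℕ} {m₀ m₁ m : Mem} {l : List (Fin n)}
    (hidx : EdgeIndex G o par idx m₀.arr) (hc : CountInv n o m₀ (n - 1) m₁)
    (h : LeafInv o m₁ n m l) :
    PeelInv o par idx m₀ 0 (m.setReg 2 0) l := by
  have hdeg : ∀ v : Fin n, m₁.arr 4 v =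
      (pending o par l 0 v).card + if v = o then 0 else 1 := by
    intro v
    rw [hc.deg, hidx.endSum_eq, Finset.sum_const, smul_eq_mul, mul_one]
    simp [pending]
  have hq : ∀ v, v ∈ l ↔ v ≠ o ∧ ∀ u, u ≠ o → par u = v → u ∈ l.take 0 := by
    intro v
    rw [h.queued, hdeg]
    constructor
    · rintro ⟨-, h1, h2⟩
      rw [if_neg h1] at h2
      refine ⟨h1, fun u hu huv => ?_⟩
      have := Finset.card_eq_zero.1 (show (pending o par l 0 v).card = 0 by omega)
      exact absurd (mem_pending.2 ⟨hu, huv, by simp⟩)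
        (Finset.eq_empty_iff_forall_notMem.1 this u)
    · rintro ⟨h1, h2⟩
      refine ⟨v.2, h1, ?_⟩
      rw [if_neg h1, Finset.card_eq_zero.2, zero_add]
      rw [Finset.eq_empty_iff_forall_notMem]
      intro u hu
      obtain ⟨u1, u2, -⟩ := mem_pending.1 hu
      simpa using h2 u u1 u2
  refine ⟨?_, ?_, ?_, ?_, h.nodup, hq, ?_, ?_, ?_, Nat.zero_le _, ?_, ?_, ?_⟩
  · simpa [Mem.setReg_reg] using h.size
  · simpa [Mem.setReg_reg] using h.start
  · simp [Mem.setReg_reg]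
  · intro a ha
    rw [Mem.setReg_arr, h.frame a (by omega), hc.frame a (by omega) (by omega)]
  · intro k hk u hu huk
    simpa using ((hq _).1 (List.getElem_mem hk)).2 u hu huk
  · simpa [Mem.setReg_reg] using h.tail
  · simpa [Mem.setReg_arr] using h.list
  · intro v
    rw [Mem.setReg_arr, h.frame 4 (by decide), hdeg]
  · intro v
    rw [Mem.setReg_arr, h.frame 5 (by decide), hc.sum, hidx.endSum_eq]
    simp [pending]
  · intro u hu
    simp at hu

/-- Compute an order of the vertices, children before parents, and the parents. -/
def orderProg : Prog :=
  .seq (.loop moreEdges countBody) <|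
  .seq (.setReg 2 (.const 0)) <|
  .seq (.loop moreVertices leafBody) <|
  .seq (.setReg 2 (.const 0)) (.loop moreEdges peelBody)

theorem setReg_runs {W x w : ℕ} {e : Expr} {m : Mem} (he : e.eval m = w) (hw : w ≤ W)
    {Q : Mem → Prop} (hQ : Q (m.setReg x w)) : Runs W (.setReg x e) m (e.cost + 1) Q :=
  ⟨_, _, .setReg m x e (he ▸ hw), le_rfl, by rwa [he]⟩

theorem Runs.mono {W : ℕ} {P : Prog} {m : Mem} {K K' : ℕ} {Q Q' : Mem → Prop}
    (h : Runs W P m K Q) (hK : K ≤ K') (hQ : ∀ m', Q m' → Q' m') : Runs W P m K' Q' := by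
  obtain ⟨k, m', h1, h2, h3⟩ := h
  exact ⟨k, m', h1, h2.trans hK, hQ m' h3⟩

theorem orderProg_runs : ∃ C, ∀ (n : ℕ) (G : TVG (Fin n)) (o : Fin n)
    (par : Fin n → Fin n) (m : Mem) (W : ℕ), G.graph.IsTree → G.IsParent o par →
    Encodes G o m → 4 * n ≤ W →
    Runs W orderProg m (C * n) (fun m' => ∃ l, Queue o par l ∧ Peeled G o par l m') := by
  refine ⟨(moreEdges.cost + 1 + countBody.time) + (moreEdges.cost + 1) + 2 +
    ((moreVertices.cost + 1 + leafBody.time) + (moreVertices.cost + 1)) + 2 +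
    ((moreEdges.cost + 1 + peelBody.time) + (moreEdges.cost + 1)), ?_⟩
  intro n G o par m W hT hpar hE hW
  obtain ⟨idx, hidx⟩ := hE.exists_edgeIndex hT hpar
  have hn : 0 < n := o.pos
  have hends : ∀ j < n - 1, m.arr 0 j < n ∧ m.arr 1 j < n := by
    intro j hj
    obtain ⟨u, hu, rfl⟩ := hidx.surj j hj
    rcases hidx.ends u hu with ⟨h1, h2⟩ | ⟨h1, h2⟩ <;> rw [h1, h2] <;>
      exact ⟨Fin.is_lt _, Fin.is_lt _⟩
  have h1 := countLoop_runs hn hW hends hE.size hE.start hE.reg_zero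
    (fun a i ha => hE.arr_zero a i (Or.inl ha))
  have h2 := h1.seq (P' := .seq (.setReg 2 (.const 0)) <| .seq (.loop moreVertices leafBody) <|
    .seq (.setReg 2 (.const 0)) (.loop moreEdges peelBody)) fun m₁ hm₁ =>
    (setReg_runs (W := W) (x := 2) (e := .const 0) (w := 0) (m := m₁)
      (Q := fun m' => m' = m₁.setReg 2 0) rfl (Nat.zero_le _) rfl).seq fun m₂ hm₂ => by
      subst hm₂
      exact (leafLoop_runs (o := o) (m := m₁.setReg 2 0) hW
        (by simpa [Mem.setReg_reg] using hm₁.size) (by simpa [Mem.setReg_reg] using hm₁.start)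
        (by simp [Mem.setReg_reg]) (by simpa [Mem.setReg_reg] using hm₁.tail)).seq fun m₃ hm₃ =>
        (setReg_runs (W := W) (x := 2) (e := .const 0) (w := 0) (m := m₃)
          (Q := fun m' => m' = m₃.setReg 2 0) rfl (Nat.zero_le _) rfl).seq fun m₄ hm₄ => by
          subst hm₄
          obtain ⟨l, hl⟩ := hm₃
          have hl' : LeafInv o m₁ n m₃ l :=
            ⟨hl.size, hl.start, hl.index, hl.frame, hl.nodup, hl.queued, hl.tail, hl.list⟩
          exact peelLoop_runs hT hpar hidx hW
            (fun a i ha => hE.arr_zero a i (Or.inl (by omega))) ⟨l, hm₁.peelInv hidx hl'⟩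
  refine h2.mono ?_ fun _ h => h
  -- As `n` is at least `1`, the final test of a loop is absorbed into the linear bound.
  have h3 : ∀ c d : ℕ, (n - 1) * c + d ≤ (c + d) * n := fun c d => by
    have := Nat.mul_le_mul_right c (Nat.sub_le n 1)
    have := Nat.mul_le_mul_left d hn
    rw [add_mul]
    nlinarith
  have h3' : ∀ c d : ℕ, n * c + d ≤ (c + d) * n := fun c d => by
    have := Nat.mul_le_mul_left d hn
    rw [add_mul]
    nlinarith
  have a1 := h3 (moreEdges.cost + 1 + countBody.time) (moreEdges.cost + 1)
  have a2 := h3' (moreVertices.cost + 1 + leafBody.time) (moreVertices.cost + 1)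
  have a3 := h3 (moreEdges.cost + 1 + peelBody.time) (moreEdges.cost + 1)
  have a4 : (Expr.const 0).cost + 1 ≤ 2 * n := by simp only [Expr.cost]; omega
  generalize (moreEdges.cost + 1 + countBody.time) + (moreEdges.cost + 1) = c1 at *
  generalize (moreVertices.cost + 1 + leafBody.time) + (moreVertices.cost + 1) = c2 at *
  generalize (moreEdges.cost + 1 + peelBody.time) + (moreEdges.cost + 1) = c3 at *
  have : (c1 + 2 + c2 + 2 + c3) * n = c1 * n + 2 * n + c2 * n + 2 * n + c3 * n := by ring
  omega

end RAM

/-! ### Costs with return, computed in the order of the queue. -/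

namespace RAM

open TVG

theorem wp_setReg {W x w : ℕ} {e : Expr} {m : Mem} {Q : Mem → Prop} (he : e.eval m = w)
    (hw : w ≤ W) (hQ : Q (m.setReg x w)) : (Prog.setReg x e).wp W Q m :=
  ⟨he ▸ hw, fun w' hw' => by rwa [hw', he]⟩

theorem wp_setArr {W a j w : ℕ} {i e : Expr} {m : Mem} {Q : Mem → Prop} (hi : i.eval m = j)
    (he : e.eval m = w) (hj : j ≤ W) (hw : w ≤ W) (hQ : Q (m.setArr a j w)) :
    (Prog.setArr a i e).wp W Q m :=
  ⟨hi ▸ hj, he ▸ hw, fun j' w' hj' hw' => by rwa [hj', hw', hi, he]⟩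

/-- The index of the entry of the vertex in register `x` for the parity or type `p`, in an array
with two entries per vertex. -/
def Expr.pair (x : ℕ) (p : Expr) : Expr := .add (.add (.reg x) (.reg x)) p

/-- The number of waiting steps from an even date on. -/
def Expr.waste (x y : Expr) : Expr := .add (.sub x (.add y (.const 1))) (.sub y x)

theorem Expr.pair_eval (m : Mem) (x : ℕ) (p : Expr) :
    (Expr.pair x p).eval m = m.reg x + m.reg x + p.eval m := rfl

theorem Expr.waste_eval (m : Mem) (x y : Expr) :
    (Expr.waste x y).eval m = TVG.waste (x.eval m) (y.eval m) 0 := rfl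

/-- A start at an odd date exchanges the roles of the two types, so one expression serves both
parities. -/
theorem waste_zero_swap (x y : ℕ) : TVG.waste y x 0 = TVG.waste x y 1 := rfl

/-- Registers `4`, `5` and `6` receive the next vertex of the queue, the index of its parent edge,
and its parent. -/
def fetch : Prog :=
  .seq (.setReg 4 (.arr 6 (.reg 2))) <|
  .seq (.setReg 5 (.arr 5 (.reg 4))) <|
  .setReg 6 (.arr 7 (.reg 4))

/-- Array `8` receives the waiting times for the parent edge at both parities. Array `9` receives
the costs with return of the subtree, from the summary of its branches: the numbers of type `fw10`
in array `11` and of type `fw01` in array `12`, and the sum of least costs in array `13`. -/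
def prepare : Prog :=
  .seq (.setArr 8 (.pair 4 (.const 0)) (.sub (.const 1) (.arr 2 (.reg 5)))) <|
  .seq (.setArr 8 (.pair 4 (.const 1)) (.sub (.const 1) (.arr 3 (.reg 5)))) <|
  .seq (.setArr 9 (.const 0)
    (.add (.arr 13 (.reg 4)) (.waste (.arr 11 (.reg 4)) (.arr 12 (.reg 4))))) <|
  .setArr 9 (.const 1)
    (.add (.arr 13 (.reg 4)) (.waste (.arr 12 (.reg 4)) (.arr 11 (.reg 4))))

/-- Register `7` follows the agent from date `p` on: across the edge, then through the subtree. Only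
the parity of its value is needed to look up the next cost. -/
def branchProg (p : ℕ) : Prog :=
  .seq (.setReg 7 (.add (.add (.const p) (.arr 8 (.pair 4 (.const p)))) (.const 1))) <|
  .seq (.setReg 7 (.add (.reg 7) (.arr 9 (.parity (.reg 7))))) <|
  .setArr 10 (.pair 4 (.const p)) (.sub (.add (.add (.reg 7)
    (.arr 8 (.pair 4 (.parity (.reg 7))))) (.const 1)) (.const p))

/-- The cost of the branch of the vertex in register `4` at dates of parity `p`. -/
def Expr.branch (p : ℕ) : Expr := .arr 10 (.pair 4 (.const p))

/-- With truncated subtraction this is the minimum of the two costs. -/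
def Expr.low : Expr := .sub (.branch 0) (.sub (.branch 0) (.branch 1))

def accumulate : Prog :=
  .seq (.setArr 11 (.reg 6) (.add (.arr 11 (.reg 6)) (.lt (.branch 0) (.branch 1)))) <|
  .seq (.setArr 12 (.reg 6) (.add (.arr 12 (.reg 6)) (.lt (.branch 1) (.branch 0)))) <|
  .setArr 13 (.reg 6) (.add (.arr 13 (.reg 6)) .low)

/-- Every vertex has two linked lists of children, with heads in array `15` and links in array `14`.
List `1` is for type `fw01` and list `0` for the rest; a constant branch may join the `fw10`
branches since it is never slow. -/
def push : Prog :=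
  .seq (.setReg 7 (.pair 6 (.lt (.branch 1) (.branch 0)))) <|
  .seq (.setArr 14 (.reg 4) (.arr 15 (.reg 7))) <|
  .setArr 15 (.reg 7) (.add (.reg 4) (.const 1))

def costBody : Prog :=
  .seq fetch <| .seq prepare <| .seq (branchProg 0) <| .seq (branchProg 1) <|
  .seq accumulate <| .seq push nextIndex

theorem fetch_wp {W i u j p : ℕ} {m : Mem} {Q : Mem → Prop} (h2 : m.reg 2 = i)
    (hu : m.arr 6 i = u) (hj : m.arr 5 u = j) (hp : m.arr 7 u = p) (huW : u ≤ W) (hjW : j ≤ W)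
    (hpW : p ≤ W)
    (hQ : ∀ m', (∀ x, x < 4 ∨ 7 ≤ x → m'.reg x = m.reg x) → m'.reg 4 = u → m'.reg 5 = j →
      m'.reg 6 = p → m'.arr = m.arr → Q m') : fetch.wp W Q m := by
  refine wp_setReg (w := u) (by simp [Expr.eval, h2, hu]) huW ?_
  refine wp_setReg (w := j) (by simp [Expr.eval, Mem.setReg_reg, Mem.setReg_arr, hj]) hjW ?_
  refine wp_setReg (w := p) (by simp [Expr.eval, Mem.setReg_reg, Mem.setReg_arr, hp]) hpW ?_
  refine hQ _ ?_ ?_ ?_ ?_ ?_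
  · intro x hx
    have h4 : x ≠ 4 := by omega
    have h5 : x ≠ 5 := by omega
    have h6 : x ≠ 6 := by omega
    simp [Mem.setReg_reg, h4, h5, h6]
  · simp [Mem.setReg_reg]
  · simp [Mem.setReg_reg]
  · simp [Mem.setReg_reg]
  · simp [Mem.setReg_arr]

theorem prepare_wp {W u j w₀ w₁ s x y : ℕ} {m : Mem} {Q : Mem → Prop} (h4 : m.reg 4 = u)
    (h5 : m.reg 5 = j) (h0 : 1 - m.arr 2 j = w₀) (h1 : 1 - m.arr 3 j = w₁)
    (hs : m.arr 13 u = s) (hx : m.arr 11 u = x) (hy : m.arr 12 u = y) (huW : u + u + 1 ≤ W)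
    (hsW : s + TVG.waste x y 0 ≤ W) (hsW' : s + TVG.waste x y 1 ≤ W)
    (hQ : ∀ m', m'.reg = m.reg → (∀ a, a ≠ 8 → a ≠ 9 → m'.arr a = m.arr a) →
      m'.arr 8 (u + u) = w₀ → m'.arr 8 (u + u + 1) = w₁ →
      (∀ k, k ≠ u + u → k ≠ u + u + 1 → m'.arr 8 k = m.arr 8 k) →
      m'.arr 9 0 = s + TVG.waste x y 0 → m'.arr 9 1 = s + TVG.waste x y 1 → Q m') :
    prepare.wp W Q m := by
  refine wp_setArr (j := u + u) (w := w₀) (by simp [Expr.pair_eval, Expr.eval, h4])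
    (by simp [Expr.eval, h5, h0]) (by omega) (by omega) ?_
  refine wp_setArr (j := u + u + 1) (w := w₁)
    (by simp [Expr.pair_eval, Expr.eval, Mem.setArr_reg, h4])
    (by simp [Expr.eval, Mem.setArr_reg, Mem.setArr_arr, h5, h1]) (by omega) (by omega) ?_
  refine wp_setArr (j := 0) (w := s + TVG.waste x y 0) rfl
    (by simp [Expr.waste_eval, Expr.eval, Mem.setArr_reg, Mem.setArr_arr, h4, hs, hx, hy])
    (by omega) hsW ?_
  refine wp_setArr (j := 1) (w := s + TVG.waste x y 1) rfl
    (by simp [Expr.waste_eval, Expr.eval, Mem.setArr_reg, Mem.setArr_arr, h4, hs, hx, hy,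
      waste_zero_swap])
    (by omega) hsW' ?_
  refine hQ _ ?_ ?_ ?_ ?_ ?_ ?_ ?_
  · simp [Mem.setArr_reg]
  · intro a a8 a9
    simp [Mem.setArr_arr, a8, a9]
  · simp [Mem.setArr_arr]
  · simp [Mem.setArr_arr]
  · intro k k1 k2
    simp [Mem.setArr_arr, k1, k2]
  · simp [Mem.setArr_arr]
  · simp [Mem.setArr_arr]

theorem branchProg_wp {W u p b : ℕ} {w c : ℕ → ℕ} {m : Mem} {Q : Mem → Prop} (hp : p < 2)
    (h4 : m.reg 4 = u) (hw : ∀ q < 2, m.arr 8 (u + u + q) = w q) (hc : ∀ q < 2, m.arr 9 q = c q)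
    (hb : p + b = p + w p + 1 + c ((p + w p + 1) % 2) +
      w ((p + w p + 1 + c ((p + w p + 1) % 2)) % 2) + 1)
    (huW : u + u + 1 ≤ W) (hbW : p + b ≤ W)
    (hQ : ∀ m', (∀ x, x ≠ 7 → m'.reg x = m.reg x) → (∀ a, a ≠ 10 → m'.arr a = m.arr a) →
      m'.arr 10 = Function.update (m.arr 10) (u + u + p) b → Q m') :
    (branchProg p).wp W Q m := by
  refine wp_setReg (w := p + w p + 1)
    (by simp [Expr.pair_eval, Expr.eval, h4, hw p hp]) (by omega) ?_
  refine wp_setReg (w := p + w p + 1 + c ((p + w p + 1) % 2))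
    (by simp [Expr.eval, Mem.setReg_reg, Mem.setReg_arr, hc _ (Nat.mod_lt _ two_pos)])
    (by omega) ?_
  refine wp_setArr (j := u + u + p) (w := b)
    (by simp [Expr.pair_eval, Expr.eval, Mem.setReg_reg, h4])
    (by simp only [Expr.pair_eval, Expr.eval, Mem.setReg_reg, Mem.setReg_arr, if_true,
          show ¬ (4 = 7) by decide, if_false, h4, hw _ (Nat.mod_lt _ two_pos)]; omega)
    (by omega) (by omega) ?_
  refine hQ _ ?_ ?_ ?_
  · intro x x7
    simp [Mem.setArr_reg, Mem.setReg_reg, x7]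
  · intro a a10
    simp [Mem.setArr_arr, Mem.setReg_arr, a10]
  · simp [Mem.setArr_arr, Mem.setReg_arr]

theorem accumulate_wp {W u v : ℕ} {b : ℕ → ℕ} {m : Mem} {Q : Mem → Prop}
    (h4 : m.reg 4 = u) (h6 : m.reg 6 = v) (hb : ∀ q < 2, m.arr 10 (u + u + q) = b q)
    (hvW : v ≤ W) (hxW : m.arr 11 v < W) (hyW : m.arr 12 v < W) (hsW : m.arr 13 v + low b ≤ W)
    (hQ : ∀ m', m'.reg = m.reg → (∀ a, a ≠ 11 → a ≠ 12 → a ≠ 13 → m'.arr a = m.arr a) →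
      m'.arr 11 = Function.update (m.arr 11) v (m.arr 11 v + fastEven b) →
      m'.arr 12 = Function.update (m.arr 12) v (m.arr 12 v + fastOdd b) →
      m'.arr 13 = Function.update (m.arr 13) v (m.arr 13 v + low b) → Q m') :
    accumulate.wp W Q m := by
  have hb0 : m.arr 10 (u + u) = b 0 := hb 0 (by omega)
  have hb1 := hb 1 (by omega)
  have e1 : fastEven b ≤ 1 := by unfold fastEven; split_ifs <;> omega
  have e2 : fastOdd b ≤ 1 := by unfold fastOdd; split_ifs <;> omega
  refine wp_setArr (j := v) (w := m.arr 11 v + fastEven b) (by simp [Expr.eval, h6])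
    (by simp [Expr.branch, Expr.pair_eval, Expr.eval, h4, h6, hb0, hb1, fastEven]) hvW
    (by omega) ?_
  refine wp_setArr (j := v) (w := m.arr 12 v + fastOdd b)
    (by simp [Expr.eval, Mem.setArr_reg, h6])
    (by simp [Expr.branch, Expr.pair_eval, Expr.eval, Mem.setArr_reg, Mem.setArr_arr, h4, h6, hb0,
      hb1, fastOdd]) hvW (by omega) ?_
  refine wp_setArr (j := v) (w := m.arr 13 v + low b)
    (by simp [Expr.eval, Mem.setArr_reg, h6])
    (by
      simp only [Expr.low, Expr.branch, Expr.pair_eval, Expr.eval, Mem.setArr_reg, Mem.setArr_arr,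
        h4, h6]
      simp [hb0, hb1, low]
      omega) hvW (by omega) ?_
  refine hQ _ ?_ ?_ ?_ ?_ ?_
  · simp [Mem.setArr_reg]
  · intro a a1 a2 a3
    simp [Mem.setArr_arr, a1, a2, a3]
  · simp [Mem.setArr_arr]
  · simp [Mem.setArr_arr]
  · simp [Mem.setArr_arr]

theorem push_wp {W u v : ℕ} {b : ℕ → ℕ} {m : Mem} {Q : Mem → Prop}
    (h4 : m.reg 4 = u) (h6 : m.reg 6 = v) (hb : ∀ q < 2, m.arr 10 (u + u + q) = b q)
    (hvW : v + v + 1 ≤ W) (huW : u < W) (hhW : m.arr 15 (v + v + fastOdd b) ≤ W)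
    (hQ : ∀ m', (∀ x, x ≠ 7 → m'.reg x = m.reg x) →
      (∀ a, a ≠ 14 → a ≠ 15 → m'.arr a = m.arr a) →
      m'.arr 14 = Function.update (m.arr 14) u (m.arr 15 (v + v + fastOdd b)) →
      m'.arr 15 = Function.update (m.arr 15) (v + v + fastOdd b) (u + 1) → Q m') :
    push.wp W Q m := by
  have hb0 : m.arr 10 (u + u) = b 0 := hb 0 (by omega)
  have hb1 := hb 1 (by omega)
  have e2 : fastOdd b ≤ 1 := by unfold fastOdd; split_ifs <;> omega
  refine wp_setReg (w := v + v + fastOdd b)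
    (by simp [Expr.branch, Expr.pair_eval, Expr.eval, h4, h6, hb0, hb1, fastOdd]) (by omega) ?_
  refine wp_setArr (j := u) (w := m.arr 15 (v + v + fastOdd b))
    (by simp [Expr.eval, Mem.setReg_reg, h4]) (by simp [Expr.eval, Mem.setReg_reg, Mem.setReg_arr])
    (by omega) hhW ?_
  refine wp_setArr (j := v + v + fastOdd b) (w := u + 1)
    (by simp [Expr.eval, Mem.setReg_reg, Mem.setArr_reg])
    (by simp [Expr.eval, Mem.setReg_reg, Mem.setArr_reg, h4]) (by omega) (by omega) ?_
  refine hQ _ ?_ ?_ ?_ ?_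
  · intro x x7
    simp [Mem.setArr_reg, Mem.setReg_reg, x7]
  · intro a a1 a2
    simp [Mem.setArr_arr, Mem.setReg_arr, a1, a2]
  · simp [Mem.setArr_arr, Mem.setReg_arr]
  · simp [Mem.setArr_arr, Mem.setReg_arr]

/-- The linked list of vertices with links `nx` and head `h`, where `0` marks its end and `u + 1`
the vertex `u`. -/
def IsChain {n : ℕ} (nx : ℕ → ℕ) : ℕ → List (Fin n) → Prop
  | h, [] => h = 0
  | h, u :: L => h = u + 1 ∧ IsChain nx (nx u) L

theorem IsChain.update {n : ℕ} {nx : ℕ → ℕ} {h : ℕ} {L : List (Fin n)} (hc : IsChain nx h L)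
    {u : Fin n} (hu : u ∉ L) (x : ℕ) : IsChain (Function.update nx u x) h L := by
  induction L generalizing h with
  | nil => exact hc
  | cons w L ih =>
    obtain ⟨h1, h2⟩ := hc
    rw [List.mem_cons, not_or] at hu
    refine ⟨h1, ?_⟩
    rw [Function.update_of_ne (fun hh => hu.1 (Fin.ext hh.symm))]
    exact ih h2 hu.2

theorem IsChain.head_le {n : ℕ} {nx : ℕ → ℕ} {h : ℕ} {L : List (Fin n)} (hc : IsChain nx h L) :
    h ≤ n := by
  cases L with
  | nil => exact hc.trans_le (Nat.zero_le n)
  | cons w L => rw [hc.1]; exact w.2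

/-- The children of `v` among the first `i` vertices of the list `l`. -/
def kids {n : ℕ} (par : Fin n → Fin n) (l : List (Fin n)) (i : ℕ) (v : Fin n) : List (Fin n) :=
  (l.take i).filter fun u => par u = v

section Kids

variable {n : ℕ} {G : TVG (Fin n)} {o : Fin n} {par : Fin n → Fin n} {l : List (Fin n)}

theorem mem_kids {i : ℕ} {u v : Fin n} : u ∈ kids par l i v ↔ u ∈ l.take i ∧ par u = v := by
  simp [kids]

theorem kids_succ_self {i : ℕ} (hi : i < l.length) :
    kids par l (i + 1) (par l[i]) = kids par l i (par l[i]) ++ [l[i]] := by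
  rw [kids, List.take_succ_eq_append_getElem hi, List.filter_append]
  simp only [List.filter_cons, decide_true, if_true, List.filter_nil, kids]

theorem kids_succ_of_ne {i : ℕ} (hi : i < l.length) {v : Fin n} (hv : v ≠ par l[i]) :
    kids par l (i + 1) v = kids par l i v := by
  rw [kids, List.take_succ_eq_append_getElem hi, List.filter_append]
  simp only [List.filter_cons, hv.symm, decide_false, Bool.false_eq_true, if_false,
    List.filter_nil, List.append_nil, kids]

theorem Queue.nodup_kids (h : Queue o par l) (i : ℕ) (v : Fin n) : (kids par l i v).Nodup :=
  (h.nodup.sublist (List.take_sublist i l)).filter _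

theorem Queue.length (h : Queue o par l) : l.length = n - 1 := length_of_mem_iff_ne h.nodup h.mem

theorem Queue.length_kids_le (h : Queue o par l) (i : ℕ) (v : Fin n) :
    (kids par l i v).length ≤ n := by
  simpa using (h.nodup_kids i v).length_le_card

theorem Queue.ne_root (h : Queue o par l) {i : ℕ} (hi : i < l.length) : l[i] ≠ o :=
  (h.mem _).1 (List.getElem_mem hi)

theorem Queue.getElem_notMem_take (h : Queue o par l) {i : ℕ} (hi : i < l.length) :
    l[i] ∉ l.take i := by
  have := h.nodup.sublist (List.take_sublist (i + 1) l)
  rw [List.take_succ_eq_append_getElem hi, List.nodup_append] at this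
  intro hmem
  exact this.2.2 _ hmem _ (by simp) rfl

theorem Queue.mem_children_of_mem_kids (h : Queue o par l) (hpar : G.IsParent o par) {i : ℕ}
    {u v : Fin n} (hu : u ∈ kids par l i v) : u ∈ G.children o v := by
  obtain ⟨h1, rfl⟩ := mem_kids.1 hu
  exact hpar u ((h.mem u).1 (List.mem_of_mem_take h1))

/-- Children precede their parents, so all branches at a vertex have been processed when its turn
comes. -/
theorem Queue.mem_kids_getElem (h : Queue o par l) (hT : G.graph.IsTree) (hpar : G.IsParent o par)
    {i : ℕ} (hi : i < l.length) (u : Fin n) :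
    u ∈ kids par l i l[i] ↔ u ∈ G.children o l[i] := by
  refine ⟨h.mem_children_of_mem_kids hpar, fun hu => ?_⟩
  obtain ⟨h1, h2⟩ := (hpar.mem_children_iff hT).1 hu
  exact mem_kids.2 ⟨h.order i hi u h1 h2, h2⟩

theorem sum_le_length {L : List (Fin n)} {f : Fin n → ℕ} (hf : ∀ u, f u ≤ 1) :
    (L.map f).sum ≤ L.length := by
  induction L with
  | nil => simp
  | cons u L ih =>
    have := hf u
    simp only [List.map_cons, List.sum_cons, List.length_cons]
    omega

end Kids

theorem ncard_subtree_le {n : ℕ} (G : TVG (Fin n)) (o u : Fin n) : (G.subtree o u).ncard ≤ n := by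
  have := Set.ncard_le_ncard (Set.subset_univ (G.subtree o u)) (Set.toFinite _)
  simpa [Set.ncard_univ] using this

/-- The summaries and lists at a vertex contain those of its children that are processed so far. The
lists are reversed because a child is put in front. -/
structure CostInv {n : ℕ} (G : TVG (Fin n)) (o : Fin n) (par : Fin n → Fin n) (l : List (Fin n))
    (m₀ : Mem) (i : ℕ) (m : Mem) : Prop where
  size : m.reg 0 = n
  start : m.reg 1 = o
  index : m.reg 2 = i
  frame : ∀ a, a < 8 ∨ 16 ≤ a → m.arr a = m₀.arr a
  wait : ∀ u ∈ l.take i, ∀ p < 2, m.arr 8 (u + u + p) = G.wait s(par u, u) p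
  branch : ∀ u ∈ l.take i, ∀ p < 2, m.arr 10 (u + u + p) = G.branchCost o (par u) u p
  even : ∀ v : Fin n, m.arr 11 v =
    ((kids par l i v).map fun u => fastEven (G.branchCost o v u)).sum
  odd : ∀ v : Fin n, m.arr 12 v =
    ((kids par l i v).map fun u => fastOdd (G.branchCost o v u)).sum
  low : ∀ v : Fin n, m.arr 13 v =
    ((kids par l i v).map fun u => low (G.branchCost o v u)).sum
  chain : ∀ v : Fin n, ∀ b < 2, IsChain (m.arr 14) (m.arr 15 (v + v + b))
    ((kids par l i v).filter fun u => fastOdd (G.branchCost o v u) = b).reverse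

theorem costBody_runs {W n i : ℕ} {G : TVG (Fin n)} {o : Fin n} {par : Fin n → Fin n}
    {l : List (Fin n)} {m₀ m : Mem} (hT : G.graph.IsTree) (hP : G.IsPeriodic 2)
    (hpar : G.IsParent o par) (hq : Queue o par l) (hm₀ : Peeled G o par l m₀)
    (hW : 8 * n ≤ W) (hi : i < n - 1) (h : CostInv G o par l m₀ i m) :
    Runs W costBody m costBody.time (CostInv G o par l m₀ (i + 1)) := by
  have hil : i < l.length := by rw [hq.length]; exact hi
  obtain ⟨h0, h1, h2, hf, hw, hb, hx, hy, hS, hch⟩ := h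
  obtain ⟨u, hu⟩ : ∃ u, u = l[i] := ⟨_, rfl⟩
  have huo : u ≠ o := hu ▸ hq.ne_root hil
  have hunot : u ∉ l.take i := hu ▸ hq.getElem_notMem_take hil
  have hchild := hpar u huo
  have hun := u.2
  have hpn := (par u).2
  have htake : ∀ w, w ∈ l.take (i + 1) ↔ w ∈ l.take i ∨ w = u := fun w => by
    rw [List.take_succ_eq_append_getElem hil, List.mem_append, List.mem_singleton, hu]
  have hkids : ∀ w, w ∈ kids par l i u ↔ w ∈ G.children o u := fun w => by
    rw [hu]; exact hq.mem_kids_getElem hT hpar hil w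
  have hsucc : kids par l (i + 1) (par u) = kids par l i (par u) ++ [u] := by
    rw [hu]; exact kids_succ_self hil
  have hsucc' : ∀ v, v ≠ par u → kids par l (i + 1) v = kids par l i v := fun v hv =>
    kids_succ_of_ne hil (hu ▸ hv)
  -- The summary at `u` is complete, so it determines the cost with return from every date.
  have hcost : ∀ t, G.returnCost (G.subtree o u) u t = m.arr 13 u +
      TVG.waste (m.arr 11 u) (m.arr 12 u) t := fun t => by
    rw [hP.returnCost_eq hT (hq.nodup_kids i u) hkids, hx, hy, hS]
    rfl
  have hcostle : ∀ t, G.returnCost (G.subtree o u) u t + 4 ≤ 4 * n := fun t =>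
    (hP.costs_le hT u t).trans (by have := ncard_subtree_le G o u; omega)
  have hbrle : ∀ t, G.branchCost o (par u) u t ≤ 4 * n := fun t =>
    (hP.branchCost_le hT hchild t).trans (by have := ncard_subtree_le G o u; omega)
  have hsum1 : ∀ v, m.arr 11 (v : Fin n) ≤ n := fun v => by
    rw [hx]
    exact (sum_le_length fun u => by unfold fastEven; split_ifs <;> omega).trans
      (hq.length_kids_le i v)
  have hsum2 : ∀ v, m.arr 12 (v : Fin n) ≤ n := fun v => by
    rw [hy]
    exact (sum_le_length fun u => by unfold fastOdd; split_ifs <;> omega).trans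
      (hq.length_kids_le i v)
  -- The new sum at the parent is part of the cost of the branches counted so far, which is bounded
  -- by the size of the subtree; so it fits into a word.
  have hsum3 : m.arr 13 (par u) + low (G.branchCost o (par u) u) ≤ 4 * n := by
    have := hP.listCost_le hT (o := o) (hq.nodup_kids (i + 1) (par u))
      (fun w hw => hq.mem_children_of_mem_kids hpar hw) 0
    rw [listCost, hsucc, List.map_append, List.sum_append, ← hS] at this
    have h3 := ncard_subtree_le G o (par u)
    simp only [List.map_cons, List.map_nil, List.sum_cons, List.sum_nil] at this
    omega
  apply Prog.runs_of_wp
  refine fetch_wp (u := u) (j := m₀.arr 5 u) (p := par u) h2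
    (by rw [hf 6 (by omega), hm₀.list i hil, hu]) (by rw [hf 5 (by omega)])
    (by rw [hf 7 (by omega), hm₀.parent u huo]) (by omega)
    (by have := hm₀.index_lt u huo; omega) (by omega) ?_
  intro m₁ a1 a4 a5 a6 a7
  refine prepare_wp (u := u) (w₀ := G.wait s(par u, u) 0) (w₁ := G.wait s(par u, u) 1) a4 a5
    (by rw [a7, hf 2 (by omega), hm₀.even u huo]) (by rw [a7, hf 3 (by omega), hm₀.odd u huo])
    rfl rfl rfl (by omega)
    (by rw [a7, ← hcost]; have := hcostle 0; omega)
    (by rw [a7, ← hcost]; have := hcostle 1; omega) ?_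
  intro m₂ b1 b2 b3 b4 b5 b6 b7
  rw [a7, ← hcost] at b6 b7
  have hw2 : ∀ q < 2, m₂.arr 8 (u + u + q) = G.wait s(par u, u) q := by
    intro q hq2
    interval_cases q
    · simpa using b3
    · exact b4
  have hc2 : ∀ q < 2, m₂.arr 9 q = G.returnCost (G.subtree o u) u q := by
    intro q hq2
    interval_cases q
    · exact b6
    · exact b7
  -- Costs and waiting times depend on the parity of the date only, so two table entries per vertex
  -- suffice.
  have hmod : ∀ p, p + G.branchCost o (par u) u p =
      p + G.wait s(par u, u) p + 1 + G.returnCost (G.subtree o u) u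
        ((p + G.wait s(par u, u) p + 1) % 2) +
      G.wait s(par u, u) ((p + G.wait s(par u, u) p + 1 + G.returnCost (G.subtree o u) u
        ((p + G.wait s(par u, u) p + 1) % 2)) % 2) + 1 := by
    intro p
    have := hP.branchCost_eq hT hchild p
    rw [(hP.typed_subtree hT u).mod (p + G.wait s(par u, u) p + 1)] at this
    rw [this]
    congr 2
    exact wait_eq_of_mod_eq hP.twoPeriodic hchild.1 (Nat.mod_mod _ 2).symm
  refine branchProg_wp (p := 0) (u := u) (b := G.branchCost o (par u) u 0) (by omega)
    (by rw [b1, a4]) hw2 hc2 (hmod 0) (by omega) (by have := hbrle 0; omega) ?_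
  intro m₃ c1 c2 c3
  refine branchProg_wp (p := 1) (u := u) (b := G.branchCost o (par u) u 1)
    (w := G.wait s(par u, u)) (c := G.returnCost (G.subtree o u) u) (by omega)
    (by rw [c1 4 (by decide), b1, a4]) (by rw [c2 8 (by decide)]; exact hw2)
    (by rw [c2 9 (by decide)]; exact hc2) (hmod 1) (by omega) (by have := hbrle 1; omega) ?_
  intro m₄ d1 d2 d3
  have hb4 : ∀ q < 2, m₄.arr 10 (u + u + q) = G.branchCost o (par u) u q := by
    intro q hq2
    rw [d3, c3]
    interval_cases q <;> simp
  have f4 : ∀ a, a ≠ 8 → a ≠ 9 → a ≠ 10 → m₄.arr a = m.arr a := fun a x8 x9 x10 => by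
    rw [d2 a x10, c2 a x10, b2 a x8 x9, a7]
  have r4 : ∀ x, x ≠ 7 → m₄.reg x = m₁.reg x := fun x x7 => by rw [d1 x x7, c1 x x7, b1]
  have f11 := f4 11 (by decide) (by decide) (by decide)
  have f12 := f4 12 (by decide) (by decide) (by decide)
  have f13 := f4 13 (by decide) (by decide) (by decide)
  refine accumulate_wp (u := u) (v := par u) (b := G.branchCost o (par u) u)
    (by rw [r4 4 (by decide), a4]) (by rw [r4 6 (by decide), a6]) hb4 (by omega)
    (by rw [f11]; have := hsum1 (par u); omega) (by rw [f12]; have := hsum2 (par u); omega)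
    (by rw [f13]; omega) ?_
  intro m₅ e1 e2 e11 e12 e13
  have f5 : ∀ a, a ≠ 8 → a ≠ 9 → a ≠ 10 → a ≠ 11 → a ≠ 12 → a ≠ 13 → m₅.arr a = m.arr a :=
    fun a x8 x9 x10 x11 x12 x13 => by rw [e2 a x11 x12 x13, f4 a x8 x9 x10]
  have fo : fastOdd (G.branchCost o (par u) u) < 2 := by unfold fastOdd; split_ifs <;> omega
  have f15 := f5 15 (by decide) (by decide) (by decide) (by decide) (by decide) (by decide)
  have f14 := f5 14 (by decide) (by decide) (by decide) (by decide) (by decide) (by decide)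
  refine push_wp (u := u) (v := par u) (b := G.branchCost o (par u) u)
    (by rw [e1, r4 4 (by decide), a4]) (by rw [e1, r4 6 (by decide), a6])
    (by rw [e2 10 (by decide) (by decide) (by decide)]; exact hb4) (by omega) (by omega)
    (by rw [f15]; have := (hch (par u) _ fo).head_le; omega) ?_
  intro m₆ g1 g2 g14 g15
  rw [f15] at g14 g15
  rw [f14] at g14
  refine nextIndex_wp (i := i) (by rw [g1 2 (by decide), e1, r4 2 (by decide), a1 2 (by omega), h2])
    (by omega) ?_
  have r6 : ∀ x, x < 4 → x ≠ 2 → (m₆.setReg 2 (i + 1)).reg x = m.reg x := fun x x4 x2 => by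
    rw [Mem.setReg_reg, if_neg x2, g1 x (by omega), e1, r4 x (by omega), a1 x (by omega)]
  have f6 : ∀ a, a ≠ 11 → a ≠ 12 → a ≠ 13 → a ≠ 14 → a ≠ 15 → m₆.arr a = m₄.arr a :=
    fun a x11 x12 x13 x14 x15 => by rw [g2 a x14 x15, e2 a x11 x12 x13]
  refine ⟨?_, ?_, ?_, ?_, ?_, ?_, ?_, ?_, ?_, ?_⟩
  · rw [r6 0 (by omega) (by omega), h0]
  · rw [r6 1 (by omega) (by omega), h1]
  · simp [Mem.setReg_reg]
  · intro a ha
    rw [Mem.setReg_arr, f6 a (by omega) (by omega) (by omega) (by omega) (by omega),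
      f4 a (by omega) (by omega) (by omega), hf a ha]
  · intro w hwt p hp
    rw [Mem.setReg_arr, f6 8 (by decide) (by decide) (by decide) (by decide) (by decide),
      d2 8 (by decide), c2 8 (by decide)]
    by_cases hwu : w = u
    · rw [hwu, hw2 p hp]
    · have : (w : ℕ) ≠ u := fun hh => hwu (Fin.ext hh)
      rw [b5 _ (by omega) (by omega), a7]
      exact hw w (((htake w).1 hwt).resolve_right hwu) p hp
  · intro w hwt p hp
    rw [Mem.setReg_arr, f6 10 (by decide) (by decide) (by decide) (by decide) (by decide)]
    by_cases hwu : w = u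
    · rw [hwu, hb4 p hp]
    · have : (w : ℕ) ≠ u := fun hh => hwu (Fin.ext hh)
      rw [d3, c3, Function.update_of_ne (by omega), Function.update_of_ne (by omega),
        b2 10 (by decide) (by decide), a7]
      exact hb w (((htake w).1 hwt).resolve_right hwu) p hp
  · intro v
    rw [Mem.setReg_arr, g2 11 (by decide) (by decide), e11, f11]
    by_cases hv : v = par u
    · rw [hv, Function.update_self, hsucc, List.map_append, List.sum_append, hx]
      simp
    · rw [Function.update_of_ne (fun hh => hv (Fin.ext hh)), hsucc' v hv, hx]
  · intro v
    rw [Mem.setReg_arr, g2 12 (by decide) (by decide), e12, f12]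
    by_cases hv : v = par u
    · rw [hv, Function.update_self, hsucc, List.map_append, List.sum_append, hy]
      simp
    · rw [Function.update_of_ne (fun hh => hv (Fin.ext hh)), hsucc' v hv, hy]
  · intro v
    rw [Mem.setReg_arr, g2 13 (by decide) (by decide), e13, f13]
    by_cases hv : v = par u
    · rw [hv, Function.update_self, hsucc, List.map_append, List.sum_append, hS]
      simp
    · rw [Function.update_of_ne (fun hh => hv (Fin.ext hh)), hsucc' v hv, hS]
  · intro v b hb2
    have hnot : ∀ v (b : ℕ), u ∉ ((kids par l i v).filter
        fun u => fastOdd (G.branchCost o v u) = b).reverse := fun v b hmem => by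
      rw [List.mem_reverse, List.mem_filter] at hmem
      exact hunot (mem_kids.1 hmem.1).1
    rw [Mem.setReg_arr, g14, g15]
    by_cases hv : v = par u
    · subst hv
      rw [hsucc, List.filter_append]
      by_cases hbo : fastOdd (G.branchCost o (par u) u) = b
      · rw [hbo, Function.update_self]
        simp only [List.filter_cons, hbo, decide_true, if_true, List.filter_nil,
          List.reverse_append, List.reverse_cons, List.reverse_nil, List.nil_append,
          List.cons_append]
        refine ⟨rfl, ?_⟩
        rw [Function.update_self]
        exact (hch (par u) b hb2).update (hnot _ _) _
      · rw [Function.update_of_ne (by omega)]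
        simp only [List.filter_cons, hbo, decide_false, Bool.false_eq_true, if_false,
          List.filter_nil, List.append_nil]
        exact (hch (par u) b hb2).update (hnot _ _) _
    · have : (v : ℕ) ≠ par u := fun hh => hv (Fin.ext hh)
      rw [Function.update_of_ne (by omega), hsucc' v hv]
      exact (hch v b hb2).update (hnot _ _) _

end RAM

/-! ### Costs without return, and the best last children. -/

namespace TVG

variable {V : Type*} {G : TVG V} {o : V}

theorem coverCost_le_returnCost {S : Set V} {r : V} {t : ℕ}
    (h : (G.returnCosts S r t).Nonempty) : G.coverCost S r t ≤ G.returnCost S r t := by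
  obtain ⟨J, h1, -, h3⟩ := exists_returnCost h
  exact Nat.sInf_le ⟨J, h1, h3⟩

/-- The form in which the program computes the date: back at `v` at date `q`, at the last child `u`
at date `r`, with tables indexed by parity. -/
theorem IsPeriodic.coverDate_eq [Finite V] (hP : G.IsPeriodic 2) (hT : G.graph.IsTree) {u v : V}
    (hu : u ∈ G.children o v) {t q r : ℕ} {L : List V} (hq : q = t + G.listCost o v t L)
    (hr : r = q + G.wait s(v, u) (q % 2) + 1) :
    G.coverDate o v t u L = r + G.coverCost (G.subtree o u) u (r % 2) := by
  rw [coverDate, ← hq, hP.branch_coverCost hT hu (hP.subtree_returnCosts_nonempty hT u),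
    hP.crossed_eq hu.1, wait_eq_of_mod_eq hP.twoPeriodic hu.1 (Nat.mod_mod q 2).symm, ← hr,
    coverCost_eq_of_mod_eq hP.twoPeriodic _ _ (Nat.mod_mod r 2).symm]

end TVG

namespace RAM

open TVG

theorem mem_kids_iff {n : ℕ} {G : TVG (Fin n)} {o : Fin n} {par : Fin n → Fin n}
    {l : List (Fin n)} (hq : Queue o par l) (hT : G.graph.IsTree) (hpar : G.IsParent o par)
    {u v : Fin n} : u ∈ kids par l (n - 1) v ↔ u ∈ G.children o v := by
  rw [mem_kids, List.take_of_length_le hq.length.le, hq.mem, hpar.mem_children_iff hT]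

/-- The memory holds the queue, the parents, the waiting times for the parent edges, the costs of
the branches, and for every vertex the summary of its branches and the two lists of its
children. -/
structure Costed {n : ℕ} (G : TVG (Fin n)) (o : Fin n) (par : Fin n → Fin n) (l : List (Fin n))
    (m : Mem) : Prop where
  size : m.reg 0 = n
  start : m.reg 1 = o
  list : ListIn (m.arr 6) l
  index_lt : ∀ u, u ≠ o → m.arr 5 u < n
  parent : ∀ u, u ≠ o → m.arr 7 u = par u
  wait : ∀ u, u ≠ o → ∀ p < 2, m.arr 8 (u + u + p) = G.wait s(par u, u) p
  branch : ∀ u, u ≠ o → ∀ p < 2, m.arr 10 (u + u + p) = G.branchCost o (par u) u p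
  even : ∀ v : Fin n, m.arr 11 v =
    ((kids par l (n - 1) v).map fun u => fastEven (G.branchCost o v u)).sum
  odd : ∀ v : Fin n, m.arr 12 v =
    ((kids par l (n - 1) v).map fun u => fastOdd (G.branchCost o v u)).sum
  low : ∀ v : Fin n, m.arr 13 v =
    ((kids par l (n - 1) v).map fun u => low (G.branchCost o v u)).sum
  chain : ∀ v : Fin n, ∀ b < 2, IsChain (m.arr 14) (m.arr 15 (v + v + b))
    ((kids par l (n - 1) v).filter fun u => fastOdd (G.branchCost o v u) = b).reverse
  zero : ∀ a i, 16 ≤ a → m.arr a i = 0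

theorem costLoop_runs {W n : ℕ} {G : TVG (Fin n)} {o : Fin n} {par : Fin n → Fin n}
    {l : List (Fin n)} {m : Mem} (hT : G.graph.IsTree) (hP : G.IsPeriodic 2)
    (hpar : G.IsParent o par) (hq : Queue o par l) (hm : Peeled G o par l m) (hW : 8 * n ≤ W) :
    Runs W (.loop moreEdges costBody) (m.setReg 2 0)
      ((n - 1) * (moreEdges.cost + 1 + costBody.time) + (moreEdges.cost + 1))
      (Costed G o par l) := by
  have hrun : Runs W (.loop moreEdges costBody) (m.setReg 2 0)
      ((n - 1) * (moreEdges.cost + 1 + costBody.time) + (moreEdges.cost + 1))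
      (CostInv G o par l m (n - 1)) := by
    refine Runs.loop (CostInv G o par l m) ?_ ?_ ?_
    · intro i hi m' hm'
      refine ⟨?_, costBody_runs hT hP hpar hq hm hW hi hm'⟩
      rw [moreEdges_eval hm'.size hm'.index, if_pos (by omega)]
      decide
    · intro m' hm'
      rw [moreEdges_eval hm'.size hm'.index, if_neg (by omega)]
    · refine ⟨?_, ?_, ?_, fun _ _ => rfl, ?_, ?_, ?_, ?_, ?_, ?_⟩
      · simpa [Mem.setReg_reg] using hm.size
      · simpa [Mem.setReg_reg] using hm.start
      · simp [Mem.setReg_reg]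
      · simp
      · simp
      · intro v; simp [Mem.setReg_arr, hm.zero, kids]
      · intro v; simp [Mem.setReg_arr, hm.zero, kids]
      · intro v; simp [Mem.setReg_arr, hm.zero, kids]
      · intro v b hb; simp [Mem.setReg_arr, hm.zero, kids, IsChain]
  refine hrun.mono le_rfl fun m' h => ?_
  have htake : ∀ u, u ≠ o → u ∈ l.take (n - 1) := fun u hu => by
    rw [List.take_of_length_le hq.length.le]
    exact (hq.mem u).2 hu
  refine ⟨h.size, h.start, ?_, ?_, ?_, fun u hu => h.wait u (htake u hu),
    fun u hu => h.branch u (htake u hu), h.even, h.odd, h.low, h.chain, ?_⟩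
  · rw [h.frame 6 (by omega)]; exact hm.list
  · rw [h.frame 5 (by omega)]; exact hm.index_lt
  · rw [h.frame 7 (by omega)]; exact hm.parent
  · intro a i ha
    rw [h.frame a (by omega), hm.zero a i (by omega)]

/-- The cost of the branches at the vertex in register `6`, except that through register `4`. -/
def removeBranch : Prog :=
  .seq (.setReg 8 (.sub (.arr 11 (.reg 6)) (.lt (.branch 0) (.branch 1)))) <|
  .seq (.setReg 9 (.sub (.arr 12 (.reg 6)) (.lt (.branch 1) (.branch 0)))) <|
  .setReg 10 (.sub (.arr 13 (.reg 6)) .low)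

/-- Register `7` ends up with the cost from a date of parity `p` if the branch of register `4` comes
last. For odd `p` the counts are passed in the opposite order, as in `waste_zero_swap`. -/
def candidate (p x y : ℕ) : Prog :=
  .seq (.setReg 7 (.add (.const p) (.add (.reg 10) (.waste (.reg x) (.reg y))))) <|
  .seq (.setReg 7 (.add (.add (.reg 7) (.arr 8 (.pair 4 (.parity (.reg 7))))) (.const 1))) <|
  .setReg 7 (.sub (.add (.reg 7) (.arr 16 (.pair 4 (.parity (.reg 7))))) (.const p))

/-- The sum of the two indicators serves as a disjunction. An entry `0` of array `17` means that
there is no candidate yet; the children are stored with one added. -/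
def improve (p : ℕ) : Prog :=
  .ite (.add (.eq (.arr 17 (.pair 6 (.const p))) (.const 0))
      (.lt (.reg 7) (.arr 16 (.pair 6 (.const p)))))
    (.seq (.setArr 16 (.pair 6 (.const p)) (.reg 7))
      (.setArr 17 (.pair 6 (.const p)) (.add (.reg 4) (.const 1))))
    .skip

/-- The summary without one branch is obtained by subtraction, so each child is tried as the last
one of its parent in constant time. -/
def coverBody : Prog :=
  .seq fetch <| .seq removeBranch <|
  .seq (candidate 0 8 9) <| .seq (improve 0) <|
  .seq (candidate 1 9 8) <| .seq (improve 1) nextIndex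

theorem removeBranch_wp {W u v x y s : ℕ} {b : ℕ → ℕ} {m : Mem} {Q : Mem → Prop}
    (h4 : m.reg 4 = u) (h6 : m.reg 6 = v) (hb : ∀ q < 2, m.arr 10 (u + u + q) = b q)
    (hx : m.arr 11 v = fastEven b + x) (hy : m.arr 12 v = fastOdd b + y)
    (hs : m.arr 13 v = low b + s) (hxW : x ≤ W) (hyW : y ≤ W) (hsW : s ≤ W)
    (hQ : ∀ m', (∀ z, z < 8 → m'.reg z = m.reg z) → m'.reg 8 = x → m'.reg 9 = y →
      m'.reg 10 = s → m'.arr = m.arr → Q m') :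
    removeBranch.wp W Q m := by
  have hb0 : m.arr 10 (u + u) = b 0 := hb 0 (by omega)
  have hb1 := hb 1 (by omega)
  have g1 : m.arr 11 v - fastEven b = x := by omega
  have g2 : m.arr 12 v - fastOdd b = y := by omega
  have g3 : m.arr 13 v - low b = s := by omega
  have g4 : b 0 - (b 0 - b 1) = low b := by unfold low; omega
  refine wp_setReg (w := x) ?_ hxW ?_
  · rw [← g1]
    simp [Expr.branch, Expr.pair_eval, Expr.eval, h4, h6, hb0, hb1, fastEven]
  refine wp_setReg (w := y) ?_ hyW ?_
  · rw [← g2]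
    simp [Expr.branch, Expr.pair_eval, Expr.eval, Mem.setReg_reg, Mem.setReg_arr, h4, h6, hb0, hb1,
      fastOdd]
  refine wp_setReg (w := s) ?_ hsW ?_
  · rw [← g3, ← g4]
    simp [Expr.low, Expr.branch, Expr.pair_eval, Expr.eval, Mem.setReg_reg, Mem.setReg_arr, h4, h6,
      hb0, hb1]
  refine hQ _ ?_ ?_ ?_ ?_ ?_
  · intro z hz
    have z8 : z ≠ 8 := by omega
    have z9 : z ≠ 9 := by omega
    have z10 : z ≠ 10 := by omega
    simp [Mem.setReg_reg, z8, z9, z10]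
  · simp [Mem.setReg_reg]
  · simp [Mem.setReg_reg]
  · simp [Mem.setReg_reg]
  · simp [Mem.setReg_arr]

theorem candidate_wp {W u p x y e q r c : ℕ} {w d : ℕ → ℕ} {m : Mem} {Q : Mem → Prop}
    (h4 : m.reg 4 = u) (he : m.reg 10 + TVG.waste (m.reg x) (m.reg y) 0 = e)
    (hw : ∀ q < 2, m.arr 8 (u + u + q) = w q) (hd : ∀ q < 2, m.arr 16 (u + u + q) = d q)
    (hq : q = p + e) (hr : r = q + w (q % 2) + 1) (hc : p + c = r + d (r % 2))
    (hcW : p + c ≤ W)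
    (hQ : ∀ m', (∀ z, z ≠ 7 → m'.reg z = m.reg z) → m'.reg 7 = c → m'.arr = m.arr → Q m') :
    (candidate p x y).wp W Q m := by
  refine wp_setReg (w := q) ?_ (by omega) ?_
  · rw [hq, ← he]
    simp [Expr.waste_eval, Expr.eval]
  refine wp_setReg (w := r) ?_ (by omega) ?_
  · rw [hr]
    simp [Expr.pair_eval, Expr.eval, Mem.setReg_reg, Mem.setReg_arr, h4,
      hw _ (Nat.mod_lt q two_pos)]
  refine wp_setReg (w := c) ?_ (by omega) ?_
  · simp only [Expr.pair_eval, Expr.eval, Mem.setReg_reg, Mem.setReg_arr, if_true,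
      show ¬ (4 = 7) by decide, if_false, h4, hd _ (Nat.mod_lt r two_pos)]
    omega
  refine hQ _ ?_ ?_ ?_
  · intro z hz
    simp [Mem.setReg_reg, hz]
  · simp [Mem.setReg_reg]
  · simp [Mem.setReg_arr]

theorem improve_wp {W u v c p : ℕ} {m : Mem} {Q : Mem → Prop} (h4 : m.reg 4 = u)
    (h6 : m.reg 6 = v) (h7 : m.reg 7 = c) (hvW : v + v + p ≤ W) (hcW : c ≤ W) (huW : u < W)
    (hyes : m.arr 17 (v + v + p) = 0 ∨ c < m.arr 16 (v + v + p) →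
      ∀ m', m'.reg = m.reg → (∀ a, a ≠ 16 → a ≠ 17 → m'.arr a = m.arr a) →
        m'.arr 16 = Function.update (m.arr 16) (v + v + p) c →
        m'.arr 17 = Function.update (m.arr 17) (v + v + p) (u + 1) → Q m')
    (hno : m.arr 17 (v + v + p) ≠ 0 → m.arr 16 (v + v + p) ≤ c → Q m) :
    (improve p).wp W Q m := by
  have heval : ∀ a b : ℕ, (if a = 0 then 1 else 0) + (if c < b then 1 else 0) ≠ 0 ↔
      a = 0 ∨ c < b := by
    intro a b; split_ifs <;> simp_all
  refine ⟨fun hcond => ?_, fun hcond => ?_⟩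
  · simp only [Expr.pair_eval, Expr.eval, h6, h7] at hcond
    rw [heval] at hcond
    refine wp_setArr (j := v + v + p) (w := c) (by simp [Expr.pair_eval, Expr.eval, h6])
      (by simp [Expr.eval, h7]) hvW hcW ?_
    refine wp_setArr (j := v + v + p) (w := u + 1)
      (by simp [Expr.pair_eval, Expr.eval, Mem.setArr_reg, h6])
      (by simp [Expr.eval, Mem.setArr_reg, h4]) hvW huW ?_
    refine hyes hcond _ ?_ ?_ ?_ ?_
    · simp [Mem.setArr_reg]
    · intro a a1 a2
      simp [Mem.setArr_arr, a1, a2]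
    · simp [Mem.setArr_arr]
    · simp [Mem.setArr_arr]
  · simp only [Expr.pair_eval, Expr.eval, h6, h7] at hcond
    have := mt (heval (m.arr 17 (v + v + p)) (m.arr 16 (v + v + p))).2 (not_not.2 hcond)
    rw [not_or, not_lt] at this
    exact hno this.1 this.2

/-- The date at which everything below `v` is covered, if the branch through `u` is the last
one. -/
noncomputable def lastDate {n : ℕ} (G : TVG (Fin n)) (o : Fin n) (par : Fin n → Fin n)
    (l : List (Fin n)) (v : Fin n) (p : ℕ) (u : Fin n) : ℕ :=
  G.coverDate o v p u ((kids par l (n - 1) v).erase u)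

/-- The entries `d` and `b` of the arrays are the least cost, and one more than the best last
child, among the children of `v` in the list `L`. -/
def IsBest {n : ℕ} (G : TVG (Fin n)) (o : Fin n) (par : Fin n → Fin n) (l : List (Fin n))
    (L : List (Fin n)) (v : Fin n) (p d b : ℕ) : Prop :=
  (L = [] ∧ b = 0 ∧ d = 0) ∨ ∃ u ∈ L, b = u + 1 ∧ p + d = lastDate G o par l v p u ∧
    ∀ u' ∈ L, lastDate G o par l v p u ≤ lastDate G o par l v p u'

structure CoverInv {n : ℕ} (G : TVG (Fin n)) (o : Fin n) (par : Fin n → Fin n) (l : List (Fin n))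
    (m₀ : Mem) (i : ℕ) (m : Mem) : Prop where
  size : m.reg 0 = n
  start : m.reg 1 = o
  index : m.reg 2 = i
  frame : ∀ a, a ≠ 16 → a ≠ 17 → m.arr a = m₀.arr a
  best : ∀ v : Fin n, ∀ p < 2, IsBest G o par l (kids par l i v) v p (m.arr 16 (v + v + p))
    (m.arr 17 (v + v + p))

section Best

variable {n : ℕ} {G : TVG (Fin n)} {o : Fin n} {par : Fin n → Fin n} {l : List (Fin n)}

theorem Queue.perm_cons_erase (hq : Queue o par l) (hT : G.graph.IsTree) (hpar : G.IsParent o par)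
    {u v : Fin n} (hu : u ∈ G.children o v) :
    (kids par l (n - 1) v).Perm (u :: (kids par l (n - 1) v).erase u) :=
  List.perm_cons_erase ((mem_kids_iff hq hT hpar).2 hu)

theorem Queue.lastDate_ge (hq : Queue o par l) (hT : G.graph.IsTree) (hP : G.IsPeriodic 2)
    (hpar : G.IsParent o par) {u v : Fin n} (hu : u ∈ G.children o v) (p : ℕ) :
    p + G.coverCost (G.subtree o v) v p ≤ lastDate G o par l v p u :=
  hP.add_coverCost_le_coverDate hT (fun w => by
    rw [← (hq.perm_cons_erase hT hpar hu).mem_iff, mem_kids_iff hq hT hpar]) p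

theorem Queue.exists_lastDate_eq (hq : Queue o par l) (hT : G.graph.IsTree) (hP : G.IsPeriodic 2)
    (hpar : G.IsParent o par) {v : Fin n} (hv : (G.children o v).Nonempty) (p : ℕ) :
    ∃ u ∈ G.children o v, p + G.coverCost (G.subtree o v) v p = lastDate G o par l v p u := by
  obtain ⟨u, L, h1, h2, h3⟩ := hP.exists_coverDate_eq hT hv p
  have hu : u ∈ G.children o v := (h2 u).1 (by simp)
  refine ⟨u, hu, ?_⟩
  have hperm : L.Perm ((kids par l (n - 1) v).erase u) := by
    have : (u :: L).Perm (u :: (kids par l (n - 1) v).erase u) := by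
      refine List.Perm.trans ?_ (hq.perm_cons_erase hT hpar hu)
      rw [List.perm_ext_iff_of_nodup h1 (hq.nodup_kids _ _)]
      intro w
      rw [h2, mem_kids_iff hq hT hpar]
    exact this.cons_inv
  rw [h3, lastDate, coverDate, coverDate, listCost_perm hperm]

/-- Every child gives an upper bound for the optimum and some child attains it. Without children,
the default entry `0` is the correct cost. -/
theorem Queue.isBest_cost (hq : Queue o par l) (hT : G.graph.IsTree) (hP : G.IsPeriodic 2)
    (hpar : G.IsParent o par) {v : Fin n} {L : List (Fin n)} (hL : ∀ u, u ∈ L ↔ u ∈ G.children o v)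
    {p d b : ℕ} (h : IsBest G o par l L v p d b) : d = G.coverCost (G.subtree o v) v p := by
  rcases h with ⟨rfl, -, rfl⟩ | ⟨u, hu, -, h1, h2⟩
  · rw [coverCost_leaf hT]
    ext u
    rw [← hL]
    simp
  · obtain ⟨u', hu', h3⟩ := hq.exists_lastDate_eq hT hP hpar ⟨u, (hL u).1 hu⟩ p
    have h4 := h2 u' ((hL u').2 hu')
    have h5 := hq.lastDate_ge hT hP hpar ((hL u).1 hu) p
    omega

theorem IsBest.add_of_lt {L : List (Fin n)} {u v : Fin n} {p c d b : ℕ}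
    (h : IsBest G o par l L v p d b) (hc : p + c = lastDate G o par l v p u) (hlt : b = 0 ∨ c < d) :
    IsBest G o par l (L ++ [u]) v p c (u + 1) := by
  refine Or.inr ⟨u, by simp, rfl, hc, fun u' hu' => ?_⟩
  rw [List.mem_append, List.mem_singleton] at hu'
  rcases hu' with hu' | rfl
  · rcases h with ⟨rfl, -, -⟩ | ⟨w, -, h2, h3, h4⟩
    · simp at hu'
    · have := h4 u' hu'
      omega
  · exact le_rfl

theorem IsBest.add_of_le {L : List (Fin n)} {u v : Fin n} {p c d b : ℕ}
    (h : IsBest G o par l L v p d b) (hc : p + c = lastDate G o par l v p u) (hb : b ≠ 0)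
    (hle : d ≤ c) : IsBest G o par l (L ++ [u]) v p d b := by
  rcases h with ⟨-, h1, -⟩ | ⟨w, h1, h2, h3, h4⟩
  · exact absurd h1 hb
  · refine Or.inr ⟨w, by simp [h1], h2, h3, fun u' hu' => ?_⟩
    rw [List.mem_append, List.mem_singleton] at hu'
    rcases hu' with hu' | rfl
    · exact h4 u' hu'
    · omega

end Best

theorem coverBody_runs {W n i : ℕ} {G : TVG (Fin n)} {o : Fin n} {par : Fin n → Fin n}
    {l : List (Fin n)} {m₀ m : Mem} (hT : G.graph.IsTree) (hP : G.IsPeriodic 2)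
    (hpar : G.IsParent o par) (hq : Queue o par l) (hm₀ : Costed G o par l m₀)
    (hW : 16 * n ≤ W) (hi : i < n - 1) (h : CoverInv G o par l m₀ i m) :
    Runs W coverBody m coverBody.time (CoverInv G o par l m₀ (i + 1)) := by
  have hil : i < l.length := by rw [hq.length]; exact hi
  obtain ⟨h0, h1, h2, hf, hbest⟩ := h
  obtain ⟨u, hu⟩ : ∃ u, u = l[i] := ⟨_, rfl⟩
  have huo : u ≠ o := hu ▸ hq.ne_root hil
  have hchild := hpar u huo
  have hun := u.2
  have hpn := (par u).2
  have hneu : par u ≠ u := hchild.1.ne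
  have hneu' : (par u : ℕ) ≠ u := fun hh => hneu (Fin.ext hh)
  have hkids : ∀ w, w ∈ kids par l i u ↔ w ∈ G.children o u := fun w => by
    rw [hu]; exact hq.mem_kids_getElem hT hpar hil w
  have hsucc : kids par l (i + 1) (par u) = kids par l i (par u) ++ [u] := by
    rw [hu]; exact kids_succ_self hil
  have hsucc' : ∀ v, v ≠ par u → kids par l (i + 1) v = kids par l i v := fun v hv =>
    kids_succ_of_ne hil (hu ▸ hv)
  -- The children of `u` precede it in the queue, so the minimum stored for `u` is final.
  have hd : ∀ q < 2, m.arr 16 (u + u + q) = G.coverCost (G.subtree o u) u q := fun q hq2 =>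
    hq.isBest_cost hT hP hpar hkids (hbest u q hq2)
  -- the branches other than that of `u`
  obtain ⟨L, hL⟩ : ∃ L, L = (kids par l (n - 1) (par u)).erase u := ⟨_, rfl⟩
  have hperm : (kids par l (n - 1) (par u)).Perm (u :: L) := by
    rw [hL]; exact hq.perm_cons_erase hT hpar hchild
  have hLnd : L.Nodup := ((hperm.nodup_iff.1 (hq.nodup_kids _ _))).of_cons
  have hLc : ∀ w ∈ L, w ∈ G.children o (par u) := fun w hw =>
    (mem_kids_iff hq hT hpar).1 (hperm.mem_iff.2 (List.mem_cons_of_mem _ hw))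
  have hLlen : L.length ≤ n := by simpa using hLnd.length_le_card
  have hlist : ∀ t, G.listCost o (par u) t L + 4 ≤ 4 * n := fun t =>
    (hP.listCost_le hT hLnd hLc t).trans (by have := ncard_subtree_le G o (par u); omega)
  -- One `4 * n` bounds the branches covered with return, the other one the last branch.
  have hlast : ∀ p < 2, lastDate G o par l (par u) p u ≤ 8 * n := by
    intro p hp
    rw [lastDate, ← hL, coverDate]
    have h1 := hlist p
    have h2 := coverCost_le_returnCost (hP.branch_nonempty hT hchild (p + G.listCost o (par u) p L))
    have h3 := hP.branchCost_le hT hchild (p + G.listCost o (par u) p L)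
    have h4 := ncard_subtree_le G o u
    rw [branchCost] at h3
    omega
  have hsub : ∀ p < 2, ∃ c, p + c = lastDate G o par l (par u) p u := fun p hp => by
    have : p ≤ lastDate G o par l (par u) p u := by
      rw [lastDate, coverDate]; omega
    exact ⟨lastDate G o par l (par u) p u - p, by omega⟩
  obtain ⟨c₀, hc₀⟩ := hsub 0 (by omega)
  obtain ⟨c₁, hc₁⟩ := hsub 1 (by omega)
  have hdate : ∀ p, lastDate G o par l (par u) p u =
      p + G.listCost o (par u) p L + G.wait s(par u, u) ((p + G.listCost o (par u) p L) % 2) + 1 +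
      G.coverCost (G.subtree o u) u ((p + G.listCost o (par u) p L +
        G.wait s(par u, u) ((p + G.listCost o (par u) p L) % 2) + 1) % 2) := fun p => by
    rw [lastDate, ← hL]
    exact hP.coverDate_eq hT hchild rfl rfl
  have hb0 := hlast 0 (by omega)
  have hb1 := hlast 1 (by omega)
  apply Prog.runs_of_wp
  refine fetch_wp (u := u) (j := m₀.arr 5 u) (p := par u) h2
    (by rw [hf 6 (by omega) (by omega), hm₀.list i hil, hu])
    (by rw [hf 5 (by omega) (by omega)])
    (by rw [hf 7 (by omega) (by omega), hm₀.parent u huo]) (by omega)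
    (by have := hm₀.index_lt u huo; omega) (by omega) ?_
  intro m₁ a1 a4 a5 a6 a7
  refine removeBranch_wp (u := u) (v := par u) (b := G.branchCost o (par u) u)
    (x := (L.map fun w => fastEven (G.branchCost o (par u) w)).sum)
    (y := (L.map fun w => fastOdd (G.branchCost o (par u) w)).sum)
    (s := (L.map fun w => low (G.branchCost o (par u) w)).sum) a4 a6
    (by rw [a7, hf 10 (by omega) (by omega)]; exact hm₀.branch u huo)
    (by rw [a7, hf 11 (by omega) (by omega), hm₀.even, (hperm.map _).sum_eq, List.map_cons,
          List.sum_cons])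
    (by rw [a7, hf 12 (by omega) (by omega), hm₀.odd, (hperm.map _).sum_eq, List.map_cons,
          List.sum_cons])
    (by rw [a7, hf 13 (by omega) (by omega), hm₀.low, (hperm.map _).sum_eq, List.map_cons,
          List.sum_cons])
    ((sum_le_length fun w => by unfold fastEven; split_ifs <;> omega).trans (by omega))
    ((sum_le_length fun w => by unfold fastOdd; split_ifs <;> omega).trans (by omega))
    (by have := hlist 0; rw [listCost] at this; omega) ?_
  intro m₂ b1 b8 b9 b10 b11
  rw [a7] at b11
  have hw2 : ∀ q < 2, m₂.arr 8 (u + u + q) = G.wait s(par u, u) q := by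
    rw [b11, hf 8 (by omega) (by omega)]; exact hm₀.wait u huo
  refine candidate_wp (u := u) (e := G.listCost o (par u) 0 L) (c := c₀)
    (by rw [b1 4 (by omega), a4]) (by rw [b8, b9, b10]; rfl) hw2 (by rw [b11]; exact hd) rfl rfl
    (hc₀.trans (hdate 0)) (by omega) ?_
  intro m₃ d1 d7 d8
  rw [b11] at d8
  have r3 : ∀ x, x < 7 → m₃.reg x = m₁.reg x := fun x hx => by
    rw [d1 x (by omega), b1 x (by omega)]
  -- the first improvement leads to a memory with the new best values for even dates
  suffices hnext : ∀ m₄ : Mem, m₄.reg = m₃.reg → (∀ a, a ≠ 16 → a ≠ 17 → m₄.arr a = m.arr a) →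
      (∀ k : ℕ, k ≠ (par u : ℕ) + par u → m₄.arr 16 k = m.arr 16 k ∧ m₄.arr 17 k = m.arr 17 k) →
      IsBest G o par l (kids par l i (par u) ++ [u]) (par u) 0 (m₄.arr 16 (par u + par u))
        (m₄.arr 17 (par u + par u)) →
      (Prog.seq (candidate 1 9 8) (.seq (improve 1) nextIndex)).wp W
        (CoverInv G o par l m₀ (i + 1)) m₄ by
    have hold := hbest (par u) 0 (by omega)
    refine improve_wp (u := u) (v := par u) (p := 0) (c := c₀) (by rw [r3 4 (by omega), a4])
      (by rw [r3 6 (by omega), a6]) d7 (by omega) (by omega) (by omega) ?_ ?_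
    · intro hcond m' e1 e2 e16 e17
      rw [d8] at e2 e16 e17 hcond
      refine hnext m' e1 e2 ?_ ?_
      · intro k hk
        rw [e16, e17, Function.update_of_ne (by omega), Function.update_of_ne (by omega)]
        exact ⟨rfl, rfl⟩
      · rw [e16, e17, add_zero, Function.update_self, Function.update_self]
        exact hold.add_of_lt hc₀ hcond
    · intro g1 g2
      rw [d8] at g1 g2
      refine hnext m₃ rfl (fun a _ _ => by rw [d8]) (fun k _ => by rw [d8]; exact ⟨rfl, rfl⟩) ?_
      rw [d8]
      exact hold.add_of_le hc₀ g1 g2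
  intro m₄ e1 e2 e3 e4
  -- The first improvement has changed entries of the parent only, which differs from `u`.
  have hd4 : ∀ q < 2, m₄.arr 16 (u + u + q) = G.coverCost (G.subtree o u) u q := fun q hq2 => by
    rw [(e3 _ (by omega)).1, hd q hq2]
  refine candidate_wp (u := u) (e := G.listCost o (par u) 1 L) (c := c₁)
    (by rw [e1, r3 4 (by omega), a4])
    (by rw [e1, d1 8 (by omega), d1 9 (by omega), d1 10 (by omega), b8, b9, b10]; rfl)
    (by rw [e2 8 (by omega) (by omega), ← b11]; exact hw2) hd4 rfl rfl
    (hc₁.trans (hdate 1)) (by omega) ?_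
  intro m₅ f1 f7 f8
  have r5 : ∀ x, x < 7 → m₅.reg x = m₁.reg x := fun x hx => by
    rw [f1 x (by omega), e1, r3 x hx]
  suffices hfin : ∀ m₆ : Mem, m₆.reg = m₅.reg → (∀ a, a ≠ 16 → a ≠ 17 → m₆.arr a = m.arr a) →
      (∀ k : ℕ, k ≠ (par u : ℕ) + par u + 1 → m₆.arr 16 k = m₄.arr 16 k ∧ m₆.arr 17 k = m₄.arr 17 k) →
      IsBest G o par l (kids par l i (par u) ++ [u]) (par u) 1 (m₆.arr 16 (par u + par u + 1))
        (m₆.arr 17 (par u + par u + 1)) →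
      nextIndex.wp W (CoverInv G o par l m₀ (i + 1)) m₆ by
    have hold := hbest (par u) 1 (by omega)
    rw [← (e3 ((par u : ℕ) + par u + 1) (by omega)).1, ← (e3 ((par u : ℕ) + par u + 1) (by omega)).2] at hold
    refine improve_wp (u := u) (v := par u) (p := 1) (c := c₁) (by rw [r5 4 (by omega), a4])
      (by rw [r5 6 (by omega), a6]) f7 (by omega) (by omega) (by omega) ?_ ?_
    · intro hcond m' g1 g2 g16 g17
      rw [f8] at g2 g16 g17 hcond
      refine hfin m' g1 (fun a x y => by rw [g2 a x y, e2 a x y]) ?_ ?_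
      · intro k hk
        rw [g16, g17, Function.update_of_ne hk, Function.update_of_ne hk]
        exact ⟨rfl, rfl⟩
      · rw [g16, g17, Function.update_self, Function.update_self]
        exact hold.add_of_lt hc₁ hcond
    · intro g1 g2
      rw [f8] at g1 g2
      refine hfin m₅ rfl (fun a x y => by rw [f8, e2 a x y])
        (fun k _ => by rw [f8]; exact ⟨rfl, rfl⟩) ?_
      rw [f8]
      exact hold.add_of_le hc₁ g1 g2
  intro m₆ g1 g2 g3 g4
  have r6 : ∀ x, x < 4 → m₆.reg x = m.reg x := fun x hx => by
    rw [g1, r5 x (by omega), a1 x (by omega)]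
  refine nextIndex_wp (i := i) (by rw [r6 2 (by omega), h2]) (by omega) ⟨?_, ?_, ?_, ?_, ?_⟩
  · simpa [Mem.setReg_reg, r6] using h0
  · simpa [Mem.setReg_reg, r6] using h1
  · simp [Mem.setReg_reg]
  · intro a a1 a2
    rw [Mem.setReg_arr, g2 a a1 a2, hf a a1 a2]
  · intro v p hp
    rw [Mem.setReg_arr]
    by_cases hv : v = par u
    · subst hv
      rw [hsucc]
      interval_cases p
      · rw [add_zero, (g3 _ (by omega)).1, (g3 _ (by omega)).2]
        exact e4
      · exact g4
    · have hv' : (v : ℕ) ≠ par u := fun hh => hv (Fin.ext hh)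
      rw [hsucc' v hv, (g3 _ (by omega)).1, (g3 _ (by omega)).2, (e3 _ (by omega)).1,
        (e3 _ (by omega)).2]
      exact hbest v p hp

/-- The memory holds, in addition, the best last children. -/
structure Covered {n : ℕ} (G : TVG (Fin n)) (o : Fin n) (par : Fin n → Fin n) (l : List (Fin n))
    (m₀ m : Mem) : Prop where
  start : m.reg 1 = o
  frame : ∀ a, a ≠ 16 → a ≠ 17 → m.arr a = m₀.arr a
  best : ∀ v : Fin n, ∀ p < 2, IsBest G o par l (kids par l (n - 1) v) v p (m.arr 16 (v + v + p))
    (m.arr 17 (v + v + p))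

theorem coverLoop_runs {W n : ℕ} {G : TVG (Fin n)} {o : Fin n} {par : Fin n → Fin n}
    {l : List (Fin n)} {m : Mem} (hT : G.graph.IsTree) (hP : G.IsPeriodic 2)
    (hpar : G.IsParent o par) (hq : Queue o par l) (hm : Costed G o par l m) (hW : 16 * n ≤ W) :
    Runs W (.loop moreEdges coverBody) (m.setReg 2 0)
      ((n - 1) * (moreEdges.cost + 1 + coverBody.time) + (moreEdges.cost + 1))
      (Covered G o par l m) := by
  have hrun : Runs W (.loop moreEdges coverBody) (m.setReg 2 0)
      ((n - 1) * (moreEdges.cost + 1 + coverBody.time) + (moreEdges.cost + 1))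
      (CoverInv G o par l m (n - 1)) := by
    refine Runs.loop (CoverInv G o par l m) ?_ ?_ ?_
    · intro i hi m' hm'
      refine ⟨?_, coverBody_runs hT hP hpar hq hm hW hi hm'⟩
      rw [moreEdges_eval hm'.size hm'.index, if_pos (by omega)]
      decide
    · intro m' hm'
      rw [moreEdges_eval hm'.size hm'.index, if_neg (by omega)]
    · refine ⟨?_, ?_, ?_, fun _ _ _ => rfl, ?_⟩
      · simpa [Mem.setReg_reg] using hm.size
      · simpa [Mem.setReg_reg] using hm.start
      · simp [Mem.setReg_reg]
      · intro v p hp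
        left
        simp [Mem.setReg_arr, hm.zero, kids]
  exact hrun.mono le_rfl fun m' h => ⟨h.start, h.frame, h.best⟩

end RAM

/-! ### The greedy tour of an abstract agent. -/

namespace TVG

variable {n : ℕ} {G : TVG (Fin n)} {o : Fin n}

/-- The state of an agent on a tour: its position, the date, the lists of children still to be
served, sorted by type, the vertex whose subtree contains all that is left, one more than the child
of that vertex to be served last (or `0`), and the journey so far. -/
structure Agent (n : ℕ) where
  cur : Fin n
  date : ℕ
  todo : Fin n → ℕ → List (Fin n)
  front : Fin n
  last : ℕ
  out : List (Fin n × ℕ)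

namespace Agent

/-- The list from which the next child is taken. -/
def side (c : Agent n) : ℕ := if c.todo c.cur (c.date % 2) = [] then 1 - c.date % 2 else c.date % 2

def pop (c : Agent n) (L : List (Fin n)) : Agent n :=
  { c with todo := fun w b => if w = c.cur ∧ b = c.side then L else c.todo w b }

noncomputable def move (G : TVG (Fin n)) (c : Agent n) (u : Fin n) : Agent n :=
  { c with
    cur := u
    date := c.date + G.wait s(c.cur, u) c.date + 1
    out := c.out ++ [(u, c.date + G.wait s(c.cur, u) c.date)] }

/-- All that is left lies below the present vertex, which becomes the new front; its last child is
chosen by the parity of the date. -/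
def settle (c : Agent n) (best : Fin n → ℕ → ℕ) : Agent n :=
  { c with front := c.cur, last := best c.cur (c.date % 2) }

/-- The children of `w` still to be served. -/
def rest (c : Agent n) (w : Fin n) : List (Fin n) := c.todo w 0 ++ c.todo w 1

/-- The next action of the agent. -/
inductive Step (G : TVG (Fin n)) (o : Fin n) (best : Fin n → ℕ → ℕ) : Agent n → Agent n → Prop
  | skip (c : Agent n) (u : Fin n) (L : List (Fin n)) : c.todo c.cur c.side = u :: L →
      (u : ℕ) + 1 = c.last → Step G o best c (c.pop L)
  | down (c : Agent n) (u : Fin n) (L : List (Fin n)) : c.todo c.cur c.side = u :: L →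
      (u : ℕ) + 1 ≠ c.last → u ∈ G.children o c.cur → Step G o best c ((c.pop L).move G u)
  | up (c : Agent n) (v : Fin n) : c.todo c.cur c.side = [] → c.cur ≠ c.front →
      c.cur ∈ G.children o v → Step G o best c (c.move G v)
  | enter (c : Agent n) (u : Fin n) : c.todo c.cur c.side = [] → c.cur = c.front →
      c.last = u + 1 → u ∈ G.children o c.cur → Step G o best c ((c.move G u).settle best)

inductive Steps (G : TVG (Fin n)) (o : Fin n) (best : Fin n → ℕ → ℕ) :
    ℕ → Agent n → Agent n → Prop
  | refl (c : Agent n) : Steps G o best 0 c c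
  | head {c c' c'' : Agent n} {k : ℕ} : Step G o best c c' → Steps G o best k c' c'' →
      Steps G o best (k + 1) c c''

/-- The tour is complete. -/
structure Halted (c : Agent n) : Prop where
  todo : c.todo c.cur c.side = []
  cur : c.cur = c.front
  last : c.last = 0

/-- The journey so far is one from `o` at date `0` to the present position and date. -/
structure Sound (G : TVG (Fin n)) (o : Fin n) (c : Agent n) : Prop where
  journey : G.IsJourney o 0 c.out
  cur : endpoint o c.out = c.cur
  date : arrival 0 c.out = c.date
  length : c.out.length ≤ c.date

/-- The children left at `w` are sorted by type. -/
structure Sorted (G : TVG (Fin n)) (o : Fin n) (c : Agent n) (w : Fin n) : Prop where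
  nodup : (c.rest w).Nodup
  children : ∀ u ∈ c.rest w, u ∈ G.children o w
  type : ∀ b < 2, ∀ u ∈ c.todo w b, fastOdd (G.branchCost o w u) = b

/-- All children of `w` are left. -/
structure Full (G : TVG (Fin n)) (o : Fin n) (c : Agent n) (w : Fin n) : Prop
    extends Sorted G o c w where
  complete : ∀ u ∈ G.children o w, u ∈ c.rest w

variable {best : Fin n → ℕ → ℕ} {c c' c'' : Agent n}

theorem Steps.trans {k l : ℕ} (h : Steps G o best k c c') (h' : Steps G o best l c' c'') :
    Steps G o best (k + l) c c'' := by
  induction h with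
  | refl c => rwa [Nat.zero_add]
  | head h1 _ ih => rw [Nat.add_right_comm]; exact .head h1 (ih h')

theorem Step.steps (h : Step G o best c c') : Steps G o best 1 c c' := .head h (.refl c')

theorem Sound.move (hP : G.IsPeriodic 2) (h : Sound G o c) {u : Fin n}
    (hu : G.graph.Adj c.cur u) : Sound G o (c.move G u) := by
  obtain ⟨h1, h2, h3, h4⟩ := h
  refine ⟨isJourney_append.2 ⟨h1, ?_⟩, ?_, ?_, ?_⟩
  · rw [h2, h3]
    exact ⟨hu, hP.present_add_wait hu _, Nat.le_add_right _ _, trivial⟩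
  · simp [Agent.move, endpoint_append, endpoint]
  · simp [Agent.move, arrival_append, arrival]
  · simp [Agent.move]
    omega

theorem Sound.pop (h : Sound G o c) (L : List (Fin n)) : Sound G o (c.pop L) :=
  ⟨h.journey, h.cur, h.date, h.length⟩

theorem Step.sound (hP : G.IsPeriodic 2) (hs : Step G o best c c') (h : Sound G o c) :
    Sound G o c' := by
  cases hs with
  | skip u L _ _ => exact h.pop L
  | down u L _ _ hu => exact (h.pop L).move hP hu.1
  | up v _ _ hv => exact h.move hP hv.1.symm
  | enter u _ _ _ hu =>
    have := h.move hP hu.1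
    exact ⟨this.journey, this.cur, this.date, this.length⟩

theorem Steps.sound (hP : G.IsPeriodic 2) {k : ℕ} (hs : Steps G o best k c c')
    (h : Sound G o c) : Sound G o c' := by
  induction hs with
  | refl c => exact h
  | head h1 _ ih => exact ih (h1.sound hP h)

theorem Step.date_le (hs : Step G o best c c') : c.date ≤ c'.date := by
  cases hs <;> simp only [Agent.move, Agent.pop, Agent.settle] <;> omega

theorem Steps.date_le {k : ℕ} (hs : Steps G o best k c c') : c.date ≤ c'.date := by
  induction hs with
  | refl c => exact le_rfl
  | head h1 _ ih => exact h1.date_le.trans ih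

theorem Step.out_prefix (hs : Step G o best c c') : c.out <+: c'.out := by
  cases hs <;> simp [Agent.move, Agent.pop, Agent.settle]

theorem Steps.out_prefix {k : ℕ} (hs : Steps G o best k c c') : c.out <+: c'.out := by
  induction hs with
  | refl c => exact List.prefix_rfl
  | head h1 _ ih => exact h1.out_prefix.trans ih

theorem Steps.mem_trace {k : ℕ} (hs : Steps G o best k c c') {w : Fin n}
    (hw : w ∈ trace o c.out) : w ∈ trace o c'.out := by
  obtain ⟨K, hK⟩ := hs.out_prefix
  rw [← hK, mem_trace_append]
  exact Or.inl hw

theorem Sound.cur_mem (h : Sound G o c) : c.cur ∈ trace o c.out :=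
  h.cur ▸ endpoint_mem_trace o c.out

theorem side_lt (c : Agent n) : c.side < 2 := by
  unfold side
  split_ifs <;> omega

theorem side_cases (c : Agent n) : c.side = c.date % 2 ∨
    (c.side = 1 - c.date % 2 ∧ c.todo c.cur (c.date % 2) = []) := by
  unfold side
  split_ifs with h
  · exact Or.inr ⟨rfl, h⟩
  · exact Or.inl rfl

theorem todo_side_eq_nil_iff : c.todo c.cur c.side = [] ↔ c.rest c.cur = [] := by
  rw [rest, List.append_eq_nil_iff]
  rcases Nat.mod_two_eq_zero_or_one c.date with h | h
  all_goals
    rcases c.side_cases with h1 | ⟨h1, h2⟩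
    · rw [side] at h1 ⊢
      split_ifs at h1 ⊢ with h3
      · omega
      · rw [h] at h3 ⊢; simp [h3]
    · rw [h1]
      rw [h] at h2 ⊢
      simp [h2]

theorem rest_perm {u : Fin n} {L : List (Fin n)} (h : c.todo c.cur c.side = u :: L) :
    (c.rest c.cur).Perm (u :: (c.pop L).rest c.cur) := by
  have hlt := c.side_lt
  have : c.side = 0 ∨ c.side = 1 := by omega
  rcases this with h0 | h0 <;> rw [h0] at h <;> simp only [rest, pop, h0, true_and] <;> simp [h]

theorem pop_todo_of_ne {w : Fin n} (hw : w ≠ c.cur) (L : List (Fin n)) (b : ℕ) :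
    (c.pop L).todo w b = c.todo w b := by
  simp [pop, hw]

theorem Sorted.pop {u : Fin n} {L : List (Fin n)} (hs : Sorted G o c c.cur)
    (h : c.todo c.cur c.side = u :: L) : Sorted G o (c.pop L) c.cur := by
  have hp := rest_perm h
  refine ⟨(hp.nodup_iff.1 hs.nodup).of_cons,
    fun w hw => hs.children w (hp.mem_iff.2 (List.mem_cons_of_mem _ hw)), fun b hb w hw => ?_⟩
  simp only [Agent.pop, true_and] at hw
  split_ifs at hw with hbs
  · subst hbs
    exact hs.type _ hb w (h ▸ List.mem_cons_of_mem _ hw)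
  · exact hs.type b hb w hw

theorem Sorted.congr {w : Fin n} (hs : Sorted G o c w) (h : ∀ b, c'.todo w b = c.todo w b) :
    Sorted G o c' w := by
  have hr : c'.rest w = c.rest w := by simp only [rest, h]
  exact ⟨hr ▸ hs.nodup, hr ▸ hs.children, fun b hb => h b ▸ hs.type b hb⟩

theorem Full.congr {w : Fin n} (hs : Full G o c w) (h : ∀ b, c'.todo w b = c.todo w b) :
    Full G o c' w := by
  have hr : c'.rest w = c.rest w := by simp only [rest, h]
  exact ⟨hs.toSorted.congr h, hr ▸ hs.complete⟩

/-- A branch that is slow at the present date is taken only if all others are slow, too. -/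
theorem Sorted.greedy (hs : Sorted G o c c.cur) {u : Fin n} {L : List (Fin n)}
    (h : c.todo c.cur c.side = u :: L) :
    (c.date % 2 = 0 → fastOdd (G.branchCost o c.cur u) = 1 →
      ∀ w ∈ c.rest c.cur, fastOdd (G.branchCost o c.cur w) = 1) ∧
    (c.date % 2 = 1 → fastOdd (G.branchCost o c.cur u) = 0 →
      ∀ w ∈ c.rest c.cur, fastOdd (G.branchCost o c.cur w) = 0) := by
  have hu := hs.type c.side c.side_lt u (h ▸ List.mem_cons_self)
  constructor
  · intro ht h1 w hw
    rcases c.side_cases with h2 | ⟨-, h3⟩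
    · omega
    · rw [ht] at h3
      rw [rest, h3, List.nil_append] at hw
      exact hs.type 1 (by omega) w hw
  · intro ht h1 w hw
    rcases c.side_cases with h2 | ⟨-, h3⟩
    · omega
    · rw [ht] at h3
      rw [rest, h3, List.append_nil] at hw
      exact hs.type 0 (by omega) w hw

end Agent

/-- The conditions are in terms of the two lists, where constant branches go with `fw10`; they imply
those of `Typed.waste_step_eq`. -/
theorem listCost_cons {v u : Fin n} {L : List (Fin n)} {t : ℕ}
    (hu : Typed (G.branchCost o v u))
    (hx : t % 2 = 0 → fastOdd (G.branchCost o v u) = 1 →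
      ∀ w ∈ L, fastOdd (G.branchCost o v w) = 1)
    (hy : t % 2 = 1 → fastOdd (G.branchCost o v u) = 0 →
      ∀ w ∈ L, fastOdd (G.branchCost o v w) = 0) :
    G.listCost o v t (u :: L) =
      G.branchCost o v u t + G.listCost o v (t + G.branchCost o v u t) L := by
  have := hu.waste_step_eq (t := t) (x := (L.map fun w => fastEven (G.branchCost o v w)).sum)
    (y := (L.map fun w => fastOdd (G.branchCost o v w)).sum)
    (fun h1 h2 => sum_eq_zero_of_forall fun w hw => by
      have := hx h1 h2 w hw
      unfold fastOdd at this
      unfold fastEven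
      split_ifs at this ⊢ <;> omega)
    (fun h1 h2 => sum_eq_zero_of_forall fun w hw => hy h1 (by
      unfold fastEven at h2
      unfold fastOdd
      split_ifs at h2 ⊢ <;> omega) w hw)
  simp only [listCost, List.map_cons, List.sum_cons]
  omega

namespace Agent

variable {best : Fin n → ℕ → ℕ}

/-- The agent can cover the subtree at `v` with foremost return. -/
def CanTour (G : TVG (Fin n)) (o : Fin n) (best : Fin n → ℕ → ℕ) (v : Fin n) : Prop :=
  ∀ c : Agent n, c.cur = v → Sound G o c →
    (∀ w ∈ G.subtree o v, w ≠ c.front ∧ (w : ℕ) + 1 ≠ c.last ∧ Full G o c w) →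
    ∃ k c', Steps G o best k c c' ∧ c'.cur = v ∧ c'.front = c.front ∧ c'.last = c.last ∧
      c'.rest v = [] ∧ (∀ w ∉ G.subtree o v, ∀ b, c'.todo w b = c.todo w b) ∧
      c'.date = c.date + G.returnCost (G.subtree o v) v c.date ∧ k + c.date ≤ c'.date ∧
      ∀ w ∈ G.subtree o v, w ∈ trace o c'.out

/-- The children that are served before the last one. -/
def early (c : Agent n) (v : Fin n) : List (Fin n) :=
  (c.rest v).filter fun u => (u : ℕ) + 1 ≠ c.last

theorem mem_early {c : Agent n} {u v : Fin n} :
    u ∈ c.early v ↔ u ∈ c.rest v ∧ (u : ℕ) + 1 ≠ c.last := by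
  simp [early]

/-- Induction on the number of children left. The child reserved for the end is skipped, and any
other one is toured by going down, around its subtree and up again. A move takes at least one date,
so the number of actions exceeds the elapsed time by at most the number of skips. -/
theorem exists_serve (hT : G.graph.IsTree) (hP : G.IsPeriodic 2) {v : Fin n}
    (ih : ∀ u ∈ G.children o v, CanTour G o best u) (c : Agent n) (hc : c.cur = v)
    (hw : Sound G o c) (hs : Sorted G o c v)
    (hf : ∀ u ∈ c.early v, ∀ w ∈ G.subtree o u,
      w ≠ c.front ∧ (w : ℕ) + 1 ≠ c.last ∧ Full G o c w) :
    ∃ k c', Steps G o best k c c' ∧ c'.cur = v ∧ c'.front = c.front ∧ c'.last = c.last ∧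
      c'.rest v = [] ∧
      (∀ w, w ≠ v → (∀ u ∈ c.early v, w ∉ G.subtree o u) → ∀ b, c'.todo w b = c.todo w b) ∧
      c'.date = c.date + G.listCost o v c.date (c.early v) ∧
      k + c.date + (c.early v).length ≤ c'.date + (c.rest v).length ∧
      ∀ u ∈ c.early v, ∀ w ∈ G.subtree o u, w ∈ trace o c'.out := by
  induction hN : (c.rest v).length generalizing c with
  | zero =>
    rw [List.length_eq_zero_iff] at hN
    have he : c.early v = [] := by rw [early, hN]; rfl
    refine ⟨0, c, .refl c, hc, rfl, rfl, hN, fun _ _ _ _ => rfl, ?_, ?_, ?_⟩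
    · simp [he, listCost, waste]
    · simp [he]
    · simp [he]
  | succ N ihN =>
    subst hc
    obtain ⟨u, L, hL⟩ : ∃ u L, c.todo c.cur c.side = u :: L := by
      cases hd : c.todo c.cur c.side with
      | nil => rw [todo_side_eq_nil_iff.1 hd] at hN; simp at hN
      | cons u L => exact ⟨u, L, rfl⟩
    have hperm := rest_perm hL
    have hlen : ((c.pop L).rest c.cur).length = N := by
      have := hperm.length_eq
      simp only [List.length_cons] at this
      omega
    have hsp := hs.pop hL
    by_cases hul : (u : ℕ) + 1 = c.last
    · have hearly : (c.early c.cur).Perm ((c.pop L).early c.cur) := by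
        have := hperm.filter fun u : Fin n => (u : ℕ) + 1 ≠ c.last
        rw [List.filter_cons_of_neg (by simp [hul])] at this
        exact this
      have hfull : ∀ w, w ≠ c.cur → Full G o c w → Full G o (c.pop L) w := fun w h1 h2 =>
        h2.congr fun b => pop_todo_of_ne h1 L b
      obtain ⟨k, c', h1, h2, h3, h4, h5, h6, h7, h8, h9⟩ := ihN (c.pop L) rfl (hw.pop L) hsp
        (fun u' hu' w hw' => by
          have hu'' := hearly.mem_iff.2 hu'
          obtain ⟨a1, a2, a3⟩ := hf u' hu'' w hw'
          refine ⟨a1, a2, hfull w ?_ a3⟩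
          rintro rfl
          exact notMem_subtree_child hT (hs.children u' (mem_early.1 hu'').1) hw') hlen
      refine ⟨k + 1, c', .head (.skip c u L hL hul) h1, h2, h3, h4, h5, ?_, ?_, ?_, ?_⟩
      · intro w k1 k2 b
        rw [h6 w k1 (fun u' hu' => k2 u' (hearly.mem_iff.2 hu')) b, pop_todo_of_ne k1]
      · rw [h7, listCost_perm hearly]; rfl
      · rw [hearly.length_eq]
        have : (c.pop L).date = c.date := rfl
        omega
      · intro u' hu'
        exact h9 u' (hearly.mem_iff.1 hu')
    · have hearly : (c.early c.cur).Perm (u :: (c.pop L).early c.cur) := by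
        have := hperm.filter fun u : Fin n => (u : ℕ) + 1 ≠ c.last
        rw [List.filter_cons_of_pos (by simp [hul])] at this
        exact this
      have hu : u ∈ G.children o c.cur := hs.children u (hperm.mem_iff.2 List.mem_cons_self)
      have hue : u ∈ c.early c.cur := hearly.mem_iff.2 List.mem_cons_self
      have hvu := notMem_subtree_child hT hu
      -- down to `u`, around its subtree, and up again
      obtain ⟨c₁, hc₁⟩ : ∃ c₁, c₁ = (c.pop L).move G u := ⟨_, rfl⟩
      have s1 : Step G o best c c₁ := hc₁ ▸ .down c u L hL hul hu
      have todo₁ : ∀ w, w ≠ c.cur → ∀ b, c₁.todo w b = c.todo w b := fun w h1 b => by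
        rw [hc₁]; exact pop_todo_of_ne h1 L b
      have date₁ : c₁.date = c.date + G.wait s(c.cur, u) c.date + 1 := by rw [hc₁]; rfl
      have front₁ : c₁.front = c.front := by rw [hc₁]; rfl
      have last₁ : c₁.last = c.last := by rw [hc₁]; rfl
      obtain ⟨k, c₂, h1, h2, h3, h4, h5, h6, h7, h8, h9⟩ := ih u hu c₁ (by rw [hc₁]; rfl)
        (s1.sound hP hw) (fun w hw' => by
          obtain ⟨a1, a2, a3⟩ := hf u hue w hw'
          rw [front₁, last₁]
          refine ⟨a1, a2, a3.congr (todo₁ w ?_)⟩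
          rintro rfl
          exact hvu hw')
      obtain ⟨c₃, hc₃⟩ : ∃ c₃, c₃ = c₂.move G c.cur := ⟨_, rfl⟩
      have s3 : Step G o best c₂ c₃ := hc₃ ▸ .up c₂ c.cur
        (todo_side_eq_nil_iff.2 (h2 ▸ h5)) (by
          rw [h2, h3, front₁]
          exact (hf u hue u (self_mem_subtree G o u)).1) (h2 ▸ hu)
      have steps : Steps G o best (k + 2) c c₃ := by
        have := (Steps.head s1 h1).trans s3.steps
        exact this
      have date₃ : c₃.date = c.date + G.branchCost o c.cur u c.date := by
        have e1 := hP.branchCost_eq hT hu c.date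
        rw [← date₁, ← h7] at e1
        rw [e1, hc₃]
        simp only [Agent.move, h2, Sym2.eq_swap]
      have todo₃ : ∀ w ∉ G.subtree o u, ∀ b, c₃.todo w b = (c.pop L).todo w b := fun w hw' b => by
        rw [hc₃]
        exact (h6 w hw' b).trans (by rw [hc₁]; rfl)
      have front₃ : c₃.front = c.front := by rw [hc₃, ← front₁, ← h3]; rfl
      have last₃ : c₃.last = c.last := by rw [hc₃, ← last₁, ← h4]; rfl
      have rest₃ : c₃.rest c.cur = (c.pop L).rest c.cur := by
        simp only [rest, todo₃ _ hvu]
      have early₃ : c₃.early c.cur = (c.pop L).early c.cur := by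
        simp only [early, rest₃, last₃]; rfl
      have disj : ∀ u' ∈ (c.pop L).early c.cur, ∀ w ∈ G.subtree o u', w ∉ G.subtree o u := by
        intro u' hu' w k1 k2
        have := eq_child_of_mem hT (hsp.children u' (mem_early.1 hu').1) hu k1 k2
        subst this
        exact (List.nodup_cons.1 (hperm.nodup_iff.1 hs.nodup)).1 (mem_early.1 hu').1
      obtain ⟨k', c', g1, g2, g3, g4, g5, g6, g7, g8, g9⟩ := ihN c₃ (by rw [hc₃]; rfl)
        (steps.sound hP hw) (hsp.congr (todo₃ _ hvu)) (fun u' hu' w hw' => by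
          rw [early₃] at hu'
          obtain ⟨a1, a2, a3⟩ := hf u' (hearly.mem_iff.2 (List.mem_cons_of_mem _ hu')) w hw'
          rw [front₃, last₃]
          refine ⟨a1, a2, a3.congr fun b => ?_⟩
          rw [todo₃ w (disj u' hu' w hw'), pop_todo_of_ne]
          rintro rfl
          exact notMem_subtree_child hT (hsp.children u' (mem_early.1 hu').1) hw')
        (by rw [rest₃, hlen])
      rw [early₃] at g6 g7 g8 g9
      refine ⟨_, c', steps.trans g1, g2, g3.trans front₃, g4.trans last₃, g5, ?_, ?_, ?_, ?_⟩
      · intro w k1 k2 b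
        rw [g6 w k1 (fun u' hu' => k2 u' (hearly.mem_iff.2 (List.mem_cons_of_mem _ hu'))) b,
          todo₃ w (k2 u hue), pop_todo_of_ne k1]
      · have hgr := hs.greedy hL
        have hsub : ∀ w ∈ (c.pop L).early c.cur, w ∈ c.rest c.cur := fun w hw' =>
          hperm.mem_iff.2 (List.mem_cons_of_mem _ (mem_early.1 hw').1)
        rw [g7, listCost_perm hearly, listCost_cons (hP.typed_branchCost hT hu)
          (fun a b w hw' => hgr.1 a b w (hsub w hw')) (fun a b w hw' => hgr.2 a b w (hsub w hw')),
          date₃, Nat.add_assoc]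
      · rw [hearly.length_eq, List.length_cons]
        have : c₂.date + 1 ≤ c₃.date := by
          rw [hc₃]; simp only [Agent.move]; omega
        omega
      · intro u' hu' w hw'
        rcases List.mem_cons.1 (hearly.mem_iff.1 hu') with rfl | hu'
        · exact g1.mem_trace (s3.steps.mem_trace (h9 w hw'))
        · exact g9 u' hu' w hw'

/-- Inside the subtree no child is reserved for the end, so nothing is skipped and every action
takes time. -/
theorem canTour (hT : G.graph.IsTree) (hP : G.IsPeriodic 2) (v : Fin n) :
    CanTour G o best v := by
  induction v using subtree_induction (o := o) hT with
  | h v ih =>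
    intro c hc hw hf
    have hv := hf v (self_mem_subtree G o v)
    have hearly : c.early v = c.rest v := by
      rw [early, List.filter_eq_self]
      intro u hu
      simpa using (hf u (hv.2.2.children u hu).2).2.1
    have hmem : ∀ u, u ∈ c.rest v ↔ u ∈ G.children o v := fun u =>
      ⟨hv.2.2.children u, hv.2.2.complete u⟩
    obtain ⟨k, c', h1, h2, h3, h4, h5, h6, h7, h8, h9⟩ := exists_serve hT hP ih c hc hw
      hv.2.2.toSorted (fun u hu w hw' => hf w
        (subtree_child_subset ((hmem u).1 (hearly ▸ hu)) hw'))
    rw [hearly] at h6 h7 h8 h9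
    refine ⟨k, c', h1, h2, h3, h4, h5, ?_, ?_, by omega, ?_⟩
    · intro w hw' b
      refine h6 w ?_ (fun u hu hwu => hw' (subtree_child_subset ((hmem u).1 hu) hwu)) b
      rintro rfl
      exact hw' (self_mem_subtree G o w)
    · rw [h7, hP.returnCost_eq hT hv.2.2.nodup hmem]
    · intro w hw'
      rcases (mem_subtree_cases hT).1 hw' with rfl | ⟨u, hu, hwu⟩
      · exact h1.mem_trace (hc ▸ hw.cur_mem)
      · exact h9 u ((hmem u).2 hu) w hwu

/-- `best v p` is one more than the child of `v` to be served last in an optimal coverage that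
starts at a date of parity `p`; it is `0` if there are no children. -/
def BestLast (G : TVG (Fin n)) (o : Fin n) (best : Fin n → ℕ → ℕ) : Prop :=
  ∀ v, ∀ p < 2, (G.children o v = ∅ ∧ best v p = 0) ∨
    ∃ u ∈ G.children o v, best v p = u + 1 ∧ ∀ L : List (Fin n), (u :: L).Nodup →
      (∀ w, w ∈ u :: L ↔ w ∈ G.children o v) →
        p + G.coverCost (G.subtree o v) v p = G.coverDate o v p u L

/-- Induction down the chain of last children. The skip of the last child is charged to the later
move that enters it, whence the factor two in the bound for the number of actions. -/
theorem exists_cover (hT : G.graph.IsTree) (hP : G.IsPeriodic 2) (hb : BestLast G o best)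
    (v : Fin n) : ∀ c : Agent n, c.cur = v → c.front = v → c.last = best v (c.date % 2) →
      Sound G o c → (∀ w ∈ G.subtree o v, Full G o c w) →
      ∃ k c', Steps G o best k c c' ∧ Halted c' ∧ k + 2 * c.date ≤ 2 * c'.date ∧
        c'.date = c.date + G.coverCost (G.subtree o v) v c.date ∧
        ∀ w ∈ G.subtree o v, w ∈ trace o c'.out := by
  induction v using subtree_induction (o := o) hT with
  | h v ih =>
    intro c hc hfr hl hw hf
    have hv := hf v (self_mem_subtree G o v)
    have hmem : ∀ u, u ∈ c.rest v ↔ u ∈ G.children o v := fun u =>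
      ⟨hv.children u, hv.complete u⟩
    have hmod := Nat.mod_lt c.date two_pos
    rcases hb v (c.date % 2) hmod with ⟨h1, h2⟩ | ⟨u, hu, h2, h3⟩
    · have hnil : c.rest v = [] := List.eq_nil_iff_forall_not_mem.2 fun u hu => by
        rw [hmem, h1] at hu
        exact hu
      refine ⟨0, c, .refl c, ⟨todo_side_eq_nil_iff.2 (hc ▸ hnil), hc.trans hfr.symm,
        hl.trans h2⟩, by omega, by rw [coverCost_leaf hT h1, Nat.add_zero], fun w hw' => ?_⟩
      rcases (mem_subtree_cases hT).1 hw' with rfl | ⟨u, hu, -⟩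
      · exact hc ▸ hw.cur_mem
      · rw [h1] at hu; exact hu.elim
    · have hl' : c.last = u + 1 := hl.trans h2
      have hperm := List.perm_cons_erase ((hmem u).2 hu)
      have hnd := hperm.nodup_iff.1 hv.nodup
      have hmemc : ∀ w, w ∈ u :: (c.rest v).erase u ↔ w ∈ G.children o v := fun w => by
        rw [← hperm.mem_iff, hmem]
      have hearly : (c.early v).Perm ((c.rest v).erase u) := by
        have := hperm.filter fun w : Fin n => (w : ℕ) + 1 ≠ c.last
        rw [List.filter_cons_of_neg (by simp [hl'])] at this
        refine this.trans (.of_eq (List.filter_eq_self.2 fun w hw' => ?_))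
        have : w ≠ u := fun h => (List.nodup_cons.1 hnd).1 (h ▸ hw')
        have : (w : ℕ) ≠ u := fun h => this (Fin.ext h)
        simp only [hl', decide_eq_true_eq]
        omega
      have hch : ∀ u' ∈ c.early v, u' ∈ G.children o v ∧ u' ≠ u := fun u' hu' =>
        ⟨(hmem u').1 (mem_early.1 hu').1, fun h => (mem_early.1 hu').2 (by rw [h, hl'])⟩
      have hdisj : ∀ u' ∈ c.early v, ∀ w ∈ G.subtree o u', w ∉ G.subtree o u :=
        fun u' hu' w k1 k2 => (hch u' hu').2 (eq_child_of_mem hT (hch u' hu').1 hu k1 k2)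
      obtain ⟨k, c₁, g1, g2, g3, g4, g5, g6, g7, g8, g9⟩ := exists_serve hT hP
        (fun u _ => canTour (best := best) hT hP u) c hc hw hv.toSorted (fun u' hu' w hw' => by
          obtain ⟨a1, a2⟩ := hch u' hu'
          refine ⟨?_, ?_, hf w (subtree_child_subset a1 hw')⟩
          · rintro rfl
            exact notMem_subtree_child hT a1 (hfr ▸ hw')
          · intro h
            have : w = u := Fin.ext (by omega)
            exact hdisj u' hu' w hw' (this ▸ self_mem_subtree G o u))
      obtain ⟨c₂, hc₂⟩ : ∃ c₂, c₂ = (c₁.move G u).settle best := ⟨_, rfl⟩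
      have s2 : Step G o best c₁ c₂ := hc₂ ▸ .enter c₁ u (todo_side_eq_nil_iff.2 (g2 ▸ g5))
        (g2.trans (g3.trans hfr).symm) (g4.trans hl') (g2 ▸ hu)
      have date₂ : c₂.date = c₁.date + G.wait s(v, u) c₁.date + 1 := by rw [hc₂, ← g2]; rfl
      have hsteps := g1.trans s2.steps
      obtain ⟨k', c', e1, e2, e3, e4, e5⟩ := ih u hu c₂ (by rw [hc₂]; rfl) (by rw [hc₂]; rfl)
        (by rw [hc₂]; rfl) (hsteps.sound hP hw) (fun w hw' => by
          refine (hf w (subtree_child_subset hu hw')).congr fun b => ?_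
          rw [hc₂]
          refine g6 w ?_ (fun u' hu' hwu' => hdisj u' hu' w hwu' hw') b
          rintro rfl
          exact notMem_subtree_child hT hu hw')
      refine ⟨_, c', hsteps.trans e1, e2, ?_, ?_, ?_⟩
      · have := hperm.length_eq
        rw [List.length_cons, ← hearly.length_eq] at this
        have := g1.date_le
        omega
      -- The choice of the last child refers to the start date `c.date % 2`. The equations that
      -- follow shift it to `c.date` by an even amount.
      · have k1 := h3 _ hnd hmemc
        rw [hP.coverDate_eq hT hu rfl rfl] at k1
        rw [listCost_perm hearly] at g7
        have k2 : G.listCost o v (c.date % 2) ((c.rest v).erase u) =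
            G.listCost o v c.date ((c.rest v).erase u) := by
          rw [listCost, listCost, ← waste_mod]
        rw [k2] at k1
        have k3 : G.wait s(v, u) ((c.date % 2 + G.listCost o v c.date ((c.rest v).erase u)) % 2) =
            G.wait s(v, u) c₁.date :=
          wait_eq_of_mod_eq hP.twoPeriodic hu.1 (by rw [g7]; omega)
        rw [k3] at k1
        have k4 : G.coverCost (G.subtree o u) u ((c.date % 2 +
            G.listCost o v c.date ((c.rest v).erase u) + G.wait s(v, u) c₁.date + 1) % 2) =
            G.coverCost (G.subtree o u) u c₂.date :=
          coverCost_eq_of_mod_eq hP.twoPeriodic _ _ (by rw [date₂]; omega)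
        rw [k4, coverCost_eq_of_mod_eq hP.twoPeriodic _ _ (Nat.mod_mod c.date 2)] at k1
        omega
      · intro w hw'
        rcases (mem_subtree_cases hT).1 hw' with rfl | ⟨u', hu', hwu'⟩
        · exact (hsteps.trans e1).mem_trace (hc ▸ hw.cur_mem)
        · by_cases h : u' = u
          · subst h; exact e5 w hwu'
          · refine (s2.steps.trans e1).mem_trace (g9 u' (mem_early.2 ⟨(hmem u').2 hu', ?_⟩) w hwu')
            rw [hl']
            intro h'
            exact h (Fin.ext (by omega))

/-- The greedy tour is an optimal solution. -/
theorem exists_optimal (hT : G.graph.IsTree) (hP : G.IsPeriodic 2) (hb : BestLast G o best)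
    {c : Agent n} (hc : c.cur = o) (hd : c.date = 0) (hfr : c.front = o)
    (hl : c.last = best o 0) (ho : c.out = []) (hf : ∀ w, Full G o c w) :
    ∃ k c', Steps G o best k c c' ∧ Halted c' ∧ k ≤ 2 * c'.date ∧ Sound G o c' ∧
      c'.date + 4 ≤ 4 * n ∧ G.IsOptimal o c'.out := by
  have hs : Sound G o c := ⟨by rw [ho]; trivial, by rw [ho, hc]; rfl, by rw [ho, hd]; rfl, by simp [ho]⟩
  obtain ⟨k, c', h1, h2, h3, h4, h5⟩ := exists_cover hT hP hb o c hc hfr (by rw [hl, hd]) hs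
    fun w _ => hf w
  have hs' := h1.sound hP hs
  rw [hd, subtree_root, Nat.zero_add] at h4
  refine ⟨k, c', h1, h2, by omega, hs', ?_, ⟨hs'.journey, fun _ _ => trivial, fun w _ => ?_⟩,
    fun J hJ => ?_⟩
  · have a1 := hP.costs_le (o := o) hT o 0
    have a2 := coverCost_le_returnCost (hP.subtree_returnCosts_nonempty (o := o) hT o 0)
    rw [subtree_root] at a1 a2
    have a3 : (Set.univ : Set (Fin n)).ncard = n := by simp [Set.ncard_univ]
    omega
  · exact h5 w (by rw [subtree_root]; trivial)
  · rw [hs'.date, h4]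
    have := add_coverCost_le hJ le_rfl
    omega

end Agent

end TVG

/-! ### The tour as a program, and its simulation of the agent. -/

namespace RAM

open TVG

/-- Put the index of the list from which the next child is taken into register `5`. -/
def select : Prog :=
  .seq (.setReg 5 (.pair 2 (.parity (.reg 3)))) <|
  .ite (.arr 15 (.reg 5)) .skip (.setReg 5 (.pair 2 (.sub (.const 1) (.parity (.reg 3)))))

/-- Move to the vertex in register `4`; the edge is the parent edge of the vertex in register
`x`. -/
def cross (x : ℕ) : Prog :=
  .seq (.setReg 10 (.add (.reg 3) (.arr 8 (.pair x (.parity (.reg 3)))))) <|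
  .seq (.setArr 0 (.reg 8) (.reg 4)) <|
  .seq (.setArr 1 (.reg 8) (.reg 10)) <|
  .seq (.setReg 8 (.add (.reg 8) (.const 1))) <|
  .seq (.setReg 3 (.add (.reg 10) (.const 1))) <|
  .setReg 2 (.reg 4)

def popProg : Prog :=
  .seq (.setReg 4 (.sub (.arr 15 (.reg 5)) (.const 1))) <| .setArr 15 (.reg 5) (.arr 14 (.reg 4))

def settleProg : Prog :=
  .seq (.setReg 6 (.reg 2)) (.setReg 7 (.arr 17 (.pair 2 (.parity (.reg 3)))))

/-- Registers `2`, `3`, `6`, `7` and `8` hold the position, the date, the front, the last child and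
the number of moves; register `9` keeps the loop running. The moves go to arrays `0` and `1`,
overwriting the edge list, which is no longer needed. -/
def walkBody : Prog :=
  .seq select <|
  .ite (.arr 15 (.reg 5))
    (.seq popProg (.ite (.eq (.add (.reg 4) (.const 1)) (.reg 7)) .skip (cross 4)))
    (.ite (.eq (.reg 2) (.reg 6))
      (.ite (.reg 7)
        (.seq (.setReg 4 (.sub (.reg 7) (.const 1))) (.seq (cross 4) settleProg))
        (.setReg 9 (.const 0)))
      (.seq (.setReg 4 (.arr 7 (.reg 2))) (cross 2)))

theorem IsChain.eq_zero_iff {n : ℕ} {nx : ℕ → ℕ} {h : ℕ} {L : List (Fin n)}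
    (hc : IsChain nx h L) : h = 0 ↔ L = [] := by
  cases L with
  | nil => exact ⟨fun _ => rfl, fun _ => hc⟩
  | cons u L => simp [hc.1]

/-- The tables that guide the agent. -/
structure Tables {n : ℕ} (G : TVG (Fin n)) (o : Fin n) (best : Fin n → ℕ → ℕ) (m : Mem) :
    Prop where
  wait : ∀ u v, u ∈ G.children o v → ∀ p < 2, m.arr 8 (u + u + p) = G.wait s(v, u) p
  parent : ∀ u v, u ∈ G.children o v → m.arr 7 u = v
  last : ∀ v : Fin n, ∀ p < 2, m.arr 17 (v + v + p) = best v p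
  last_le : ∀ v, ∀ p < 2, best v p ≤ n

/-- Popping a child moves only a head in array `15`; the links in array `14` remain those of the
initial memory, so all lists keep sharing them. -/
structure Refines {n : ℕ} (m₀ : Mem) (c : Agent n) (m : Mem) : Prop where
  cur : m.reg 2 = c.cur
  date : m.reg 3 = c.date
  front : m.reg 6 = c.front
  last : m.reg 7 = c.last
  length : m.reg 8 = c.out.length
  active : m.reg 9 = 1
  frame : ∀ a, a ≠ 0 → a ≠ 1 → a ≠ 15 → m.arr a = m₀.arr a
  chain : ∀ v : Fin n, ∀ b < 2, IsChain (m₀.arr 14) (m.arr 15 (v + v + b)) (c.todo v b)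
  moves : ∀ k (h : k < c.out.length), m.arr 0 k = (c.out[k].1 : ℕ) ∧ m.arr 1 k = c.out[k].2

section Walk

variable {W n : ℕ} {G : TVG (Fin n)} {o : Fin n} {best : Fin n → ℕ → ℕ} {m₀ m : Mem}
  {c c' : Agent n}

/-- Only the scratch registers have changed. -/
theorem Refines.congr {m' : Mem} (h : Refines m₀ c m)
    (hr : ∀ x, x ≠ 4 → x ≠ 5 → x ≠ 10 → m'.reg x = m.reg x) (ha : m'.arr = m.arr) :
    Refines m₀ c m' := by
  obtain ⟨h1, h2, h3, h4, h5, h6, h7, h8, h9⟩ := h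
  constructor
  all_goals first
    | rw [hr _ (by decide) (by decide) (by decide)]; assumption
    | rw [ha]; assumption

theorem select_wp {Q : Mem → Prop} (h : Refines m₀ c m) (hW : 2 * n ≤ W)
    (hQ : ∀ m', Refines m₀ c m' → m'.reg 5 = c.cur + c.cur + c.side → Q m') :
    select.wp W Q m := by
  have hv := c.cur.2
  have hlt := Nat.mod_lt c.date two_pos
  have hch := (h.chain c.cur _ hlt).eq_zero_iff
  refine wp_setReg (w := c.cur + c.cur + c.date % 2)
    (by simp [Expr.pair_eval, Expr.eval, h.cur, h.date]) (by omega) ⟨fun h1 => ?_, fun h1 => ?_⟩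
  · simp only [Expr.eval, Mem.setReg_reg, Mem.setReg_arr, if_true] at h1
    rw [Ne, hch] at h1
    refine hQ _ (h.congr ?_ rfl) ?_
    · intro x _ h5 _; simp [Mem.setReg_reg, h5]
    · simp [Mem.setReg_reg, Agent.side, h1]
  · simp only [Expr.eval, Mem.setReg_reg, Mem.setReg_arr, if_true] at h1
    rw [hch] at h1
    refine wp_setReg (w := c.cur + c.cur + c.side) ?_ ?_ (hQ _ (h.congr ?_ rfl) ?_)
    · simp [Expr.pair_eval, Expr.eval, Mem.setReg_reg, h.cur, h.date, Agent.side, h1]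
    · have := c.side_lt
      omega
    · intro x _ h5 _; simp [Mem.setReg_reg, h5]
    · simp [Mem.setReg_reg]

/-- The number of moves is at most the date, so the bound for the final date also bounds the
addresses of the output. -/
theorem cross_wp {Q : Mem → Prop} {x : ℕ} {u w : Fin n} (h : Refines m₀ c m)
    (hs : Agent.Sound G o c) (h4 : m.reg 4 = u) (hx : m.reg x = w)
    (hw : m₀.arr 8 (w + w + c.date % 2) = G.wait s(c.cur, u) c.date) (hW : n ≤ W)
    (hd : (c.move G u).date ≤ W) (hQ : ∀ m', Refines m₀ (c.move G u) m' → Q m') :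
    (cross x).wp W Q m := by
  have hu := u.2
  have hlen := hs.length
  have hd' : c.date + G.wait s(c.cur, u) c.date + 1 ≤ W := hd
  have h8 := h.frame 8 (by decide) (by decide) (by decide)
  refine wp_setReg (w := c.date + G.wait s(c.cur, u) c.date)
    (by simp [Expr.pair_eval, Expr.eval, h.date, hx, h8, hw]) (by omega) ?_
  refine wp_setArr (j := c.out.length) (w := u) (by simp [Expr.eval, Mem.setReg_reg, h.length])
    (by simp [Expr.eval, Mem.setReg_reg, h4]) (by omega) (by omega) ?_
  refine wp_setArr (j := c.out.length) (w := c.date + G.wait s(c.cur, u) c.date)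
    (by simp [Expr.eval, Mem.setArr_reg, Mem.setReg_reg, h.length])
    (by simp [Expr.eval, Mem.setArr_reg, Mem.setReg_reg]) (by omega) (by omega) ?_
  refine wp_setReg (w := c.out.length + 1)
    (by simp [Expr.eval, Mem.setArr_reg, Mem.setReg_reg, h.length]) (by omega) ?_
  refine wp_setReg (w := c.date + G.wait s(c.cur, u) c.date + 1)
    (by simp [Expr.eval, Mem.setArr_reg, Mem.setReg_reg]) (by omega) ?_
  refine wp_setReg (w := u)
    (by simp [Expr.eval, Mem.setArr_reg, Mem.setReg_reg, h4]) (by omega) (hQ _ ?_)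
  constructor
  · simp [Mem.setReg_reg, Agent.move]
  · simp [Mem.setReg_reg, Agent.move]
  · simp [Mem.setReg_reg, Mem.setArr_reg, Agent.move, h.front]
  · simp [Mem.setReg_reg, Mem.setArr_reg, Agent.move, h.last]
  · simp [Mem.setReg_reg, Mem.setArr_reg, Agent.move]
  · simp [Mem.setReg_reg, Mem.setArr_reg, Agent.move, h.active]
  · intro a a0 a1 a15
    simp [Mem.setReg_arr, Mem.setArr_arr, a0, a1, h.frame a a0 a1 a15]
  · intro v b hb
    simpa [Mem.setReg_arr, Mem.setArr_arr, Agent.move] using h.chain v b hb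
  · intro k hk
    simp only [Agent.move, List.length_append, List.length_singleton] at hk
    simp only [Mem.setReg_arr, Mem.setArr_arr, Agent.move]
    by_cases hkl : k = c.out.length
    · subst hkl
      simp
    · have hk' : k < c.out.length := by omega
      have := h.moves k hk'
      simp [Function.update_of_ne hkl, List.getElem_append_left hk', this]

theorem popProg_wp {Q : Mem → Prop} {u : Fin n} {L : List (Fin n)} (h : Refines m₀ c m)
    (h5 : m.reg 5 = c.cur + c.cur + c.side) (hL : c.todo c.cur c.side = u :: L) (hW : 2 * n ≤ W)
    (hQ : ∀ m', Refines m₀ (c.pop L) m' → m'.reg 4 = u → Q m') : popProg.wp W Q m := by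
  have hu := u.2
  have hv := c.cur.2
  have hlt := c.side_lt
  have hch := h.chain c.cur _ hlt
  rw [hL] at hch
  have h14 := h.frame 14 (by decide) (by decide) (by decide)
  have hle := hch.2.head_le
  refine wp_setReg (w := u) (by simp [Expr.eval, h5, hch.1]) (by omega) ?_
  refine wp_setArr (j := c.cur + c.cur + c.side) (w := m₀.arr 14 u)
    (by simp [Expr.eval, Mem.setReg_reg, h5])
    (by simp [Expr.eval, Mem.setReg_reg, Mem.setReg_arr, h14]) (by omega) (by omega) (hQ _ ?_ ?_)
  · constructor
    · simpa [Mem.setArr_reg, Mem.setReg_reg, Agent.pop] using h.cur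
    · simpa [Mem.setArr_reg, Mem.setReg_reg, Agent.pop] using h.date
    · simpa [Mem.setArr_reg, Mem.setReg_reg, Agent.pop] using h.front
    · simpa [Mem.setArr_reg, Mem.setReg_reg, Agent.pop] using h.last
    · simpa [Mem.setArr_reg, Mem.setReg_reg, Agent.pop] using h.length
    · simpa [Mem.setArr_reg, Mem.setReg_reg, Agent.pop] using h.active
    · intro a a0 a1 a15
      simp [Mem.setArr_arr, Mem.setReg_arr, a15, h.frame a a0 a1 a15]
    · intro v b hb
      simp only [Mem.setArr_arr, Mem.setReg_arr, if_true, Agent.pop]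
      by_cases hvb : v = c.cur ∧ b = c.side
      · rw [if_pos hvb, hvb.1, hvb.2, Function.update_self]
        exact hch.2
      · rw [if_neg hvb, Function.update_of_ne]
        · exact h.chain v b hb
        · intro heq
          exact hvb ⟨Fin.ext (by omega), by omega⟩
    · intro k hk
      rw [Mem.setArr_arr, Mem.setArr_arr, if_neg (by decide), if_neg (by decide)]
      exact h.moves k hk
  · simp [Mem.setArr_reg, Mem.setReg_reg]

theorem settleProg_wp {Q : Mem → Prop} (h : Refines m₀ c m) (hm₀ : Tables G o best m₀)
    (hW : n ≤ W) (hQ : ∀ m', Refines m₀ (c.settle best) m' → Q m') : settleProg.wp W Q m := by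
  have hv := c.cur.2
  have hlt := Nat.mod_lt c.date two_pos
  have hle := hm₀.last_le c.cur _ hlt
  have h17 := h.frame 17 (by decide) (by decide) (by decide)
  refine wp_setReg (w := c.cur) (by simp [Expr.eval, h.cur]) (by omega) ?_
  refine wp_setReg (w := best c.cur (c.date % 2))
    (by simp [Expr.pair_eval, Expr.eval, Mem.setReg_reg, Mem.setReg_arr, h.cur, h.date, h17,
      hm₀.last _ _ hlt]) (by omega) (hQ _ ?_)
  constructor
  · simpa [Mem.setReg_reg, Agent.settle] using h.cur
  · simpa [Mem.setReg_reg, Agent.settle] using h.date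
  · simp [Mem.setReg_reg, Agent.settle]
  · simp [Mem.setReg_reg, Agent.settle]
  · simpa [Mem.setReg_reg, Agent.settle] using h.length
  · simpa [Mem.setReg_reg, Agent.settle] using h.active
  · exact h.frame
  · exact h.chain
  · exact h.moves

/-- One round of the loop performs exactly one action of the agent, the case being determined by the
selected list, the front and the last child. -/
theorem walkBody_runs (hP : G.IsPeriodic 2) (hm₀ : Tables G o best m₀)
    (hW : 2 * n ≤ W) (h : Refines m₀ c m) (hs : Agent.Sound G o c)
    (hstep : Agent.Step G o best c c') (hd : c'.date ≤ W) :
    Runs W walkBody m walkBody.time (Refines m₀ c') := by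
  have hmod : ∀ t : ℕ, t % 2 % 2 = t % 2 := fun t => Nat.mod_mod t 2
  have hlt := Nat.mod_lt c.date two_pos
  apply Prog.runs_of_wp
  refine select_wp h hW fun m₁ h₁ h5 => ?_
  have hch := (h₁.chain c.cur _ c.side_lt).eq_zero_iff
  have hcond : (Expr.arr 15 (.reg 5)).eval m₁ = 0 ↔ c.todo c.cur c.side = [] := by
    simp only [Expr.eval, h5, hch]
  cases hstep with
  | skip u L hL hl =>
    refine ⟨fun _ => popProg_wp h₁ h5 hL hW fun m₂ h₂ h4 => ⟨fun _ => h₂, fun h6 => ?_⟩,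
      fun h6 => by rw [hcond, hL] at h6; cases h6⟩
    have : m₂.reg 7 = c.last := h₂.last
    simp [Expr.eval, h4, this, hl] at h6
  | down u L hL hl hu =>
    refine ⟨fun _ => popProg_wp h₁ h5 hL hW fun m₂ h₂ h4 => ⟨fun h6 => ?_, fun _ => ?_⟩,
      fun h6 => by rw [hcond, hL] at h6; cases h6⟩
    · have : m₂.reg 7 = c.last := h₂.last
      simp [Expr.eval, h4, this, hl] at h6
    · refine cross_wp (w := u) h₂ (hs.pop L) h4 h4 ?_ (by omega) hd fun m₃ h₃ => h₃
      exact (hm₀.wait u _ hu _ hlt).trans (wait_eq_of_mod_eq hP.twoPeriodic hu.1 (hmod _))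
  | up v hL hf hv =>
    refine ⟨fun h6 => absurd (hcond.2 hL) h6, fun _ => ⟨fun h6 => ?_, fun _ => ?_⟩⟩
    · have : (c.cur : ℕ) ≠ c.front := fun h => hf (Fin.ext h)
      simp [Expr.eval, h₁.cur, h₁.front, this] at h6
    · have h7 := h₁.frame 7 (by decide) (by decide) (by decide)
      have hvn := v.2
      refine wp_setReg (w := v) (by simp [Expr.eval, h₁.cur, h7, hm₀.parent _ v hv]) (by omega) ?_
      refine cross_wp (w := c.cur)
        (h₁.congr (fun x h4 _ _ => by simp [Mem.setReg_reg, h4]) rfl) hs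
        (by simp [Mem.setReg_reg]) (by simp [Mem.setReg_reg, h₁.cur]) ?_ (by omega) hd
        fun m₃ h₃ => h₃
      rw [hm₀.wait _ v hv _ hlt, Sym2.eq_swap]
      exact wait_eq_of_mod_eq hP.twoPeriodic hv.1.symm (hmod _)
  | enter u hL hf hl hu =>
    refine ⟨fun h6 => absurd (hcond.2 hL) h6, fun _ => ⟨fun _ => ⟨fun _ => ?_, fun h6 => ?_⟩,
      fun h6 => ?_⟩⟩
    · have hun := u.2
      refine wp_setReg (w := u) (by simp [Expr.eval, h₁.last, hl]) (by omega) ?_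
      refine cross_wp (w := u)
        (h₁.congr (fun x h4 _ _ => by simp [Mem.setReg_reg, h4]) rfl) hs
        (by simp [Mem.setReg_reg]) (by simp [Mem.setReg_reg]) ?_ (by omega) hd
        fun m₃ h₃ => settleProg_wp h₃ hm₀ (by omega) fun m₄ h₄ => h₄
      exact (hm₀.wait u _ hu _ hlt).trans (wait_eq_of_mod_eq hP.twoPeriodic hu.1 (hmod _))
    · simp [Expr.eval, h₁.last, hl] at h6
    · simp [Expr.eval, h₁.cur, h₁.front, hf] at h6

/-- The loop has ended. -/
structure Finished {n : ℕ} (c : Agent n) (m : Mem) : Prop where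
  date : m.reg 3 = c.date
  length : m.reg 8 = c.out.length
  inactive : m.reg 9 = 0
  moves : ∀ k (h : k < c.out.length), m.arr 0 k = (c.out[k].1 : ℕ) ∧ m.arr 1 k = c.out[k].2

theorem walkBody_halts (hW : 2 * n ≤ W) (h : Refines m₀ c m) (hh : c.Halted) :
    Runs W walkBody m walkBody.time (Finished c) := by
  apply Prog.runs_of_wp
  refine select_wp h hW fun m₁ h₁ h5 => ?_
  have hch := (h₁.chain c.cur _ c.side_lt).eq_zero_iff
  have hcond : (Expr.arr 15 (.reg 5)).eval m₁ = 0 ↔ c.todo c.cur c.side = [] := by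
    simp only [Expr.eval, h5, hch]
  refine ⟨fun h6 => absurd (hcond.2 hh.todo) h6, fun _ => ⟨fun _ => ⟨fun h6 => ?_, fun _ => ?_⟩,
    fun h6 => ?_⟩⟩
  · simp [Expr.eval, h₁.last, hh.last] at h6
  · refine wp_setReg (w := 0) rfl (Nat.zero_le _) ⟨?_, ?_, ?_, h₁.moves⟩
    · simpa [Mem.setReg_reg] using h₁.date
    · simpa [Mem.setReg_reg] using h₁.length
    · simp [Mem.setReg_reg]
  · simp [Expr.eval, h₁.cur, h₁.front, hh.cur] at h6

/-- The extra round is the one that finds the tour complete and clears the loop condition. -/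
theorem walkLoop_runs (hP : G.IsPeriodic 2) (hm₀ : Tables G o best m₀)
    (hW : 2 * n ≤ W) {k : ℕ} (hsteps : Agent.Steps G o best k c c') (hh : c'.Halted)
    (hd : c'.date ≤ W) (hs : Agent.Sound G o c) (h : Refines m₀ c m) :
    Runs W (.loop (.reg 9) walkBody) m ((k + 1) * (2 + walkBody.time) + 2) (Finished c') := by
  induction hsteps generalizing m with
  | refl c =>
    obtain ⟨j, m₁, h1, h2, h3⟩ := walkBody_halts hW h hh
    refine ⟨_, m₁, .loop_step m m₁ m₁ j _ _ _ ?_ h1 (.loop_done m₁ _ _ h3.inactive), ?_, h3⟩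
    · simp [Expr.eval, h.active]
    · simp only [Expr.cost]
      omega
  | @head c c₁ c₂ k h1 h2 ih =>
    obtain ⟨j, m₁, k1, k2, k3⟩ := walkBody_runs hP hm₀ hW h hs h1 (h2.date_le.trans hd)
    obtain ⟨i, m₂, l1, l2, l3⟩ := ih hh hd (h1.sound hP hs) k3
    refine ⟨_, m₂, .loop_step m m₁ m₂ j i _ _ ?_ k1 l1, ?_, l3⟩
    · simp [Expr.eval, h.active]
    · simp only [Expr.cost]
      rw [Nat.succ_mul]
      omega

end Walk

def startWalk : Prog :=
  .seq (.setReg 2 (.reg 1)) <| .seq (.setReg 3 (.const 0)) <| .seq (.setReg 8 (.const 0)) <|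
  .seq (.setReg 9 (.const 1)) settleProg

def report : Prog := .seq (.setReg 0 (.reg 3)) (.setReg 1 (.reg 8))

def walkProg : Prog := .seq startWalk (.seq (.loop (.reg 9) walkBody) report)

/-- The agent at the start of its tour. -/
noncomputable def firstAgent {n : ℕ} (G : TVG (Fin n)) (o : Fin n) (par : Fin n → Fin n) (l : List (Fin n))
    (best : Fin n → ℕ → ℕ) : Agent n where
  cur := o
  date := 0
  todo v b := ((kids par l (n - 1) v).filter fun u => fastOdd (G.branchCost o v u) = b).reverse
  front := o
  last := best o 0
  out := []

section Start

variable {n : ℕ} {G : TVG (Fin n)} {o : Fin n} {par : Fin n → Fin n} {l : List (Fin n)}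
  {best : Fin n → ℕ → ℕ}

theorem fastOdd_le (c : ℕ → ℕ) : fastOdd c ≤ 1 := by
  unfold fastOdd
  split_ifs <;> omega

theorem Queue.firstAgent_full (hq : Queue o par l) (hT : G.graph.IsTree)
    (hpar : G.IsParent o par) (v : Fin n) : Agent.Full G o (firstAgent G o par l best) v := by
  have hmem : ∀ u b, u ∈ (firstAgent G o par l best).todo v b ↔
      u ∈ G.children o v ∧ fastOdd (G.branchCost o v u) = b := fun u b => by
    simp [firstAgent, mem_kids_iff hq hT hpar]
  have hrest : ∀ u, u ∈ (firstAgent G o par l best).rest v ↔ u ∈ G.children o v := fun u => by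
    rw [Agent.rest, List.mem_append, hmem, hmem]
    have := fastOdd_le (G.branchCost o v u)
    constructor
    · rintro (h | h) <;> exact h.1
    · intro h
      rcases Nat.le_one_iff_eq_zero_or_eq_one.1 this with h' | h'
      · exact Or.inl ⟨h, h'⟩
      · exact Or.inr ⟨h, h'⟩
  have hnd : ∀ b, ((firstAgent G o par l best).todo v b).Nodup := fun b =>
    List.nodup_reverse.2 ((hq.nodup_kids _ v).filter _)
  refine ⟨⟨?_, fun u hu => (hrest u).1 hu, fun b _ u hu => ((hmem u b).1 hu).2⟩,
    fun u hu => (hrest u).2 hu⟩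
  rw [Agent.rest, List.nodup_append]
  refine ⟨hnd 0, hnd 1, fun a ha b hb hab => ?_⟩
  subst hab
  have h0 := ((hmem a 0).1 ha).2
  have h1 := ((hmem a 1).1 hb).2
  omega

variable {m₀ m : Mem}

theorem Covered.bestLast (hT : G.graph.IsTree) (hP : G.IsPeriodic 2)
    (hpar : G.IsParent o par) (hq : Queue o par l) (hm : Covered G o par l m₀ m) :
    Agent.BestLast G o (fun v p => m.arr 17 (v + v + p)) := by
  intro v p hp
  have hkids : ∀ u, u ∈ kids par l (n - 1) v ↔ u ∈ G.children o v := fun u =>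
    mem_kids_iff hq hT hpar
  have hb := hm.best v p hp
  have hcost := hq.isBest_cost hT hP hpar hkids hb
  rcases hb with ⟨h1, h2, -⟩ | ⟨u, h1, h2, h3, -⟩
  · refine Or.inl ⟨Set.eq_empty_iff_forall_notMem.2 fun u hu => ?_, h2⟩
    rw [← hkids, h1] at hu
    cases hu
  · refine Or.inr ⟨u, (hkids u).1 h1, h2, fun L hnd hL => ?_⟩
    have hperm : L.Perm ((kids par l (n - 1) v).erase u) := by
      refine List.Perm.cons_inv (a := u) (List.Perm.trans ?_ (List.perm_cons_erase h1))
      rw [List.perm_ext_iff_of_nodup hnd (hq.nodup_kids _ _)]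
      intro w
      rw [hL, hkids]
    rw [← hcost, h3, lastDate, coverDate, coverDate, listCost_perm hperm]

theorem Covered.tables (hT : G.graph.IsTree) (hpar : G.IsParent o par)
    (hm₀ : Costed G o par l m₀) (hm : Covered G o par l m₀ m) :
    Tables G o (fun v p => m.arr 17 (v + v + p)) m := by
  have hpu : ∀ {u v}, u ∈ G.children o v → u ≠ o ∧ par u = v := (hpar.mem_children_iff hT).1
  refine ⟨?_, ?_, fun _ _ _ => rfl, ?_⟩
  · intro u v hu p hp
    obtain ⟨h1, rfl⟩ := hpu hu
    rw [hm.frame 8 (by decide) (by decide)]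
    exact hm₀.wait u h1 p hp
  · intro u v hu
    obtain ⟨h1, rfl⟩ := hpu hu
    rw [hm.frame 7 (by decide) (by decide)]
    exact hm₀.parent u h1
  · intro v p hp
    rcases hm.best v p hp with ⟨-, h2, -⟩ | ⟨u, -, h2, -⟩
    · exact h2.trans_le (Nat.zero_le n)
    · exact h2.trans_le u.2

/-- The running time of the last phase. -/
def walkTime (n : ℕ) : ℕ :=
  startWalk.time + ((8 * n + 1) * (2 + walkBody.time) + 2 + report.time)

theorem walkProg_runs {W : ℕ} (hT : G.graph.IsTree) (hP : G.IsPeriodic 2)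
    (hpar : G.IsParent o par) (hq : Queue o par l) (hm₀ : Costed G o par l m₀)
    (hm : Covered G o par l m₀ m) (hW : 4 * n ≤ W) :
    Runs W walkProg m (walkTime n) (fun m' => ∃ J, G.IsOptimal o J ∧ Outputs m' J) := by
  obtain ⟨best, hbest⟩ : ∃ best : Fin n → ℕ → ℕ, best = fun (v : Fin n) p => m.arr 17 (v + v + p) := ⟨_, rfl⟩
  have htab := Covered.tables hT hpar hm₀ hm
  have hlast := Covered.bestLast hT hP hpar hq hm
  rw [← hbest] at htab hlast
  obtain ⟨c, hc⟩ : ∃ c, c = firstAgent G o par l best := ⟨_, rfl⟩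
  have hcur : c.cur = o := by rw [hc]; rfl
  have hdate : c.date = 0 := by rw [hc]; rfl
  have hfront : c.front = o := by rw [hc]; rfl
  have hout : c.out = [] := by rw [hc]; rfl
  have hl : c.last = best o 0 := by rw [hc]; rfl
  obtain ⟨k, c', h1, h2, h3, h4, h5, h6⟩ := Agent.exists_optimal hT hP hlast hcur hdate hfront hl hout
    (fun w => hc ▸ hq.firstAgent_full hT hpar w)
  have hsound : Agent.Sound G o c := by
    refine ⟨?_, ?_, ?_, ?_⟩
    · rw [hout]; trivial
    · rw [hout, hcur]; rfl
    · rw [hout, hdate]; rfl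
    · rw [hout]; exact Nat.zero_le _
  have hon := o.2
  have hb0 := htab.last_le o 0 (by omega)
  have hstart : Runs W startWalk m startWalk.time (Refines m c) := by
    apply Prog.runs_of_wp
    refine wp_setReg (w := o) (by simp [Expr.eval, hm.start]) (by omega) ?_
    refine wp_setReg (w := 0) rfl (by omega) ?_
    refine wp_setReg (w := 0) rfl (by omega) ?_
    refine wp_setReg (w := 1) rfl (by omega) ?_
    refine wp_setReg (w := o) (by simp [Expr.eval, Mem.setReg_reg]) (by omega) ?_
    refine wp_setReg (w := best o 0) ?_ (by omega) ?_
    · simp [Expr.pair_eval, Expr.eval, Mem.setReg_reg, Mem.setReg_arr, hbest]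
    · constructor
      · simp [Mem.setReg_reg, hcur]
      · simp [Mem.setReg_reg, hdate]
      · simp [Mem.setReg_reg, hfront]
      · simp [Mem.setReg_reg, hl]
      · simp [Mem.setReg_reg, hout]
      · simp [Mem.setReg_reg]
      · intro a _ _ _; rfl
      · intro v b hb
        simp only [Mem.setReg_arr, hm.frame 14 (by decide) (by decide),
          hm.frame 15 (by decide) (by decide), hc]
        exact hm₀.chain v b hb
      · intro j hj
        rw [hout] at hj
        cases hj
  refine (hstart.seq fun m₁ hm₁ => (walkLoop_runs hP htab (by omega) h1 h2 (by omega) hsound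
    hm₁).seq fun m₂ hm₂ => Prog.runs_of_wp (P := report)
      (Q := fun m' => ∃ J, G.IsOptimal o J ∧ Outputs m' J) ?_).mono ?_ fun _ h => h
  · have := h4.length
    refine wp_setReg (w := c'.date) (by simp [Expr.eval, hm₂.date]) (by omega) ?_
    refine wp_setReg (w := c'.out.length) (by simp [Expr.eval, Mem.setReg_reg, hm₂.length])
      (by omega) ⟨c'.out, h6, ?_, ?_, hm₂.moves⟩
    · simp [Mem.setReg_reg, h4.date]
    · simp [Mem.setReg_reg]
  · have : (k + 1) * (2 + walkBody.time) ≤ (8 * n + 1) * (2 + walkBody.time) :=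
      Nat.mul_le_mul_right _ (by omega)
    unfold walkTime
    omega

end Start

/-- The program for the dynamic map visitation problem. -/
def visitProg : Prog :=
  .seq orderProg <|
  .seq (.setReg 2 (.const 0)) <| .seq (.loop moreEdges costBody) <|
  .seq (.setReg 2 (.const 0)) <| .seq (.loop moreEdges coverBody) walkProg

theorem visitProg_runs : ∃ C, ∀ (n : ℕ) (G : TVG (Fin n)) (o : Fin n) (m : Mem),
    G.graph.IsTree → G.IsPeriodic 2 → Encodes G o m →
    Runs (C * n) visitProg m (C * n) (fun m' => ∃ J, G.IsOptimal o J ∧ Outputs m' J) := by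
  obtain ⟨C₀, hC₀⟩ := orderProg_runs
  obtain ⟨a, ha⟩ : ∃ a, a = moreEdges.cost + 1 + costBody.time := ⟨_, rfl⟩
  obtain ⟨b, hb⟩ : ∃ b, b = moreEdges.cost + 1 + coverBody.time := ⟨_, rfl⟩
  obtain ⟨d, hd⟩ : ∃ d, d = moreEdges.cost + 1 := ⟨_, rfl⟩
  obtain ⟨s, hs⟩ : ∃ s, s = startWalk.time := ⟨_, rfl⟩
  obtain ⟨w, hw⟩ : ∃ w, w = 2 + walkBody.time := ⟨_, rfl⟩
  obtain ⟨r, hr⟩ : ∃ r, r = report.time := ⟨_, rfl⟩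
  -- The coefficients of the phases are added up; `9 * w` covers the at most `8 * n + 1` rounds of
  -- the tour, and `16` makes room for the largest words.
  refine ⟨C₀ + 2 + (a + d) + 2 + (b + d) + (s + 9 * w + 2 + r) + 16, ?_⟩
  intro n G o m hT hP hE
  obtain ⟨C, hC⟩ : ∃ C, C = C₀ + 2 + (a + d) + 2 + (b + d) + (s + 9 * w + 2 + r) + 16 := ⟨_, rfl⟩
  rw [← hC]
  have hn : 1 ≤ n := o.pos
  have h16 : 16 * n ≤ C * n := Nat.mul_le_mul_right _ (by omega)
  obtain ⟨par, hpar⟩ := exists_isParent hT o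
  have hzero : ∀ m : Mem, Runs (C * n) (.setReg 2 (.const 0)) m 2 (fun m' => m' = m.setReg 2 0) :=
    fun m => setReg_runs rfl (Nat.zero_le _) rfl
  have hrun : Runs (C * n) visitProg m (C₀ * n + (2 + (((n - 1) * a + d) + (2 +
      (((n - 1) * b + d) + walkTime n)))))
      (fun m' => ∃ J, G.IsOptimal o J ∧ Outputs m' J) := by
    refine (hC₀ n G o par m (C * n) hT hpar hE (by omega)).seq fun m₁ hm₁ => ?_
    obtain ⟨l, hq, hm₁⟩ := hm₁
    refine (hzero m₁).seq fun m₂ hm₂ => ?_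
    subst hm₂
    rw [ha, hb, hd]
    refine (costLoop_runs hT hP hpar hq hm₁ (by omega)).seq fun m₃ hm₃ => ?_
    refine (hzero m₃).seq fun m₄ hm₄ => ?_
    subst hm₄
    refine (coverLoop_runs hT hP hpar hq hm₃ h16).seq fun m₅ hm₅ => ?_
    exact walkProg_runs hT hP hpar hq hm₃ hm₅ (by omega)
  refine hrun.mono ?_ fun _ h => h
  rw [walkTime, ← hs, ← hw, ← hr, hC]
  obtain ⟨k, rfl⟩ : ∃ k, n = k + 1 := ⟨n - 1, by omega⟩
  simp only [Nat.add_sub_cancel]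
  -- With `n = k + 1` no subtraction is left, and the final bracket is the slack in the estimate.
  have e : (C₀ + 2 + (a + d) + 2 + (b + d) + (s + 9 * w + 2 + r) + 16) * (k + 1) =
      C₀ * (k + 1) + (2 + ((k * a + d) + (2 + ((k * b + d) +
        (s + ((8 * (k + 1) + 1) * w + 2 + r)))))) +
      (k * 2 + a + k * d + k * 2 + b + k * d + k * s + k * w + k * 2 + k * r + 16 * (k + 1)) := by
    ring
  rw [e]
  exact Nat.le_add_right _ _

end RAM

theorem theorem15 :
    -- one program solves the problem in linear time, with words of logarithmic length
    (∃ (P : RAM.Prog) (C : ℕ), ∀ (n : ℕ) (G : TVG (Fin n)) (o : Fin n),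
      G.graph.IsTree → G.IsPeriodic 2 → ∀ m : RAM.Mem, RAM.Encodes G o m →
        ∃ (k : ℕ) (m' : RAM.Mem), RAM.Exec (C * n) P m k m' ∧ k ≤ C * n ∧
          ∃ J : List (Fin n × ℕ), G.IsOptimal o J ∧ RAM.Outputs m' J) ∧
    (∀ (V : Type*) [Finite V] (G : TVG V) (o : V), G.graph.IsTree → G.IsPeriodic 2 →
      -- some optimal solution enters every subtree only once
      (∃ J, G.IsOptimal o J ∧ ∀ u, u ≠ o → TVG.entries (G.subtree o u) o J = 1) ∧
      -- subtrees and branches can be covered with return, and have a type, with its parity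
      (∀ (S : Set V) (r : V),
        (S = G.subtree o r ∨ ∃ u ∈ G.children o r, S = G.branch o r u) →
          (∀ t, (G.returnCosts S r t).Nonempty) ∧
          ((G.FW11 S r ∧ Even (G.fastestReturn S r)) ∨
           (G.FW10 S r ∧ Odd (G.fastestReturn S r)) ∨
           (G.FW01 S r ∧ Odd (G.fastestReturn S r)))) ∧
      -- costs of a branch in terms of those of the child subtree
      (∀ (v : V), ∀ u ∈ G.children o v, ∀ t : ℕ,
        t + G.returnCost (G.branch o v u) v t =
          G.crossed s(v, u) (G.crossed s(v, u) t +
            G.returnCost (G.subtree o u) u (G.crossed s(v, u) t)) ∧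
        t + G.coverCost (G.branch o v u) v t =
          G.crossed s(v, u) t + G.coverCost (G.subtree o u) u (G.crossed s(v, u) t)) ∧
      -- alternating orders exist, and each of them is optimal for coverage with return
      (∀ (v : V) (t : ℕ),
        (∃ L : List V, L.Nodup ∧ (∀ u, u ∈ L ↔ u ∈ G.children o v) ∧ G.Alternating o v t L) ∧
        ∀ L : List V, L.Nodup → (∀ u, u ∈ L ↔ u ∈ G.children o v) → G.Alternating o v t L →
          t + G.returnCost (G.subtree o v) v t = G.serve o v t L) ∧
      -- coverage without return: alternate over all children but one, and end with that one
      (∀ (v : V) (t : ℕ),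
        (G.children o v = ∅ → G.coverCost (G.subtree o v) v t = 0) ∧
        ((G.children o v).Nonempty → IsLeast
          {x | ∃ (u : V) (L : List V), (u :: L).Nodup ∧
            (∀ w, w ∈ u :: L ↔ w ∈ G.children o v) ∧ G.Alternating o v t L ∧
            x = G.serve o v t L + G.coverCost (G.branch o v u) v (G.serve o v t L)}
          (t + G.coverCost (G.subtree o v) v t)))) := by
  refine ⟨?_, fun V _ G o hT hP => hP.tree_structure hT o⟩
  obtain ⟨C, hC⟩ := RAM.visitProg_runs
  exact ⟨RAM.visitProg, C, fun n G o hT hP m hm => hC n G o m hT hP hm⟩
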